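/- **Setting.** Let ${\sf A}=\begin{pmatrix}1&\cos(\pi/3)\\0&\sin(\pi/3)\end{pmatrix}$, let $\Lambda^{\rm hom}={\sf A}\mathbb Z^2$ be the triangular lattice with its six nearest-neighbour vectors $a_1,\dots,a_6$, and let $\mathcal T_{\rm a}$ be its micro-triangulation into the triangles ${\sf A}(\xi\pm\mathrm{conv}\{0,e_1,e_2\})$, $\xi\in\mathbb Z^2$. Let $\Lambda=\Lambda^{\rm hom}\setminus\Lambda^{\rm def}$ with a finite set $\Lambda^{\rm def}$ of vacancies. Every site $\ell\in\Lambda$ has the interaction range $\mathscr R_\ell=\{a_j:\ell+a_j\in\Lambda\}$ and a $C^2$ site potential $V_\ell$ of $Dy(\ell)=(y(\ell+\rho)-y(\ell))_{\rho\in\mathscr R_\ell}$. There is a defect core $D^{\rm def}\supset\Lambda^{\rm def}$ such that $V_\ell=V$ and $\mathscr R_\ell=\{a_1,\dots,a_6\}$ for $\ell\notin D^{\rm def}$, where $V$ is a fixed $C^2$ potential. Put $\mathscr E^{\rm a}(y)=\sum_{\ell\in\Lambda}V_\ell(Dy(\ell))$ (understood through energy differences), $W({\sf F})=\frac1{\det{\sf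 A}}V(({\sf F}a_j)_j)$ and $\partial W({\sf F})=\frac1{\det {\sf A}}\sum_j\partial_jV(({\sf F}a_k)_k)\otimes a_j$. A lattice function is identified with its continuous interpolant that is affine on each $T\in\mathcal T_{\rm a}$; at vacancy sites it is given arbitrary values (an extension of the function on $\Lambda$). Let $\mathscr U^{1,2}$ be the space of those $v:\Lambda^{\rm hom}\to\mathbb R^2$ with $\nabla v\in L^2$, and let $\delta\mathscr E^{\rm a}(y)$ be the linear functional on $\mathscr U^{1,2}$, bounded with respect to $\|\nabla v\|_{L^2}$, that equals the directional derivative of $\mathscr E^{\rm a}$ at $y$ for all $v$ for which $\nabla v$ has compact support. **A/c coupling.** Let $R>6$, let $\Omega_R\supset B_R=\{|x|\le R\}$ be a polygonal domain with a finite conforming triangulation $\mathcal T_h$, and let $\kappa$ be a shape regularity constant: $(\operatorname{diam}T)^2\le\kappa|T|$ for all $T\in\mathcal T_h$. Let $\mathcal T_h^{\rm a}\subset\mathcal T_h$ consist of triangles of $\mathcal T_{\rm a}$ (vacancy sites being kept as nodes), and let their union $\Omega^{\rm a}$ contain $D^{\rm def}$; all elements with a vacancy as a vertex are in $\mathcal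 T^{\rm a}_h$. The sites of $\Lambda\cap\Omega^{\rm a}$ are split into core sites $\Lambda^{\rm a}\supset\Lambda\cap D^{\rm def}$ and interface sites $\Lambda^{\rm i}$. For reconstruction parameters $C_{\ell;\rho,\varsigma}$ put $V^{\rm i}_\ell(g)=V\big((\sum_\varsigma C_{\ell;\rho,\varsigma}g_\varsigma)_\rho\big)$, and $$\mathscr E^{\rm h}(y_h)=\sum_{\ell\in\Lambda^{\rm a}}V_\ell(Dy_h(\ell))+\sum_{\ell\in\Lambda^{\rm i}}\omega_\ell V_\ell^{\rm i}(Dy_h(\ell))+\sum_{T\in\mathcal T_h}\omega_TW(\nabla y_h|_T),$$ where $\omega_\ell\ge0$, $0\le\omega_T\le|T|$, and, for elements $T$ that contain no interface site, $\omega_T=0$ if $T\in\mathcal T_h^{\rm a}$ and $\omega_T=|T|$ otherwise. Assume that every bond $(\ell,\ell+\rho)$ of $\Lambda$ on which one of the first two sums depends is an edge of $\mathcal T_h$. Let $\mathscr U_{h,R}$ be the space of continuous functions that are affine on each $T\in\mathcal T_h$ and vanish on $\partial\Omega_R$ (extended by $0$). For ${\sf B}\in\mathbb R^{2\times2}$ let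 $y_h$ with $y_h-{\sf B}x\in\mathscr U_{h,R}$ be an a/c solution: $\langle\delta\mathscr E^{\rm h}(y_h),v_h\rangle=0$ for all $v_h\in\mathscr U_{h,R}$; this holds in particular for every minimizer of $\mathscr E^{\rm h}$ over ${\sf B}x+\mathscr U_{h,R}$. Let $I_{\rm a}y_h$ be the lattice function $\ell\mapsto y_h(\ell)$. **Stresses.** For $T\in\mathcal T_{\rm a}$ and $T\in\mathcal T_h$, respectively, let $$\sigma^{\rm a}(y;T)=\frac1{\det{\sf A}}\sum_{(\ell,\ell+\rho)\subset\partial T}\partial_\rho V_\ell(Dy(\ell))\otimes\rho,\qquad |T|\,\sigma^{\rm h}(y_h;T)=\frac12\sum_{(\ell,\ell+\rho)\subset\partial T}\partial_\rho V^{\rm h}_\ell(Dy_h(\ell))\otimes\rho+\omega_T\,\partial W(\nabla y_h|_T),$$ the sums being over the directed nearest-neighbour bonds of $\Lambda$ that are edges of $T$, with $V_\ell^{\rm h}=V_\ell$ on $\Lambda^{\rm a}$, $V_\ell^{\rm h}=\omega_\ell V_\ell^{\rm i}$ on $\Lambda^{\rm i}$, and $V^{\rm h}_\ell=0$ elsewhere.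 Let $\sigma^0=\partial W({\sf B})$. Matrix norms are Frobenius norms. **Theorem.** There is an absolute constant $C^{\rm Tr}>0$, and for every $\kappa$ a constant $C'>0$ that depends only on $\kappa$, such that, in every such situation, $\delta\mathscr E^{\rm a}(I_{\rm a}y_h)$ exists and is unique, and $$\langle\delta\mathscr E^{\rm a}(I_{\rm a}y_h),v\rangle\le(\eta_T+\eta_M+\eta_C)\,\|\nabla v\|_{L^2}\qquad\text{for all }v\in\mathscr U^{1,2},$$ where $$\eta_T=C^{\rm Tr}\,\|\sigma^{\rm a}(I_{\rm a}y_h)-\sigma^0\|_{L^2(\Omega_R^+\setminus B_{R/2})},\qquad \Omega_R^+=\{x:\operatorname{dist}(x,\Omega_R)\le2\},$$ $$\eta_M=C^{\rm Tr}\Big\{\sum_{T\in\mathcal T_{\rm a},\,T\subset\Omega_R}|T|\,\Big|\sigma^{\rm a}(I_{\rm a}y_h;T)-\sum_{T'\in\mathcal T_h}\frac{|T'\cap T|}{|T|}\sigma^{\rm h}(y_h;T')\Big|^2\Big\}^{1/2},$$ $$\eta_C=\sqrt3\,C^{\rm Tr}C'\Big(\sum_{f}\big(h_f\,|\sigma^{\rm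 h}(y_h;T_f^+)\nu^++\sigma^{\rm h}(y_h;T_f^-)\nu^-|\big)^2\Big)^{1/2},$$ the last sum being over the interior edges $f$ of $\mathcal T_h$, with length $h_f$, adjacent elements $T_f^\pm$ and their outward unit normals $\nu^\pm$ on $f$. -/

import Mathlib

noncomputable section

namespace GRAC

open MeasureTheory

/-- The Euclidean plane. -/
abbrev Plane : Type := EuclideanSpace ℝ (Fin 2)

/-! ### The triangular lattice and its micro-triangulation -/

/-- Lattice sites `ξ ∈ ℤ²`, standing for the points `A ξ` of the homogeneous lattice. -/
abbrev Site : Type := ℤ × ℤ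

/-- The matrix of the triangular lattice. -/
def latticeMatrix : Matrix (Fin 2) (Fin 2) ℝ :=
  !![1, Real.cos (Real.pi / 3); 0, Real.sin (Real.pi / 3)]

/-- The point `A ξ` of the reference lattice. -/
def pos (ξ : Site) : Plane :=
  WithLp.toLp 2 (latticeMatrix.mulVec ![(ξ.1 : ℝ), (ξ.2 : ℝ)])

/-- The six nearest-neighbour directions in lattice coordinates, clockwise from `a₁ = (1, 0)`. -/
def dir : Fin 6 → Site := ![(1, 0), (1, -1), (0, -1), (-1, 0), (-1, 1), (0, 1)]

/-- The six nearest-neighbour vectors in the plane. -/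
def nn (j : Fin 6) : Plane := pos (dir j)

/-- Stencils `(g_ρ)_ρ`, indexed by the six nearest-neighbour directions. -/
abbrev Stencil : Type := Fin 6 → Plane

/-- Triangles of the micro-triangulation: `(ξ, true)` is `A (ξ + conv {0, e₁, e₂})` and
`(ξ, false)` is `A (ξ - conv {0, e₁, e₂})`. -/
abbrev Micro : Type := Site × Bool

/-- The sign in `A (ξ ± conv {0, e₁, e₂})`. -/
def Micro.sgn (τ : Micro) : ℤ := if τ.2 then 1 else -1

/-- The lattice sites that are the vertices of a micro-triangle. -/
def Micro.sites (τ : Micro) : Finset Site :=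
  {τ.1, τ.1 + (τ.sgn, 0), τ.1 + (0, τ.sgn)}

/-- The vertices of a micro-triangle, as points of the plane. -/
def Micro.verts (τ : Micro) : Finset Plane := by
  classical exact τ.sites.image pos

/-- The closed triangle with the given vertices (used for any finite vertex set). -/
def hull (T : Finset Plane) : Set Plane := convexHull ℝ (T : Set Plane)

/-- The area `|T|`. -/
def area (T : Finset Plane) : ℝ := volume.real (hull T)

/-- The square `|M|²` of the Frobenius norm. -/
def frobSq (M : Matrix (Fin 2) (Fin 2) ℝ) : ℝ := ∑ i, ∑ j, M i j ^ 2

/-- The constant gradient on the micro-triangle `τ` of the continuous piecewise affine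
interpolant of a lattice function: `∇w · (A e_j) = ± (w (ξ ± e_j) - w ξ)`. -/
def microGrad (w : Site → Plane) (τ : Micro) : Matrix (Fin 2) (Fin 2) ℝ :=
  (Matrix.of fun i j =>
    (τ.sgn : ℝ) * (w (τ.1 + ![((τ.sgn, 0) : Site), (0, τ.sgn)] j) i - w τ.1 i)) *
    latticeMatrix⁻¹

lemma microGrad_add (v w : Site → Plane) (τ : Micro) :
    microGrad (v + w) τ = microGrad v τ + microGrad w τ := by
  unfold microGrad
  rw [← Matrix.add_mul]
  congr 1
  ext i j
  simp
  ring

lemma microGrad_smul (c : ℝ) (w : Site → Plane) (τ : Micro) :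
    microGrad (c • w) τ = c • microGrad w τ := by
  unfold microGrad
  rw [← Matrix.smul_mul]
  congr 1
  ext i j
  simp
  ring

lemma frobSq_nonneg (M : Matrix (Fin 2) (Fin 2) ℝ) : 0 ≤ frobSq M :=
  Finset.sum_nonneg fun _ _ => Finset.sum_nonneg fun _ _ => sq_nonneg _

lemma frobSq_add_le (M N : Matrix (Fin 2) (Fin 2) ℝ) :
    frobSq (M + N) ≤ 2 * frobSq M + 2 * frobSq N := by
  simp only [frobSq, Fin.sum_univ_two, Matrix.add_apply]
  nlinarith [sq_nonneg (M 0 0 - N 0 0), sq_nonneg (M 0 1 - N 0 1),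
    sq_nonneg (M 1 0 - N 1 0), sq_nonneg (M 1 1 - N 1 1)]

lemma frobSq_smul (c : ℝ) (M : Matrix (Fin 2) (Fin 2) ℝ) :
    frobSq (c • M) = c ^ 2 * frobSq M := by
  simp only [frobSq, Fin.sum_univ_two, Matrix.smul_apply, smul_eq_mul]
  ring

/-- The discrete energy space: lattice functions whose piecewise affine interpolant has its
gradient in `L²`.  Lattice functions are defined on the whole homogeneous lattice; when there are
vacancies, a function on the defective lattice is represented by any of its extensions. -/
def energySpace : Submodule ℝ (Site → Plane) where
  carrier := {w | Summable fun τ : Micro => area τ.verts * frobSq (microGrad w τ)}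
  add_mem' := by
    intro v w hv hw
    refine Summable.of_nonneg_of_le
      (fun τ => mul_nonneg measureReal_nonneg (frobSq_nonneg _)) (fun τ => ?_)
      ((hv.mul_left 2).add (hw.mul_left 2))
    rw [microGrad_add]
    have h := mul_le_mul_of_nonneg_left (frobSq_add_le (microGrad v τ) (microGrad w τ))
      (measureReal_nonneg : 0 ≤ area τ.verts)
    calc area τ.verts * frobSq (microGrad v τ + microGrad w τ)
        ≤ area τ.verts * (2 * frobSq (microGrad v τ) + 2 * frobSq (microGrad w τ)) := h
      _ = _ := by ring
  zero_mem' := by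
    have h : ∀ τ : Micro, microGrad (0 : Site → Plane) τ = 0 := by
      intro τ
      simpa using microGrad_smul 0 0 τ
    simp [h, frobSq, summable_zero]
  smul_mem' := by
    intro c w hw
    have h : (fun τ : Micro => area τ.verts * frobSq (microGrad (c • w) τ)) =
        fun τ : Micro => c ^ 2 * (area τ.verts * frobSq (microGrad w τ)) := by
      funext τ
      rw [microGrad_smul, frobSq_smul]
      ring
    change Summable _
    rw [h]
    exact hw.mul_left _

/-- `‖∇w‖_{L²}`, the `L²` norm of the piecewise constant gradient. -/
def gradNorm (w : Site → Plane) : ℝ :=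
  Real.sqrt (∑' τ : Micro, area τ.verts * frobSq (microGrad w τ))

/-- `∇w` has compact support. -/
def CompactGrad (w : Site → Plane) : Prop := {τ : Micro | microGrad w τ ≠ 0}.Finite

/-! ### The atomistic model -/

/-- The partial derivative `∂_j V (g)` with respect to the `j`-th stencil entry, as a vector. -/
def partialGrad (V : Stencil → ℝ) (g : Stencil) (j : Fin 6) : Plane :=
  WithLp.toLp 2 fun i => fderiv ℝ V g (Pi.single j (EuclideanSpace.single i 1))

/-- The tensor product `u ⊗ a`. -/
def tensor (u a : Plane) : Matrix (Fin 2) (Fin 2) ℝ := Matrix.vecMulVec u.ofLp a.ofLp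

/-- A crystal with nearest-neighbour interaction and point defects (vacancies and impurities). -/
structure Crystal where
  /-- the vacancy sites; the reference lattice `Λ` is the complement -/
  vac : Finset Site
  /-- the homogeneous site potential -/
  V : Stencil → ℝ
  /-- the site potentials `V_ℓ` -/
  Vsite : Site → Stencil → ℝ
  /-- the defect core -/
  core : Set Plane
  contDiff_V : ContDiff ℝ 2 V
  contDiff_Vsite : ∀ ℓ, ContDiff ℝ 2 (Vsite ℓ)
  vac_mem_core : ∀ ℓ ∈ vac, pos ℓ ∈ core
  /-- away from the defect core, the site potential and the interaction range are homogeneous -/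
  homogeneous : ∀ ℓ, pos ℓ ∉ core → Vsite ℓ = V ∧ ∀ j, ℓ + dir j ∉ vac

namespace Crystal

/-- The finite difference stencil `Dy(ℓ) = (y(ℓ+ρ) - y(ℓ))_ρ`; the entries of directions
outside the interaction range of `ℓ` (those that point to a vacancy) are set to `0`, so that
`V_ℓ(Dy(ℓ))` is a function of the differences in the interaction range only. -/
def stencil (X : Crystal) (y : Site → Plane) (ℓ : Site) : Stencil := fun j =>
  if ℓ + dir j ∈ X.vac then 0 else y (ℓ + dir j) - y ℓ

/-- The energy difference `E^a(z) - E^a(y)`, summed over the sites of `Λ`. -/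
def energyDiff (X : Crystal) (y z : Site → Plane) : ℝ :=
  ∑' ℓ : {ℓ : Site // ℓ ∉ X.vac},
    (X.Vsite ℓ (X.stencil z ℓ) - X.Vsite ℓ (X.stencil y ℓ))

/-- `L` is the first variation `δE^a(y)` on the energy space: the bounded linear functional that
is the directional derivative of the energy in all directions with compactly supported gradient
(for such directions the energy difference is a finite sum). -/
def IsFirstVariation (X : Crystal) (y : Site → Plane) (L : energySpace →ₗ[ℝ] ℝ) : Prop :=
  (∃ K : ℝ, ∀ v : energySpace, |L v| ≤ K * gradNorm v) ∧
  ∀ v : energySpace, CompactGrad v →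
    HasDerivAt (fun t : ℝ => X.energyDiff y (y + t • (v : Site → Plane))) (L v) 0

/-- The atomistic stress tensor `σ^a(y; τ)`: the sum of `∂_ρ V_ℓ ⊗ a_ρ` over the directed bonds
`(ℓ, ℓ+ρ)` of `Λ` that are edges of `τ`, divided by `det A`. -/
def stressA (X : Crystal) (y : Site → Plane) (τ : Micro) : Matrix (Fin 2) (Fin 2) ℝ := by
  classical exact
    (1 / latticeMatrix.det) • ∑ ℓ ∈ τ.sites, ∑ j : Fin 6,
      if ℓ + dir j ∈ τ.sites ∧ ℓ ∉ X.vac ∧ ℓ + dir j ∉ X.vac then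
        tensor (partialGrad (X.Vsite ℓ) (X.stencil y ℓ) j) (nn j) else 0

/-- The Cauchy--Born energy density `W(F) = V((F a_j)_j) / det A`. -/
def cauchyBorn (X : Crystal) (F : Plane →L[ℝ] Plane) : ℝ :=
  (1 / latticeMatrix.det) * X.V fun j => F (nn j)

/-- The Cauchy--Born stress `∂W(F)`. -/
def stressCB (X : Crystal) (F : Plane →L[ℝ] Plane) : Matrix (Fin 2) (Fin 2) ℝ :=
  (1 / latticeMatrix.det) • ∑ j : Fin 6, tensor (partialGrad X.V (fun k => F (nn k)) j) (nn j)

end Crystal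

/-! ### Finite element meshes -/

/-- A finite conforming triangulation in the plane: a finite simplicial complex in which every
face is a face of a triangle. -/
structure Triangulation extends Geometry.SimplicialComplex ℝ Plane where
  finite_faces : faces.Finite
  pure : ∀ s ∈ faces, ∃ T ∈ faces, s ⊆ T ∧ T.card = 3

namespace Triangulation

/-- The triangulated domain. -/
def domain (M : Triangulation) : Set Plane := M.toSimplicialComplex.space

/-- The elements (triangles, given by their vertices). -/
def elems (M : Triangulation) : Finset (Finset Plane) := by
  classical exact M.finite_faces.toFinset.filter fun s => s.card = 3

/-- The interior edges: those that are shared by two elements. -/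
def interiorEdges (M : Triangulation) : Finset (Finset Plane) := by
  classical exact M.finite_faces.toFinset.filter fun f =>
    f.card = 2 ∧ (M.elems.filter fun T => f ⊆ T).card = 2

/-- Shape regularity with constant `κ`: `h_T² ≤ κ |T|` for every element. -/
def ShapeRegular (M : Triangulation) (κ : ℝ) : Prop :=
  ∀ T ∈ M.elems, Metric.diam (T : Set Plane) ^ 2 ≤ κ * area T

/-- The coarse-grained displacements: continuous, affine on every element, zero on the boundary
of the domain, and extended by zero outside. -/
def displacements (M : Triangulation) : Set (Plane → Plane) :=
  {u | Continuous u ∧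
    (∀ T ∈ M.elems, ∃ (G : Plane →L[ℝ] Plane) (c : Plane), ∀ x ∈ hull T, u x = G x + c) ∧
    ∀ x, x ∉ interior M.domain → u x = 0}

end Triangulation

/-- The constant gradient on the triangle `T` of a function that is affine on `T`. -/
def elemGrad (u : Plane → Plane) (T : Finset Plane) : Plane →L[ℝ] Plane :=
  fderiv ℝ u (T.centroid ℝ id)

/-- `ν` is the outward unit normal of the triangle `T` on its edge `f`. -/
def IsOutwardNormal (T f : Finset Plane) (ν : Plane) : Prop :=
  ‖ν‖ = 1 ∧ (∀ p ∈ f, ∀ q ∈ f, inner ℝ ν (q - p) = 0) ∧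
    ∀ p ∈ f, ∀ r ∈ T, r ∉ f → inner ℝ ν (r - p) < 0

/-- The outward unit normal of the triangle `T` on its edge `f`. -/
def outwardNormal (T f : Finset Plane) : Plane := Classical.epsilon (IsOutwardNormal T f)

/-! ### The a/c coupling -/

/-- The data of a GRAC atomistic/continuum coupling for the crystal `X`.  Vacancy sites are nodes
of the mesh, and the triangles at them are atomistic elements that carry no energy. -/
structure Coupling (X : Crystal) where
  /-- the radius of the computational domain -/
  R : ℝ
  R_gt : 6 < R
  /-- the mesh of the computational domain `Ω_R` -/
  mesh : Triangulation
  ball_subset : Metric.closedBall 0 R ⊆ mesh.domain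
  /-- the elements in the atomistic region `Ω^a` -/
  meshA : Finset (Finset Plane)
  meshA_subset : meshA ⊆ mesh.elems
  /-- in the atomistic region the mesh is the micro-triangulation -/
  meshA_micro : ∀ T ∈ meshA, ∃ τ : Micro, T = τ.verts
  core_subset : X.core ⊆ ⋃ T ∈ meshA, hull T
  vac_elem : ∀ T ∈ mesh.elems, ∀ ℓ ∈ X.vac, pos ℓ ∈ T → T ∈ meshA
  /-- the core atomistic sites -/
  siteA : Finset Site
  /-- the interface sites -/
  siteI : Finset Site
  disjoint_sites : Disjoint siteA siteI
  mem_sites : ∀ ℓ, ℓ ∈ siteA ∨ ℓ ∈ siteI ↔ ℓ ∉ X.vac ∧ pos ℓ ∈ ⋃ T ∈ meshA, hull T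
  core_siteA : ∀ ℓ, ℓ ∉ X.vac → pos ℓ ∈ X.core → ℓ ∈ siteA
  /-- the reconstruction parameters `C_{ℓ;ρ,ς}` -/
  C : Site → Fin 6 → Fin 6 → ℝ
  /-- the volume ratios `ω_ℓ` of the interface sites -/
  wSite : Site → ℝ
  wSite_nonneg : ∀ ℓ ∈ siteI, 0 ≤ wSite ℓ
  /-- the effective volumes `ω_T` of the elements -/
  wElem : Finset Plane → ℝ
  wElem_nonneg : ∀ T ∈ mesh.elems, 0 ≤ wElem T
  wElem_le : ∀ T ∈ mesh.elems, wElem T ≤ area T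
  wElem_atomistic : ∀ T ∈ meshA, (∀ ℓ ∈ siteI, pos ℓ ∉ hull T) → wElem T = 0
  wElem_continuum : ∀ T ∈ mesh.elems, T ∉ meshA → (∀ ℓ ∈ siteI, pos ℓ ∉ hull T) →
    wElem T = area T
  /-- the bonds on which the atomistic and interface site energies depend are mesh edges -/
  bondA : ∀ ℓ ∈ siteA, ∀ j, ℓ + dir j ∉ X.vac →
    ∃ T ∈ mesh.elems, pos ℓ ∈ T ∧ pos (ℓ + dir j) ∈ T
  bondI : ∀ ℓ ∈ siteI, ∀ j, (∃ i, C ℓ i j ≠ 0) →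
    ∃ T ∈ mesh.elems, pos ℓ ∈ T ∧ pos (ℓ + dir j) ∈ T

namespace Coupling

variable {X : Crystal}

/-- The computational domain `Ω_R`. -/
def domain (S : Coupling X) : Set Plane := S.mesh.domain

/-- The reconstructed interface potential `V^i_ℓ(g) = V(C_ℓ · g)`. -/
def interfaceV (S : Coupling X) (ℓ : Site) (g : Stencil) : ℝ :=
  X.V fun i => ∑ j, S.C ℓ i j • g j

/-- The a/c energy. -/
def energy (S : Coupling X) (y : Plane → Plane) : ℝ :=
  ∑ ℓ ∈ S.siteA, X.Vsite ℓ (X.stencil (y ∘ pos) ℓ) +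
  ∑ ℓ ∈ S.siteI, S.wSite ℓ * S.interfaceV ℓ (X.stencil (y ∘ pos) ℓ) +
  ∑ T ∈ S.mesh.elems, S.wElem T * X.cauchyBorn (elemGrad y T)

/-- The a/c deformations with far-field strain `B`: those `y` with `y - y^B` a coarse-grained
displacement (so `y = y^B` outside the computational domain). -/
def Admissible (S : Coupling X) (B : Plane →L[ℝ] Plane) (y : Plane → Plane) : Prop :=
  (fun x => y x - B x) ∈ S.mesh.displacements

/-- `y` solves the a/c problem: it is admissible and the first variation of the a/c energy at `y`
vanishes in all coarse-grained directions. -/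
def IsSolution (S : Coupling X) (B : Plane →L[ℝ] Plane) (y : Plane → Plane) : Prop :=
  S.Admissible B y ∧
    ∀ v ∈ S.mesh.displacements, deriv (fun t : ℝ => S.energy (y + t • v)) 0 = 0

/-- Minimizers of the a/c energy are solutions. -/
theorem isSolution_of_minimizer (S : Coupling X) (B : Plane →L[ℝ] Plane) (y : Plane → Plane)
    (hy : S.Admissible B y) (hmin : ∀ z, S.Admissible B z → S.energy y ≤ S.energy z) :
    S.IsSolution B y := by
  refine ⟨hy, fun v hv => IsLocalMin.deriv_eq_zero (Filter.Eventually.of_forall fun t => ?_)⟩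
  have h0 : y + (0 : ℝ) • v = y := by simp
  simp only [h0]
  apply hmin
  obtain ⟨hc, ha, hb⟩ := hy
  obtain ⟨hc', ha', hb'⟩ := hv
  have he : (fun x => (y + t • v) x - B x) = fun x => (y x - B x) + t • v x := by
    funext x
    simp only [Pi.add_apply, Pi.smul_apply]
    abel
  refine ⟨?_, ?_, ?_⟩
  · rw [he]
    exact hc.add (hc'.const_smul t)
  · intro T hT
    obtain ⟨G, c, h⟩ := ha T hT
    obtain ⟨G', c', h'⟩ := ha' T hT
    refine ⟨G + t • G', c + t • c', fun x hx => ?_⟩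
    calc (y + t • v) x - B x = (y x - B x) + t • v x := congrFun he x
      _ = (G x + c) + t • (G' x + c') := by rw [← h x hx, ← h' x hx]
      _ = (G + t • G') x + (c + t • c') := by
        simp only [add_apply, smul_apply, smul_add]
        abel
  · intro x hx
    calc (y + t • v) x - B x = (y x - B x) + t • v x := congrFun he x
      _ = 0 + t • v x := congrArg (· + t • v x) (hb x hx)
      _ = 0 := by rw [hb' x hx]; simp

/-- The site potential of `ℓ` in the a/c energy: `V_ℓ` in the core, `ω_ℓ V^i_ℓ` at the
interface, and `0` otherwise. -/
def siteV (S : Coupling X) (ℓ : Site) : Stencil → ℝ := by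
  classical exact
    if ℓ ∈ S.siteA then X.Vsite ℓ
    else if ℓ ∈ S.siteI then fun g => S.wSite ℓ * S.interfaceV ℓ g
    else 0

/-- The a/c stress tensor `σ^h(y; T)`, with
`|T| σ^h = ½ ∑ ∂_ρ V^h_ℓ ⊗ a_ρ + ω_T ∂W(∇y|_T)`, the sum being over the directed bonds
`(ℓ, ℓ+ρ)` of `Λ` that are edges of the element `T`. -/
def stressH (S : Coupling X) (y : Plane → Plane) (T : Finset Plane) :
    Matrix (Fin 2) (Fin 2) ℝ := by
  classical exact
    (area T)⁻¹ •
      ((1 / 2 : ℝ) • (∑ ℓ ∈ S.siteA ∪ S.siteI, ∑ j : Fin 6,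
          if pos ℓ ∈ T ∧ pos (ℓ + dir j) ∈ T ∧ ℓ + dir j ∉ X.vac then
            tensor (partialGrad (S.siteV ℓ) (X.stencil (y ∘ pos) ℓ) j) (nn j) else 0) +
        S.wElem T • X.stressCB (elemGrad y T))

/-- The jump `σ^h(T⁺) ν⁺ + σ^h(T⁻) ν⁻` across an interior edge. -/
def jump (S : Coupling X) (y : Plane → Plane) (f : Finset Plane) : Plane := by
  classical exact
    ∑ T ∈ S.mesh.elems.filter (fun T => f ⊆ T),
      WithLp.toLp 2 ((S.stressH y T).mulVec (outwardNormal T f).ofLp)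

/-- The strip near the outer boundary: the points of `Ω_R`, or of the layer of width two lattice
spacings around it, that lie outside the disc of radius `R / 2`. -/
def outerStrip (S : Coupling X) : Set Plane :=
  Metric.cthickening 2 S.domain \ Metric.closedBall 0 (S.R / 2)

/-- The truncation estimator without its constant: `‖σ^a(I_a y) - ∂W(B)‖_{L²}` over the strip
near the outer boundary. -/
def truncation (S : Coupling X) (B : Plane →L[ℝ] Plane) (y : Plane → Plane) : ℝ :=
  Real.sqrt (∑' τ : Micro, volume.real (hull τ.verts ∩ S.outerStrip) *
    frobSq (X.stressA (y ∘ pos) τ - X.stressCB B))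

/-- The modelling estimator without its constant; the sum is over the micro-triangles in
`Ω_R`. -/
def modelling (S : Coupling X) (y : Plane → Plane) : ℝ := by
  classical exact
    Real.sqrt (∑' τ : Micro, if hull τ.verts ⊆ S.domain then
      area τ.verts * frobSq (X.stressA (y ∘ pos) τ -
        ∑ T ∈ S.mesh.elems,
          (volume.real (hull T ∩ hull τ.verts) / area τ.verts) • S.stressH y T)
      else 0)

/-- The coarsening estimator without its constants. -/
def coarsening (S : Coupling X) (y : Plane → Plane) : ℝ :=
  Real.sqrt (∑ f ∈ S.mesh.interiorEdges, (Metric.diam (f : Set Plane) * ‖S.jump y f‖) ^ 2)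

end Coupling

end GRAC

end

noncomputable section

namespace GRAC

open MeasureTheory Filter Topology

/-! ### Triangles in the plane -/

/-- The planar cross product. -/
def cr (a b : Plane) : ℝ := a 0 * b 1 - a 1 * b 0

/-- The barycentric coordinate of `x` at `p` in the triangle `p q r`. -/
def bary (p q r x : Plane) : ℝ := cr (q - x) (r - x) / cr (q - p) (r - p)

lemma cr_rotate (p q r : Plane) : cr (r - q) (p - q) = cr (q - p) (r - p) := by
  simp only [cr, PiLp.sub_apply]; ring

lemma cr_swap (p q r : Plane) : cr (r - p) (q - p) = -cr (q - p) (r - p) := by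
  simp only [cr, PiLp.sub_apply]; ring

lemma bary_add (p q r x : Plane) (h : cr (q - p) (r - p) ≠ 0) :
    bary p q r x + bary q r p x + bary r p q x = 1 := by
  unfold bary
  rw [cr_rotate q r p, cr_rotate p q r, ← add_div, ← add_div,
    div_eq_one_iff_eq h]
  simp only [cr, PiLp.sub_apply]; ring

lemma bary_combo (p q r x : Plane) (h : cr (q - p) (r - p) ≠ 0) :
    x = bary p q r x • p + bary q r p x • q + bary r p q x • r := by
  unfold bary
  rw [cr_rotate q r p, cr_rotate p q r]
  ext i
  simp only [PiLp.add_apply, PiLp.smul_apply, smul_eq_mul]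
  field_simp
  fin_cases i <;> simp only [cr, PiLp.sub_apply, Fin.zero_eta, Fin.mk_one] <;> ring

lemma bary_of_combo (p q r : Plane) (h : cr (q - p) (r - p) ≠ 0) (a b c : ℝ)
    (habc : a + b + c = 1) : bary p q r (a • p + b • q + c • r) = a := by
  unfold bary
  rw [div_eq_iff h]
  obtain rfl : a = 1 - b - c := by linarith
  simp only [cr, PiLp.sub_apply, PiLp.add_apply, PiLp.smul_apply, smul_eq_mul]
  ring

lemma bary_of_combo₂ (p q r : Plane) (h : cr (q - p) (r - p) ≠ 0) (a b c : ℝ)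
    (habc : a + b + c = 1) : bary q r p (a • p + b • q + c • r) = b := by
  have := bary_of_combo q r p (by rwa [cr_rotate]) b c a (by linarith)
  rwa [show b • q + c • r + a • p = a • p + b • q + c • r by abel] at this

lemma bary_of_combo₃ (p q r : Plane) (h : cr (q - p) (r - p) ≠ 0) (a b c : ℝ)
    (habc : a + b + c = 1) : bary r p q (a • p + b • q + c • r) = c := by
  have := bary_of_combo r p q (by rwa [cr_rotate, cr_rotate]) c a b (by linarith)
  rwa [show c • r + a • p + b • q = a • p + b • q + c • r by abel] at this

@[fun_prop]
lemma continuous_cr {X : Type*} [TopologicalSpace X] {f g : X → Plane} (hf : Continuous f)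
    (hg : Continuous g) : Continuous fun x => cr (f x) (g x) := by
  unfold cr; fun_prop

@[fun_prop]
lemma continuous_bary (p q r : Plane) : Continuous (bary p q r) := by
  unfold bary; fun_prop

lemma hull_triple (p q r : Plane) :
    hull {p, q, r} = {x | ∃ a b c : ℝ, 0 ≤ a ∧ 0 ≤ b ∧ 0 ≤ c ∧ a + b + c = 1 ∧
      x = a • p + b • q + c • r} := by
  classical
  ext x
  simp only [hull, Finset.coe_insert, Finset.coe_singleton, Set.mem_ofPred_eq]
  rw [convexHull_insert (by simp), convexHull_pair, convexJoin_singleton_left]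
  simp only [Set.mem_iUnion, exists_prop]
  constructor
  · rintro ⟨y, ⟨s, t, hs, ht, hst, rfl⟩, ⟨a, b, ha, hb, hab, rfl⟩⟩
    refine ⟨a, b * s, b * t, ha, by positivity, by positivity, ?_, ?_⟩
    · rw [add_assoc, ← mul_add, hst, mul_one, hab]
    · simp only [smul_add, smul_smul, add_assoc]
  · rintro ⟨a, b, c, ha, hb, hc, habc, rfl⟩
    rcases (add_nonneg hb hc).eq_or_lt with h0 | h0
    · have hb0 : b = 0 := by linarith
      have hc0 : c = 0 := by linarith
      refine ⟨q, left_mem_segment _ _ _, ⟨1, 0, by simp, le_rfl, by simp, ?_⟩⟩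
      obtain rfl : a = 1 := by linarith
      simp [hb0, hc0]
    · refine ⟨(b / (b + c)) • q + (c / (b + c)) • r,
        ⟨_, _, by positivity, by positivity, by field_simp, rfl⟩,
        ⟨a, b + c, ha, h0.le, by linarith, ?_⟩⟩
      rw [smul_add, smul_smul, smul_smul, mul_div_cancel₀ _ h0.ne', mul_div_cancel₀ _ h0.ne',
        add_assoc]

lemma mem_hull_triple {p q r : Plane} (h : cr (q - p) (r - p) ≠ 0) (x : Plane) :
    x ∈ hull {p, q, r} ↔ 0 ≤ bary p q r x ∧ 0 ≤ bary q r p x ∧ 0 ≤ bary r p q x := by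
  rw [hull_triple]
  constructor
  · rintro ⟨a, b, c, ha, hb, hc, habc, rfl⟩
    rw [bary_of_combo _ _ _ h _ _ _ habc, bary_of_combo₂ _ _ _ h _ _ _ habc,
      bary_of_combo₃ _ _ _ h _ _ _ habc]
    exact ⟨ha, hb, hc⟩
  · rintro ⟨ha, hb, hc⟩
    exact ⟨_, _, _, ha, hb, hc, bary_add p q r x h, bary_combo p q r x h⟩

lemma hull_pair (p q : Plane) : hull {p, q} = segment ℝ p q := by
  classical
  simp [hull, convexHull_pair]

lemma cr_ne_zero_of_affineIndependent {T : Finset Plane}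
    (hT : AffineIndependent ℝ ((↑) : T → Plane)) {p q r : Plane} (hp : p ∈ T) (hq : q ∈ T)
    (hr : r ∈ T) (hpq : p ≠ q) (hpr : p ≠ r) (hqr : q ≠ r) : cr (q - p) (r - p) ≠ 0 := by
  intro h0
  have h3 := hT.comp_embedding (⟨![⟨p, hp⟩, ⟨q, hq⟩, ⟨r, hr⟩], by
    intro i j hij
    fin_cases i <;> fin_cases j <;> simp_all [eq_comm]⟩ : Fin 3 ↪ T)
  rw [affineIndependent_iff_linearIndependent_vsub ℝ _ (0 : Fin 3)] at h3
  have h4 := h3.comp (![⟨1, by decide⟩, ⟨2, by decide⟩] : Fin 2 → {x : Fin 3 // x ≠ 0}) (by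
    intro i j hij
    fin_cases i <;> fin_cases j <;> simp_all)
  have h5 : LinearIndependent ℝ ![q - p, r - p] := by
    convert! h4 using 1
    ext i : 1
    fin_cases i <;> rfl
  rw [LinearIndependent.pair_iff] at h5
  have key : ∀ i : Fin 2, (r - p) i = 0 ∧ -(q - p) i = 0 := by
    intro i
    apply h5
    ext k
    simp only [cr, PiLp.sub_apply] at h0
    fin_cases i <;> fin_cases k <;>
      simp [PiLp.add_apply, PiLp.smul_apply] <;> linarith
  apply hpr
  ext i
  have := (key i).1
  rw [PiLp.sub_apply] at this
  linarith

/-! ### Affine changes of variables -/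

/-- The affine chart `(t, s) ↦ p + t a + s b`. -/
def chart (p a b : Plane) (z : ℝ × ℝ) : Plane := p + z.1 • a + z.2 • b

lemma continuous_chart (p a b : Plane) : Continuous (chart p a b) := by
  unfold chart; fun_prop

/-- The linear map with columns `a` and `b`. -/
def colMap (a b : Plane) : Plane →ₗ[ℝ] Plane :=
  Matrix.toLin (EuclideanSpace.basisFun (Fin 2) ℝ).toBasis
    (EuclideanSpace.basisFun (Fin 2) ℝ).toBasis !![a 0, b 0; a 1, b 1]

lemma colMap_det (a b : Plane) : LinearMap.det (colMap a b) = cr a b := by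
  rw [colMap, LinearMap.det_toLin, Matrix.det_fin_two_of, cr]; ring

lemma colMap_apply (a b x : Plane) : colMap a b x = x 0 • a + x 1 • b := by
  rw [colMap, Matrix.toLin_apply]
  ext i
  fin_cases i <;> simp [Matrix.mulVec, dotProduct, Fin.sum_univ_two] <;> ring

lemma measurePreserving_pair :
    MeasurePreserving (fun z : ℝ × ℝ => (WithLp.toLp 2 ![z.1, z.2] : Plane)) volume volume := by
  have h1 := (volume_preserving_finTwoArrow ℝ).symm
  have h2 := PiLp.volume_preserving_toLp (Fin 2)
  have e : (fun z : ℝ × ℝ => (WithLp.toLp 2 ![z.1, z.2] : Plane)) =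
      WithLp.toLp 2 ∘ MeasurableEquiv.finTwoArrow.symm := by
    funext z
    rfl
  rw [e]
  exact h2.comp h1

lemma map_chart_volume (p a b : Plane) (h : cr a b ≠ 0) :
    Measure.map (chart p a b) volume = ENNReal.ofReal |(cr a b)⁻¹| • volume := by
  have h1 : chart p a b = (fun x => p + x) ∘ (colMap a b) ∘
      (fun z : ℝ × ℝ => (WithLp.toLp 2 ![z.1, z.2] : Plane)) := by
    funext z
    simp [chart, colMap_apply, add_assoc]
  have hm : Measurable (colMap a b) := (colMap a b).continuous_of_finiteDimensional.measurable
  rw [h1, ← Measure.map_map (by fun_prop) (hm.comp measurePreserving_pair.measurable),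
    ← Measure.map_map hm measurePreserving_pair.measurable, measurePreserving_pair.map_eq,
    Measure.map_linearMap_addHaar_eq_smul_addHaar _ (by rwa [colMap_det]), Measure.map_smul,
    colMap_det, map_add_left_eq_self]

lemma measurePreserving_chart (p a b : Plane) (h : cr a b ≠ 0) :
    MeasurePreserving (chart p a b) volume (ENNReal.ofReal |(cr a b)⁻¹| • volume) :=
  ⟨(continuous_chart p a b).measurable, map_chart_volume p a b h⟩

lemma chart_isClosedEmbedding (p a b : Plane) (h : cr a b ≠ 0) :
    MeasurableEmbedding (chart p a b) := by
  refine (continuous_chart p a b).measurableEmbedding ?_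
  rintro ⟨t, s⟩ ⟨t', s'⟩ hz
  have h0 := congrArg (fun x : Plane => x 0) hz
  have h1 := congrArg (fun x : Plane => x 1) hz
  simp only [chart, PiLp.add_apply, PiLp.smul_apply, smul_eq_mul] at h0 h1
  have e1 : (t - t') * cr a b = 0 := by unfold cr; linear_combination b 1 * h0 - b 0 * h1
  have e2 : (s - s') * cr a b = 0 := by unfold cr; linear_combination a 0 * h1 - a 1 * h0
  rcases mul_eq_zero.1 e1 with e1 | e1
  · rcases mul_eq_zero.1 e2 with e2 | e2
    · ext
      · exact sub_eq_zero.1 e1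
      · exact sub_eq_zero.1 e2
    · exact absurd e2 h
  · exact absurd e1 h

lemma setIntegral_chart (p a b : Plane) (h : cr a b ≠ 0) (s : Set Plane) (g : Plane → ℝ) :
    ∫ x in s, g x = |cr a b| * ∫ z in chart p a b ⁻¹' s, g (chart p a b z) := by
  have := (measurePreserving_chart p a b h).setIntegral_preimage_emb
    (chart_isClosedEmbedding p a b h) g s
  rw [this, Measure.restrict_smul, integral_smul_measure, ENNReal.toReal_ofReal (abs_nonneg _),
    abs_inv, smul_eq_mul, ← mul_assoc, mul_inv_cancel₀ (abs_ne_zero.2 h), one_mul]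

/-- The set of chart parameters of a triangle. -/
def refTriangle : Set (ℝ × ℝ) := {z | 0 ≤ z.2 ∧ z.2 ≤ z.1 ∧ z.1 ≤ 1}

lemma chart_preimage_hull {p q r : Plane} (h : cr (q - p) (r - p) ≠ 0) :
    chart p (r - p) (q - r) ⁻¹' hull {p, q, r} = refTriangle := by
  ext ⟨t, s⟩
  have e : chart p (r - p) (q - r) (t, s) = (1 - t) • p + s • q + (t - s) • r := by
    simp only [chart, smul_sub, sub_smul, one_smul]
    abel
  rw [Set.mem_preimage, e, mem_hull_triple h, bary_of_combo _ _ _ h _ _ _ (by ring),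
    bary_of_combo₂ _ _ _ h _ _ _ (by ring), bary_of_combo₃ _ _ _ h _ _ _ (by ring)]
  simp only [refTriangle, Set.mem_ofPred_eq, sub_nonneg]
  tauto

lemma cr_chart (p q r : Plane) : cr (r - p) (q - r) = -cr (q - p) (r - p) := by
  simp only [cr, PiLp.sub_apply]; ring

lemma measurableSet_refTriangle : MeasurableSet refTriangle := by
  unfold refTriangle
  exact (measurableSet_le measurable_const measurable_snd).inter
    ((measurableSet_le measurable_snd measurable_fst).inter
      (measurableSet_le measurable_fst measurable_const))

lemma refTriangle_subset : refTriangle ⊆ Set.Icc 0 1 ×ˢ Set.Icc 0 1 := by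
  rintro ⟨t, s⟩ ⟨h1, h2, h3⟩
  exact ⟨⟨h1.trans h2, h3⟩, ⟨h1, h2.trans h3⟩⟩

/-- Iterated integration over the reference triangle. -/
lemma setIntegral_refTriangle (g : ℝ × ℝ → ℝ) (hg : IntegrableOn g refTriangle) :
    ∫ z in refTriangle, g z = ∫ t in (0 : ℝ)..1, ∫ s in (0 : ℝ)..t, g (t, s) := by
  rw [← integral_indicator measurableSet_refTriangle, Measure.volume_eq_prod, integral_prod]
  · rw [intervalIntegral.integral_of_le zero_le_one, ← integral_Icc_eq_integral_Ioc,
      ← integral_indicator measurableSet_Icc]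
    congr 1
    funext t
    by_cases ht : t ∈ Set.Icc (0 : ℝ) 1
    · rw [Set.indicator_of_mem ht, intervalIntegral.integral_of_le ht.1,
        ← integral_Icc_eq_integral_Ioc, ← integral_indicator measurableSet_Icc]
      congr 1
      funext s
      by_cases hs : s ∈ Set.Icc 0 t
      · rw [Set.indicator_of_mem hs, Set.indicator_of_mem]
        exact ⟨hs.1, hs.2, ht.2⟩
      · rw [Set.indicator_of_notMem hs, Set.indicator_of_notMem]
        exact fun h => hs ⟨h.1, h.2.1⟩
    · rw [Set.indicator_of_notMem ht]
      rw [integral_eq_zero_of_ae]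
      refine Filter.Eventually.of_forall fun s => ?_
      exact Set.indicator_of_notMem (fun h => ht ⟨h.1.trans h.2.1, h.2.2⟩) g
  · rwa [← Measure.volume_eq_prod, integrable_indicator_iff measurableSet_refTriangle]

lemma isCompact_hull (T : Finset Plane) : IsCompact (hull T) := T.finite_toSet.isCompact_convexHull ℝ

lemma measurableSet_hull (T : Finset Plane) : MeasurableSet (hull T) :=
  (isCompact_hull T).isClosed.measurableSet

lemma volume_hull_ne_top (T : Finset Plane) : volume (hull T) ≠ ⊤ :=
  (isCompact_hull T).measure_lt_top.ne

/-- The area of a triangle. -/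
lemma area_triple {p q r : Plane} (h : cr (q - p) (r - p) ≠ 0) :
    area {p, q, r} = |cr (q - p) (r - p)| / 2 := by
  have hr : cr (r - p) (q - r) ≠ 0 := by rw [cr_chart]; exact neg_ne_zero.2 h
  have h1 := setIntegral_chart p (r - p) (q - r) hr (hull {p, q, r}) (fun _ => 1)
  rw [chart_preimage_hull h, setIntegral_refTriangle, cr_chart, abs_neg] at h1
  · simp only [integral_const, intervalIntegral.integral_const, smul_eq_mul, mul_one, sub_zero,
      integral_id, MeasurableSet.univ, measureReal_restrict_apply, Set.univ_inter] at h1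
    rw [area, h1]; ring
  · refine (integrableOn_const ?_)
    exact ((measure_mono refTriangle_subset).trans_lt
      ((isCompact_Icc.prod isCompact_Icc).measure_lt_top)).ne

lemma area_nonneg (T : Finset Plane) : 0 ≤ area T := measureReal_nonneg

lemma area_triple_pos {p q r : Plane} (h : cr (q - p) (r - p) ≠ 0) : 0 < area {p, q, r} := by
  rw [area_triple h]; positivity

lemma volume_segment (p q : Plane) : volume (segment ℝ p q) = 0 := by
  have hne : affineSpan ℝ {p, q} ≠ ⊤ := by
    intro h
    have h1 := collinear_iff_finrank_le_one.1 (collinear_pair ℝ p q)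
    rw [AffineSubspace.vectorSpan_eq_top_of_affineSpan_eq_top _ _ _ h, finrank_top] at h1
    simp at h1
  refine measure_mono_null ?_ (Measure.addHaar_affineSubspace volume _ hne)
  rw [← convexHull_pair]
  exact convexHull_subset_affineSpan _

lemma volume_hull_of_card_le_two {T : Finset Plane} (hT : T.card ≤ 2) : volume (hull T) = 0 := by
  classical
  interval_cases hc : T.card
  · rw [Finset.card_eq_zero.1 hc]; simp [hull]
  · obtain ⟨p, rfl⟩ := Finset.card_eq_one.1 hc
    simp [hull]
  · obtain ⟨p, q, -, rfl⟩ := Finset.card_eq_two.1 hc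
    rw [hull_pair, volume_segment]

/-! ### Topology of conforming triangulations -/

lemma bary_third (p q r x : Plane) :
    bary r p q x = cr (q - p) (x - p) / cr (q - p) (r - p) := by
  rw [bary, cr_rotate r p q, cr_rotate x p q]

lemma cr_eq_zero_of_mem_segment {p q x : Plane} (hx : x ∈ segment ℝ p q) :
    cr (q - p) (x - p) = 0 := by
  obtain ⟨a, b, -, -, hab, rfl⟩ := hx
  obtain rfl : a = 1 - b := by linarith
  simp only [cr, PiLp.sub_apply, PiLp.add_apply, PiLp.smul_apply, smul_eq_mul]
  ring

lemma bary_pos_of_mem_openSegment {p q r x : Plane} (h : cr (q - p) (r - p) ≠ 0)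
    (hx : x ∈ openSegment ℝ p q) : 0 < bary p q r x ∧ 0 < bary q r p x := by
  obtain ⟨a, b, ha, hb, hab, rfl⟩ := hx
  have e : a • p + b • q = a • p + b • q + (0 : ℝ) • r := by simp
  rw [e, bary_of_combo _ _ _ h _ _ _ (by linarith), bary_of_combo₂ _ _ _ h _ _ _ (by linarith)]
  exact ⟨ha, hb⟩

lemma eventually_bary_pos {p q r x : Plane} (hx : 0 < bary p q r x) :
    ∀ᶠ y in 𝓝 x, 0 < bary p q r y :=
  (continuous_bary p q r).continuousAt.eventually_const_lt hx

namespace Triangulation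

variable (M : Triangulation)

/-- The elements that contain a given face. -/
def around (f : Finset Plane) : Finset (Finset Plane) := by
  classical exact M.elems.filter fun T => f ⊆ T

variable {M}

lemma mem_elems {T : Finset Plane} : T ∈ M.elems ↔ T ∈ M.faces ∧ T.card = 3 := by
  simp [elems]

lemma mem_around {f T : Finset Plane} : T ∈ M.around f ↔ T ∈ M.elems ∧ f ⊆ T := by
  simp [around]

lemma mem_interiorEdges {f : Finset Plane} :
    f ∈ M.interiorEdges ↔ f ∈ M.faces ∧ f.card = 2 ∧ (M.around f).card = 2 := by
  simp [interiorEdges, around]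

lemma face_of_subset {s T : Finset Plane} (hT : T ∈ M.elems) (hs : s ⊆ T) (hne : s.Nonempty) :
    s ∈ M.faces :=
  M.toSimplicialComplex.down_closed (mem_elems.1 hT).1 hs hne

lemma mem_hull_inter {s t : Finset Plane} (hs : s ∈ M.faces) (ht : t ∈ M.faces) {x : Plane}
    (hxs : x ∈ hull s) (hxt : x ∈ hull t) : x ∈ hull (s ∩ t) := by
  have := M.inter_subset_convexHull hs ht ⟨hxs, hxt⟩
  simpa [hull] using this

lemma mem_domain {x : Plane} : x ∈ M.domain ↔ ∃ T ∈ M.elems, x ∈ hull T := by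
  constructor
  · intro h
    obtain ⟨s, hs, hx⟩ := Geometry.SimplicialComplex.mem_space_iff.1 h
    obtain ⟨T, hT, hsT, hc⟩ := M.pure s hs
    exact ⟨T, mem_elems.2 ⟨hT, hc⟩, convexHull_mono (by exact_mod_cast hsT) hx⟩
  · rintro ⟨T, hT, hx⟩
    exact Geometry.SimplicialComplex.mem_space_iff.2 ⟨T, (mem_elems.1 hT).1, hx⟩

lemma isCompact_domain : IsCompact M.domain := by
  have : M.domain = ⋃ T ∈ M.elems, hull T := by
    ext x; simp [mem_domain]
  rw [this]
  exact M.elems.isCompact_biUnion fun T _ => isCompact_hull T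

lemma hull_subset_domain {T : Finset Plane} (hT : T ∈ M.elems) : hull T ⊆ M.domain :=
  fun _ hx => mem_domain.2 ⟨T, hT, hx⟩

lemma cr_ne_zero {p q r : Plane} {T : Finset Plane} (hT : T ∈ M.elems) (hp : p ∈ T) (hq : q ∈ T)
    (hr : r ∈ T) (hpq : p ≠ q) (hpr : p ≠ r) (hqr : q ≠ r) : cr (q - p) (r - p) ≠ 0 :=
  cr_ne_zero_of_affineIndependent (M.indep (mem_elems.1 hT).1) hp hq hr hpq hpr hqr

lemma exists_third {p q : Plane} {T : Finset Plane} (hT : T ∈ M.elems) (hp : p ∈ T) (hq : q ∈ T)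
    (hpq : p ≠ q) :
    ∃ r, T = {p, q, r} ∧ p ≠ r ∧ q ≠ r ∧ cr (q - p) (r - p) ≠ 0 := by
  have hc : ((T.erase p).erase q).card = 1 := by
    rw [Finset.card_erase_of_mem (Finset.mem_erase.2 ⟨hpq.symm, hq⟩), Finset.card_erase_of_mem hp,
      (mem_elems.1 hT).2]
  obtain ⟨r, hr⟩ := Finset.card_eq_one.1 hc
  have hr' : r ∈ (T.erase p).erase q := by rw [hr]; simp
  simp only [Finset.mem_erase] at hr'
  refine ⟨r, ?_, hr'.2.1.symm, hr'.1.symm,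
    cr_ne_zero hT hp hq hr'.2.2 hpq hr'.2.1.symm hr'.1.symm⟩
  rw [← hr, Finset.insert_erase (Finset.mem_erase.2 ⟨hpq.symm, hq⟩), Finset.insert_erase hp]

lemma exists_two {p : Plane} {T : Finset Plane} (hT : T ∈ M.elems) (hp : p ∈ T) :
    ∃ q r, T = {p, q, r} ∧ p ≠ q ∧ p ≠ r ∧ q ≠ r ∧ cr (q - p) (r - p) ≠ 0 := by
  have : ∃ q ∈ T, q ≠ p := Finset.exists_mem_ne (by rw [(mem_elems.1 hT).2]; norm_num) p
  obtain ⟨q, hq, hqp⟩ := this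
  obtain ⟨r, h⟩ := exists_third hT hp hq hqp.symm
  exact ⟨q, r, h.1, hqp.symm, h.2.1, h.2.2.1, h.2.2.2⟩

lemma eq_of_same_side {p q r r' : Plane} (hT : {p, q, r} ∈ M.elems) (hT' : {p, q, r'} ∈ M.elems)
    (h : 0 < cr (q - p) (r - p) * cr (q - p) (r' - p)) :
    ({p, q, r} : Finset Plane) = {p, q, r'} := by
  by_contra hne
  have hD : cr (q - p) (r - p) ≠ 0 := left_ne_zero_of_mul h.ne'
  have hD' : cr (q - p) (r' - p) ≠ 0 := right_ne_zero_of_mul h.ne'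
  let x : ℝ → Plane := fun ε => ((1 - ε) / 2) • p + ((1 - ε) / 2) • q + ε • r
  have hx : Continuous x := by fun_prop
  have h0 : x 0 ∈ openSegment ℝ p q := ⟨1 / 2, 1 / 2, by norm_num, by norm_num, by norm_num, by
    simp [x]⟩
  have hpos := bary_pos_of_mem_openSegment hD' h0
  have e1 := hx.continuousAt.eventually (eventually_bary_pos hpos.1)
  have e2 := hx.continuousAt.eventually (eventually_bary_pos hpos.2)
  have e3 : ∀ᶠ ε : ℝ in 𝓝 0, ε < 1 := eventually_lt_nhds one_pos
  obtain ⟨ε, ⟨⟨h1, h2⟩, h3⟩, h4⟩ := (((e1.and e2).and e3).filter_mono nhdsWithin_le_nhds).and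
    (self_mem_nhdsWithin : Set.Ioi (0 : ℝ) ∈ 𝓝[>] 0) |>.exists
  have h4 : 0 < ε := h4
  have hcr : cr (q - p) (x ε - p) = ε * cr (q - p) (r - p) := by
    simp only [x, cr, PiLp.sub_apply, PiLp.add_apply, PiLp.smul_apply, smul_eq_mul]
    ring
  have hxT : x ε ∈ hull {p, q, r} := by
    rw [hull_triple]
    exact ⟨_, _, _, by linarith, by linarith, h4.le, by ring, rfl⟩
  have hxT' : x ε ∈ hull {p, q, r'} := by
    rw [mem_hull_triple hD']
    refine ⟨h1.le, h2.le, ?_⟩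
    rw [bary_third, hcr, ← mul_div_mul_right _ _ hD']
    have : 0 < cr (q - p) (r' - p) * cr (q - p) (r' - p) := mul_self_pos.2 hD'
    rw [mul_assoc]
    positivity
  have hi := mem_hull_inter (mem_elems.1 hT).1 (mem_elems.1 hT').1 hxT hxT'
  have hr : r ∉ ({p, q, r'} : Finset Plane) := by
    intro hr
    apply hne
    apply Finset.eq_of_subset_of_card_le
    · simp only [Finset.insert_subset_iff, Finset.singleton_subset_iff]
      exact ⟨by simp, by simp, hr⟩
    · rw [(mem_elems.1 hT).2, (mem_elems.1 hT').2]
  have hsub : hull (({p, q, r} : Finset Plane) ∩ {p, q, r'}) ⊆ segment ℝ p q := by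
    rw [← hull_pair]
    apply convexHull_mono
    intro z hz
    simp only [Finset.coe_inter, Set.mem_inter_iff, Finset.mem_coe] at hz
    have := hz.1
    simp only [Finset.mem_insert, Finset.mem_singleton] at this
    rcases this with rfl | rfl | rfl
    · simp
    · simp
    · exact absurd hz.2 hr
  have := cr_eq_zero_of_mem_segment (hsub hi)
  rw [hcr] at this
  exact mul_ne_zero h4.ne' hD this

/-- Points of an edge between two elements are interior points of the domain. -/
lemma openSegment_subset_interior {p q : Plane} (hpq : p ≠ q)
    (hc : (M.around {p, q}).card = 2) : openSegment ℝ p q ⊆ interior M.domain := by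
  intro x hx
  obtain ⟨T, T', hne, hTT⟩ := Finset.card_eq_two.1 hc
  have hT : T ∈ M.around {p, q} := by rw [hTT]; simp
  have hT' : T' ∈ M.around {p, q} := by rw [hTT]; simp
  rw [mem_around] at hT hT'
  obtain ⟨hT, hs⟩ := hT
  obtain ⟨hT', hs'⟩ := hT'
  obtain ⟨r, rfl, -, -, hD⟩ := exists_third hT (hs (by simp)) (hs (by simp)) hpq
  obtain ⟨r', rfl, -, -, hD'⟩ := exists_third hT' (hs' (by simp)) (hs' (by simp)) hpq
  have hneg : cr (q - p) (r - p) * cr (q - p) (r' - p) < 0 := by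
    rcases lt_trichotomy (cr (q - p) (r - p) * cr (q - p) (r' - p)) 0 with h | h | h
    · exact h
    · exact absurd h (mul_ne_zero hD hD')
    · exact absurd (eq_of_same_side hT hT' h) hne
  rw [mem_interior_iff_mem_nhds]
  have h1 := bary_pos_of_mem_openSegment hD hx
  have h2 := bary_pos_of_mem_openSegment hD' hx
  filter_upwards [eventually_bary_pos h1.1, eventually_bary_pos h1.2, eventually_bary_pos h2.1,
    eventually_bary_pos h2.2] with y y1 y2 y3 y4
  rcases le_total 0 (cr (q - p) (y - p) / cr (q - p) (r - p)) with h | h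
  · refine hull_subset_domain hT ((mem_hull_triple hD y).2 ⟨y1.le, y2.le, ?_⟩)
    rwa [bary_third]
  · refine hull_subset_domain hT' ((mem_hull_triple hD' y).2 ⟨y3.le, y4.le, ?_⟩)
    rw [bary_third]
    rcases mul_neg_iff.1 hneg with ⟨ha, hb⟩ | ⟨ha, hb⟩
    · exact div_nonneg_of_nonpos (by
        rcases div_nonpos_iff.1 h with h | h <;> linarith [h.1, h.2]) hb.le
    · exact div_nonneg (by
        rcases div_nonpos_iff.1 h with h | h <;> linarith [h.1, h.2]) hb.le

lemma subset_of_mem_hull {p q x : Plane} {T T₀ : Finset Plane} (hT : T ∈ M.elems)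
    (hT₀ : T₀ ∈ M.elems) (hp : p ∈ T₀) (hq : q ∈ T₀) (hpq : p ≠ q)
    (hx : x ∈ openSegment ℝ p q) (hxT : x ∈ hull T) : {p, q} ⊆ T := by
  have hf : ({p, q} : Finset Plane) ∈ M.faces := face_of_subset hT₀ (by
    simp [Finset.insert_subset_iff, hp, hq]) (by simp)
  have hi := mem_hull_inter hf (mem_elems.1 hT).1
    (by rw [hull_pair]; exact openSegment_subset_segment _ _ _ hx) hxT
  have hxp : x ≠ p := by
    rintro rfl; exact hpq (left_mem_openSegment_iff.1 hx)
  have hxq : x ≠ q := by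
    rintro rfl; exact hpq (right_mem_openSegment_iff.1 hx)
  by_contra hns
  have : ∃ z, x ∈ hull {z} ∧ (z = p ∨ z = q) := by
    rw [Finset.insert_subset_iff, Finset.singleton_subset_iff, not_and_or] at hns
    rcases hns with h | h
    · refine ⟨q, convexHull_mono ?_ hi, Or.inr rfl⟩
      intro z hz
      simp only [Finset.coe_inter, Set.mem_inter_iff, Finset.mem_coe, Finset.mem_insert,
        Finset.mem_singleton] at hz
      rcases hz with ⟨rfl | rfl, hz⟩
      · exact absurd hz h
      · simp
    · refine ⟨p, convexHull_mono ?_ hi, Or.inl rfl⟩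
      intro z hz
      simp only [Finset.coe_inter, Set.mem_inter_iff, Finset.mem_coe, Finset.mem_insert,
        Finset.mem_singleton] at hz
      rcases hz with ⟨rfl | rfl, hz⟩
      · simp
      · exact absurd hz h
  obtain ⟨z, hz, h⟩ := this
  simp only [hull, Finset.coe_singleton, convexHull_singleton, Set.mem_singleton_iff] at hz
  subst hz
  rcases h with h | h
  · exact hxp h
  · exact hxq h

/-- An edge with a relative interior point in the interior of the domain lies in exactly two
elements. -/
lemma card_around_eq_two {p q x : Plane} {T₀ : Finset Plane} (hT₀ : T₀ ∈ M.elems) (hp : p ∈ T₀)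
    (hq : q ∈ T₀) (hpq : p ≠ q) (hx : x ∈ openSegment ℝ p q) (hxi : x ∈ interior M.domain) :
    (M.around {p, q}).card = 2 := by
  obtain ⟨r, hr, -, -, hD⟩ := exists_third hT₀ hp hq hpq
  have hclosed : ∀ᶠ y in 𝓝 x, ∀ T ∈ M.elems, y ∈ hull T → {p, q} ⊆ T := by
    rw [Filter.eventually_all_finset]
    intro T hT
    by_cases hs : {p, q} ⊆ T
    · exact Eventually.of_forall fun _ _ => hs
    · have : x ∉ hull T := fun h => hs (subset_of_mem_hull hT hT₀ hp hq hpq hx h)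
      filter_upwards [(isCompact_hull T).isClosed.isOpen_compl.mem_nhds this] with y hy h
      exact absurd h hy
  have hev := hclosed.and (mem_interior_iff_mem_nhds.1 hxi)
  have hcr : ∀ ε : ℝ, cr (q - p) (x + ε • (r - p) - p) = ε * cr (q - p) (r - p) := by
    intro ε
    have h0 := cr_eq_zero_of_mem_segment (openSegment_subset_segment _ _ _ hx)
    simp only [cr, PiLp.sub_apply, PiLp.add_apply, PiLp.smul_apply, smul_eq_mul] at h0 ⊢
    linear_combination h0
  have key : ∀ᶠ ε : ℝ in 𝓝 0, ε ≠ 0 → ∃ r', {p, q, r'} ∈ M.elems ∧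
      0 < ε * cr (q - p) (r - p) * cr (q - p) (r' - p) := by
    have hc : Continuous fun ε : ℝ => x + ε • (r - p) := by fun_prop
    have h0 : x = x + (0 : ℝ) • (r - p) := by simp
    rw [h0] at hev
    filter_upwards [hc.continuousAt.eventually hev] with ε ⟨h1, h2⟩ hε
    obtain ⟨T, hT, hyT⟩ := mem_domain.1 h2
    have hs := h1 T hT hyT
    obtain ⟨r', rfl, -, -, hD'⟩ := exists_third hT (hs (by simp)) (hs (by simp)) hpq
    refine ⟨r', hT, ?_⟩
    have h3 := ((mem_hull_triple hD' _).1 hyT).2.2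
    rw [bary_third, hcr] at h3
    have h4 : 0 ≤ ε * cr (q - p) (r - p) * cr (q - p) (r' - p) := by
      rcases div_nonneg_iff.1 h3 with h | h
      · exact mul_nonneg h.1 h.2
      · exact mul_nonneg_of_nonpos_of_nonpos h.1 h.2
    exact h4.lt_of_ne' (mul_ne_zero (mul_ne_zero hε hD) hD')
  have hneg : ∀ᶠ ε : ℝ in 𝓝 0, -ε ≠ 0 → ∃ r', {p, q, r'} ∈ M.elems ∧
      0 < -ε * cr (q - p) (r - p) * cr (q - p) (r' - p) := by
    have : Tendsto (fun ε : ℝ => -ε) (𝓝 0) (𝓝 0) := by simpa using (continuous_neg (G := ℝ)).tendsto 0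
    exact this.eventually key
  obtain ⟨ε, ⟨h1, h2⟩, h4⟩ := ((key.and hneg).filter_mono nhdsWithin_le_nhds).and
    (self_mem_nhdsWithin : Set.Ioi (0 : ℝ) ∈ 𝓝[>] 0) |>.exists
  have h4 : 0 < ε := h4
  obtain ⟨r₁, hT₁, hs₁⟩ := h1 h4.ne'
  obtain ⟨r₂, hT₂, hs₂⟩ := h2 (neg_ne_zero.2 h4.ne')
  set D := cr (q - p) (r - p)
  set D₁ := cr (q - p) (r₁ - p) with hD₁
  set D₂ := cr (q - p) (r₂ - p) with hD₂
  have hs₁ : 0 < D * D₁ := by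
    rw [mul_assoc] at hs₁; exact pos_of_mul_pos_right hs₁ h4.le
  have hs₂ : D * D₂ < 0 := by
    by_contra hcon
    push Not at hcon
    nlinarith [mul_nonneg h4.le hcon]
  have hpos : 0 < D * D := mul_self_pos.2 hD
  have h12 : D₁ * D₂ < 0 := by
    by_contra hcon
    push Not at hcon
    have : (D * D₁) * (D * D₂) < 0 := mul_neg_of_pos_of_neg hs₁ hs₂
    have h' : 0 ≤ (D * D) * (D₁ * D₂) := mul_nonneg hpos.le hcon
    linarith [show (D * D₁) * (D * D₂) = (D * D) * (D₁ * D₂) by ring]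
  have hne : ({p, q, r₁} : Finset Plane) ≠ {p, q, r₂} := by
    intro h
    have hr : r₁ ∈ ({p, q, r₂} : Finset Plane) := by rw [← h]; simp
    simp only [Finset.mem_insert, Finset.mem_singleton] at hr
    rcases hr with hr | hr | hr
    · rw [hD₁, hr] at h12; simp [cr] at h12
    · rw [hD₁, hr] at h12; simp [cr, mul_comm] at h12
    · rw [hD₁, hr, ← hD₂] at h12
      linarith [mul_self_nonneg D₂]
  have : M.around {p, q} = {{p, q, r₁}, {p, q, r₂}} := by
    ext T
    simp only [mem_around, Finset.mem_insert, Finset.mem_singleton]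
    constructor
    · rintro ⟨hT, hs⟩
      obtain ⟨r', rfl, -, -, hD'⟩ := exists_third hT (hs (by simp)) (hs (by simp)) hpq
      rcases lt_or_gt_of_ne (mul_ne_zero hD' (left_ne_zero_of_mul h12.ne)) with h | h
      · right
        apply eq_of_same_side hT hT₂
        by_contra hcon
        push Not at hcon
        have a1 : 0 ≤ (cr (q - p) (r' - p) * D₁) * (cr (q - p) (r' - p) * D₂) :=
          mul_nonneg_of_nonpos_of_nonpos h.le hcon
        have a2 : (cr (q - p) (r' - p) * cr (q - p) (r' - p)) * (D₁ * D₂) < 0 :=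
          mul_neg_of_pos_of_neg (mul_self_pos.2 hD') h12
        linarith [show (cr (q - p) (r' - p) * D₁) * (cr (q - p) (r' - p) * D₂) =
          (cr (q - p) (r' - p) * cr (q - p) (r' - p)) * (D₁ * D₂) by ring]
      · left
        exact eq_of_same_side hT hT₁ h
    · rintro (rfl | rfl)
      · exact ⟨hT₁, by intro z; simp; tauto⟩
      · exact ⟨hT₂, by intro z; simp; tauto⟩
  rw [this, Finset.card_pair hne]

lemma notMem_interior_of_openSegment {p q x : Plane} {T : Finset Plane} (hT : T ∈ M.elems)
    (hp : p ∈ T) (hq : q ∈ T) (hpq : p ≠ q) (hx : x ∈ openSegment ℝ p q)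
    (hxi : x ∉ interior M.domain) : p ∉ interior M.domain := by
  intro hpi
  have hc : Continuous fun ε : ℝ => (1 - ε) • p + ε • q := by fun_prop
  have h0 : (fun ε : ℝ => (1 - ε) • p + ε • q) 0 = p := by simp
  have hev : ∀ᶠ ε : ℝ in 𝓝 0, (1 - ε) • p + ε • q ∈ interior M.domain := by
    apply hc.continuousAt.eventually
    rw [h0]
    exact isOpen_interior.mem_nhds hpi
  obtain ⟨ε, ⟨h1, h2⟩, h3⟩ := ((hev.and (eventually_lt_nhds one_pos)).filter_mono
    nhdsWithin_le_nhds).and (self_mem_nhdsWithin : Set.Ioi (0 : ℝ) ∈ 𝓝[>] 0) |>.exists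
  have h3 : 0 < ε := h3
  have := card_around_eq_two hT hp hq hpq ⟨1 - ε, ε, by linarith, h3, by ring, rfl⟩ h1
  exact hxi (openSegment_subset_interior hpq this hx)

lemma mem_interior_of_bary_pos {p q r x : Plane} (hT : {p, q, r} ∈ M.elems)
    (hD : cr (q - p) (r - p) ≠ 0) (h1 : 0 < bary p q r x) (h2 : 0 < bary q r p x)
    (h3 : 0 < bary r p q x) : x ∈ interior M.domain := by
  rw [mem_interior_iff_mem_nhds]
  filter_upwards [eventually_bary_pos h1, eventually_bary_pos h2, eventually_bary_pos h3]
    with y y1 y2 y3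
  exact hull_subset_domain hT ((mem_hull_triple hD y).2 ⟨y1.le, y2.le, y3.le⟩)

/-- In an element, a boundary point of the domain with a positive barycentric coordinate at `p`
is `p` itself or lies on an edge at `p`. -/
lemma boundary_cases {p q r x : Plane} (hT : {p, q, r} ∈ M.elems)
    (hD : cr (q - p) (r - p) ≠ 0) (hx : x ∈ hull {p, q, r}) (hxi : x ∉ interior M.domain)
    (h1 : 0 < bary p q r x) : x = p ∨ x ∈ openSegment ℝ p q ∨ x ∈ openSegment ℝ p r := by
  obtain ⟨-, h2, h3⟩ := (mem_hull_triple hD x).1 hx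
  have hs := bary_add p q r x hD
  have hc := bary_combo p q r x hD
  rcases h2.eq_or_lt with h2 | h2
  · rw [← h2] at hs hc
    rcases h3.eq_or_lt with h3 | h3
    · rw [← h3] at hs hc
      left
      have : bary p q r x = 1 := by linarith
      simpa [this] using hc
    · right; right
      exact ⟨_, _, h1, h3, by linarith, by rw [zero_smul, add_zero] at hc; exact hc.symm⟩
  · rcases h3.eq_or_lt with h3 | h3
    · rw [← h3] at hs hc
      right; left
      exact ⟨_, _, h1, h2, by linarith, by rw [zero_smul, add_zero] at hc; exact hc.symm⟩
    · exact absurd (mem_interior_of_bary_pos hT hD h1 h2 h3) hxi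

lemma vertex_notMem_interior {p q r x : Plane} (hT : {p, q, r} ∈ M.elems) (hpq : p ≠ q)
    (hpr : p ≠ r) (hD : cr (q - p) (r - p) ≠ 0) (hx : x ∈ hull {p, q, r})
    (hxi : x ∉ interior M.domain) (h1 : 0 < bary p q r x) : p ∉ interior M.domain := by
  rcases boundary_cases hT hD hx hxi h1 with h | h | h
  · rwa [← h]
  · exact notMem_interior_of_openSegment hT (by simp) (by simp) hpq h hxi
  · exact notMem_interior_of_openSegment hT (by simp) (by simp) hpr h hxi

/-- A set of elements at the vertex `p` that is closed under adjacency through edges at `p`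
reaches a boundary edge at `p`, unless `p` is an interior point and the set contains all elements
at `p`. -/
lemma exists_boundary_edge (p : Plane) (A : Finset (Finset Plane)) (hA : A ⊆ M.elems)
    (hpA : ∀ T ∈ A, p ∈ T) (hne : A.Nonempty)
    (hcl : ∀ T ∈ A, ∀ T' ∈ M.elems, ∀ q, q ≠ p → {p, q} ⊆ T → {p, q} ⊆ T' → T' ∈ A)
    (hmore : p ∉ interior M.domain ∨ ∃ T ∈ M.elems, p ∈ T ∧ T ∉ A) :
    ∃ T ∈ A, ∃ q ∈ T, q ≠ p ∧ (M.around {p, q}).card ≠ 2 := by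
  classical
  have hfar : ∀ᶠ x in 𝓝 p, ∀ s ∈ M.finite_faces.toFinset, p ∉ s → x ∉ hull s := by
    rw [Filter.eventually_all_finset]
    intro s hs
    rw [Set.Finite.mem_toFinset] at hs
    by_cases hps : p ∈ s
    · exact Eventually.of_forall fun _ h => absurd hps h
    · obtain ⟨T₁, hT₁⟩ := hne
      have hpf : {p} ∈ M.faces := face_of_subset (hA hT₁) (by simpa using hpA _ hT₁) (by simp)
      have : p ∉ hull s := by
        intro h
        have h2 := mem_hull_inter hpf hs (by simp [hull]) h
        rw [Finset.singleton_inter_of_notMem hps] at h2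
        simp [hull] at h2
      filter_upwards [(isCompact_hull s).isClosed.isOpen_compl.mem_nhds this] with x hx _
      exact hx
  obtain ⟨δ, hδ, hball⟩ := Metric.eventually_nhds_iff.1 hfar
  obtain ⟨ε, hε, hεδ, hout⟩ : ∃ ε, 0 < ε ∧ ε < δ ∧
      ((∃ T ∈ M.elems, p ∈ T ∧ T ∉ A) ∨
        (Metric.sphere p ε ∩ closure M.domainᶜ).Nonempty) := by
    by_cases h : ∃ T ∈ M.elems, p ∈ T ∧ T ∉ A
    · exact ⟨δ / 2, by linarith, by linarith, Or.inl h⟩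
    · have hp : p ∉ interior M.domain := hmore.resolve_right h
      rw [← Set.mem_compl_iff, ← closure_compl, Metric.mem_closure_iff] at hp
      obtain ⟨x, hx, hd⟩ := hp δ hδ
      refine ⟨dist x p, dist_pos.2 ?_, by rwa [dist_comm], Or.inr ⟨x, rfl, subset_closure hx⟩⟩
      rintro rfl
      obtain ⟨T₁, hT₁⟩ := hne
      exact hx (hull_subset_domain (hA hT₁) (subset_convexHull ℝ _ (hpA _ hT₁)))
  have hsph : ∀ x ∈ Metric.sphere p ε, ∀ s ∈ M.faces, x ∈ hull s → p ∈ s := by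
    intro x hx s hs hxs
    by_contra hps
    exact hball (by rw [Metric.mem_sphere.1 hx]; exact hεδ) s (by simpa using hs) hps hxs
  have hmeet : ∀ T ∈ M.elems, p ∈ T → (Metric.sphere p ε ∩ hull T).Nonempty := by
    intro T hT hp
    obtain ⟨q, r, rfl, hpq, -⟩ := exists_two hT hp
    have hqp : 0 < ‖q - p‖ := norm_pos_iff.2 (sub_ne_zero.2 hpq.symm)
    have hle : ε ≤ ‖q - p‖ := by
      by_contra hcon
      push Not at hcon
      have hqf : {q} ∈ M.faces := face_of_subset hT (by simp) (by simp)
      exact hball (y := q) (by rw [dist_eq_norm]; linarith) {q} (by simpa using hqf)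
        (by simpa using hpq) (by simp [hull])
    refine ⟨p + (ε / ‖q - p‖) • (q - p), ?_, ?_⟩
    · rw [Metric.mem_sphere, dist_eq_norm, add_sub_cancel_left, norm_smul, Real.norm_eq_abs,
        abs_of_pos (by positivity), div_mul_cancel₀ _ hqp.ne']
    · apply (convex_convexHull ℝ _).add_smul_sub_mem
      · exact subset_convexHull ℝ _ (by simp)
      · exact subset_convexHull ℝ _ (by simp)
      · exact ⟨by positivity, (div_le_one hqp).2 hle⟩
  let F₁ : Set Plane := ⋃ T ∈ A, hull T
  let F₂ : Set Plane := (⋃ T ∈ M.elems.filter (fun T => p ∈ T ∧ T ∉ A), hull T) ∪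
    closure M.domainᶜ
  have hF₁ : IsClosed F₁ :=
    (A.isCompact_biUnion fun T _ => isCompact_hull T).isClosed
  have hF₂ : IsClosed F₂ :=
    ((Finset.isCompact_biUnion _ fun T _ => isCompact_hull T).isClosed).union isClosed_closure
  have hconn : IsPreconnected (Metric.sphere p ε) := isPreconnected_sphere (by
    rw [← Module.finrank_eq_rank]
    simp) p ε
  have hcov : Metric.sphere p ε ⊆ F₁ ∪ F₂ := by
    intro x hx
    by_cases hxd : x ∈ M.domain
    · obtain ⟨T, hT, hxT⟩ := mem_domain.1 hxd
      have hp := hsph x hx T (mem_elems.1 hT).1 hxT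
      by_cases hTA : T ∈ A
      · left
        simp only [F₁, Set.mem_iUnion]
        exact ⟨T, hTA, hxT⟩
      · right; left
        simp only [Set.mem_iUnion]
        exact ⟨T, by simp [hT, hp, hTA], hxT⟩
    · right; right
      exact subset_closure hxd
  have h1 : (Metric.sphere p ε ∩ F₁).Nonempty := by
    obtain ⟨T₁, hT₁⟩ := hne
    obtain ⟨x, hx, hxT⟩ := hmeet T₁ (hA hT₁) (hpA _ hT₁)
    refine ⟨x, hx, ?_⟩
    simp only [F₁, Set.mem_iUnion]
    exact ⟨T₁, hT₁, hxT⟩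
  have h2 : (Metric.sphere p ε ∩ F₂).Nonempty := by
    rcases hout with ⟨T, hT, hp, hTA⟩ | ⟨x, hx, hxc⟩
    · obtain ⟨x, hx, hxT⟩ := hmeet T hT hp
      refine ⟨x, hx, Or.inl ?_⟩
      simp only [Set.mem_iUnion]
      exact ⟨T, by simp [hT, hp, hTA], hxT⟩
    · exact ⟨x, hx, Or.inr hxc⟩
  obtain ⟨x, hx, hx1, hx2⟩ := isPreconnected_closed_iff.1 hconn F₁ F₂ hF₁ hF₂ hcov h1 h2
  have hxp : x ≠ p := by
    rintro rfl
    simp [hε.ne] at hx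
  simp only [F₁, Set.mem_iUnion] at hx1
  obtain ⟨T, hTA, hxT⟩ := hx1
  have hT := hA hTA
  have hpT := hpA T hTA
  rcases hx2 with hx2 | hx2
  · simp only [Set.mem_iUnion] at hx2
    obtain ⟨T', hT', hxT'⟩ := hx2
    simp only [Finset.mem_filter] at hT'
    exfalso
    have hi := mem_hull_inter (mem_elems.1 hT).1 (mem_elems.1 hT'.1).1 hxT hxT'
    have : ∃ q ∈ T ∩ T', q ≠ p := by
      by_contra hcon
      push Not at hcon
      have : T ∩ T' ⊆ {p} := fun z hz => by simpa using hcon z hz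
      have hx' : x ∈ hull {p} := convexHull_mono (by exact_mod_cast this) hi
      simp only [hull, Finset.coe_singleton, convexHull_singleton, Set.mem_singleton_iff] at hx'
      exact hxp hx'
    obtain ⟨q, hq, hqp⟩ := this
    rw [Finset.mem_inter] at hq
    refine hT'.2.2 (hcl T hTA T' hT'.1 q hqp ?_ ?_)
    · simp [Finset.insert_subset_iff, hpT, hq.1]
    · simp [Finset.insert_subset_iff, hT'.2.1, hq.2]
  · rw [closure_compl, Set.mem_compl_iff] at hx2
    obtain ⟨q, r, rfl, hpq, hpr, hqr, hD⟩ := exists_two hT hpT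
    have hb : 0 < bary p q r x := by
      obtain ⟨b1, b2, b3⟩ := (mem_hull_triple hD x).1 hxT
      refine b1.lt_of_ne fun h0 => ?_
      have hc := bary_combo p q r x hD
      have hs := bary_add p q r x hD
      rw [← h0] at hc hs
      have hqf : {q, r} ∈ M.faces := face_of_subset hT (by intro z; simp; tauto) (by simp)
      have := hsph x hx {q, r} hqf (by
        rw [hull_pair]
        exact ⟨_, _, b2, b3, by linarith, by rw [zero_smul, zero_add] at hc; exact hc.symm⟩)
      simp [hpq, hpr] at this
    rcases boundary_cases hT hD hxT hx2 hb with h | h | h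
    · exact absurd h hxp
    · exact ⟨_, hTA, q, by simp, hpq.symm, fun hc => hx2 (openSegment_subset_interior hpq hc h)⟩
    · exact ⟨_, hTA, r, by simp, hpr.symm, fun hc => hx2 (openSegment_subset_interior hpr hc h)⟩

end Triangulation

namespace Triangulation

variable {M : Triangulation}

/-- Adjacency of the elements at the vertex `p` through edges at `p`. -/
def fan (M : Triangulation) (p : Plane) : SimpleGraph (M.around {p}) where
  Adj T T' := T ≠ T' ∧ ∃ q, q ≠ p ∧ q ∈ T.1 ∧ q ∈ T'.1
  symm := ⟨fun _ _ ⟨h, q, h1, h2, h3⟩ => ⟨h.symm, q, h1, h3, h2⟩⟩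
  loopless := ⟨fun _ h => h.1 rfl⟩

section EdgeValues

variable {E : Type*} [NormedAddCommGroup E] {m : Finset Plane → E} {p : Plane} {D : ℝ}

lemma norm_sub_le_of_walk
    (hadj : ∀ T ∈ M.around {p}, ∀ q ∈ T, ∀ r ∈ T, q ≠ p → r ≠ p → ‖m {p, q} - m {p, r}‖ ≤ D)
    {T T' : M.around {p}} (w : (M.fan p).Walk T T') :
    ∀ q ∈ T.1, ∀ q' ∈ T'.1, q ≠ p → q' ≠ p → ‖m {p, q} - m {p, q'}‖ ≤ (w.length + 1) * D := by
  induction w with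
  | nil =>
    intro q hq q' hq' h h'
    simpa using hadj _ (Subtype.prop _) q hq q' hq' h h'
  | cons ha w ih =>
    intro q hq q' hq' h h'
    obtain ⟨q₁, h₁, h2, h3⟩ := And.right (show _ ∧ _ from ha)
    calc ‖m {p, q} - m {p, q'}‖ ≤ ‖m {p, q} - m {p, q₁}‖ + ‖m {p, q₁} - m {p, q'}‖ :=
          norm_sub_le_norm_sub_add_norm_sub _ _ _
      _ ≤ D + (w.length + 1) * D :=
          add_le_add (hadj _ (Subtype.prop _) q hq q₁ h2 h h₁) (ih q₁ h3 q' hq' h₁ h')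
      _ = _ := by rw [SimpleGraph.Walk.length_cons]; push_cast; ring

lemma norm_sub_le_of_reachable
    (hadj : ∀ T ∈ M.around {p}, ∀ q ∈ T, ∀ r ∈ T, q ≠ p → r ≠ p → ‖m {p, q} - m {p, r}‖ ≤ D)
    {T T' : M.around {p}} (w : (M.fan p).Reachable T T') (hD : 0 ≤ D) {q q' : Plane}
    (hq : q ∈ T.1) (hq' : q' ∈ T'.1) (h : q ≠ p) (h' : q' ≠ p) :
    ‖m {p, q} - m {p, q'}‖ ≤ (M.around {p}).card * D := by
  obtain ⟨w, hw⟩ := w.exists_isPath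
  refine (norm_sub_le_of_walk hadj w q hq q' hq' h h').trans ?_
  have hl := hw.length_lt
  rw [Fintype.card_coe] at hl
  gcongr
  exact_mod_cast hl

/-- The elements in the same fan at `p`. -/
def component (M : Triangulation) {p : Plane} (T₀ : M.around {p}) : Finset (Finset Plane) := by
  classical exact (Finset.univ.filter fun T => (M.fan p).Reachable T₀ T).image Subtype.val

lemma mem_component {T₀ : M.around {p}} {T : Finset Plane} :
    T ∈ M.component T₀ ↔ ∃ h : T ∈ M.around {p}, (M.fan p).Reachable T₀ ⟨T, h⟩ := by
  simp [component]

lemma component_closed (T₀ : M.around {p}) : ∀ T ∈ M.component T₀, ∀ T' ∈ M.elems, ∀ q, q ≠ p →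
    {p, q} ⊆ T → {p, q} ⊆ T' → T' ∈ M.component T₀ := by
  intro T hT T' hT' q hqp hs hs'
  obtain ⟨h, hr⟩ := mem_component.1 hT
  have hT'p : T' ∈ M.around {p} := mem_around.2 ⟨hT', by simpa using hs' (by simp)⟩
  refine mem_component.2 ⟨hT'p, ?_⟩
  by_cases heq : T = T'
  · subst heq; exact hr
  · refine hr.trans (SimpleGraph.Adj.reachable ⟨?_, q, hqp, hs (by simp), hs' (by simp)⟩)
    simpa using heq

lemma component_boundary (T₀ : M.around {p})
    (hmore : p ∉ interior M.domain ∨ ∃ T ∈ M.elems, p ∈ T ∧ T ∉ M.component T₀) :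
    ∃ T ∈ M.component T₀, ∃ q ∈ T, q ≠ p ∧ (M.around {p, q}).card ≠ 2 := by
  refine exists_boundary_edge p _ ?_ ?_ ⟨T₀, ?_⟩ (component_closed T₀) hmore
  · intro T hT
    obtain ⟨h, -⟩ := mem_component.1 hT
    exact (mem_around.1 h).1
  · intro T hT
    obtain ⟨h, -⟩ := mem_component.1 hT
    simpa using (mem_around.1 h).2
  · exact mem_component.2 ⟨T₀.2, SimpleGraph.Reachable.refl _⟩

lemma card_around_of_mem_interior {T : Finset Plane} {q : Plane} (hT : T ∈ M.elems) (hp : p ∈ T)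
    (hq : q ∈ T) (hqp : q ≠ p) (hpi : p ∈ interior M.domain) : (M.around {p, q}).card = 2 := by
  by_contra hc
  have hx : midpoint ℝ p q ∈ openSegment ℝ p q := midpoint_mem_openSegment _ _
  refine notMem_interior_of_openSegment hT hp hq hqp.symm hx (fun hxi => hc ?_) hpi
  exact card_around_eq_two hT hp hq hqp.symm hx hxi

/-- Edge values that vary little within every element vary little around a vertex. -/
lemma norm_sub_le_of_mem_interior
    (hadj : ∀ T ∈ M.around {p}, ∀ q ∈ T, ∀ r ∈ T, q ≠ p → r ≠ p → ‖m {p, q} - m {p, r}‖ ≤ D)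
    (hD : 0 ≤ D) (hpi : p ∈ interior M.domain) {T T' : Finset Plane} (hT : T ∈ M.around {p})
    (hT' : T' ∈ M.around {p}) {q q' : Plane} (hq : q ∈ T) (hq' : q' ∈ T') (h : q ≠ p)
    (h' : q' ≠ p) : ‖m {p, q} - m {p, q'}‖ ≤ (M.around {p}).card * D := by
  have hmem : T' ∈ M.component ⟨T, hT⟩ := by
    by_contra hcon
    obtain ⟨T₁, hT₁, q₁, hq₁, hne, hc⟩ := component_boundary ⟨T, hT⟩
      (Or.inr ⟨T', (mem_around.1 hT').1, by simpa using (mem_around.1 hT').2, hcon⟩)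
    obtain ⟨h1, -⟩ := mem_component.1 hT₁
    exact hc (card_around_of_mem_interior (mem_around.1 h1).1 (by simpa using (mem_around.1 h1).2)
      hq₁ hne hpi)
  obtain ⟨h1, h2⟩ := mem_component.1 hmem
  exact norm_sub_le_of_reachable hadj h2 hD hq hq' h h'

/-- At a boundary vertex, edge values that vanish at boundary edges and vary little within every
element are small. -/
lemma norm_le_of_notMem_interior
    (hadj : ∀ T ∈ M.around {p}, ∀ q ∈ T, ∀ r ∈ T, q ≠ p → r ≠ p → ‖m {p, q} - m {p, r}‖ ≤ D)
    (hzero : ∀ T ∈ M.around {p}, ∀ q ∈ T, q ≠ p → (M.around {p, q}).card ≠ 2 → m {p, q} = 0)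
    (hD : 0 ≤ D) (hpi : p ∉ interior M.domain) {T : Finset Plane} (hT : T ∈ M.around {p})
    {q : Plane} (hq : q ∈ T) (h : q ≠ p) : ‖m {p, q}‖ ≤ (M.around {p}).card * D := by
  obtain ⟨T₁, hT₁, q₁, hq₁, hne, hc⟩ := component_boundary ⟨T, hT⟩ (Or.inl hpi)
  obtain ⟨h1, h2⟩ := mem_component.1 hT₁
  have := norm_sub_le_of_reachable hadj h2 hD hq hq₁ h hne
  rwa [hzero T₁ h1 q₁ hq₁ hne hc, sub_zero] at this

end EdgeValues

/-! ### Shape regularity -/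

lemma volume_inter_hull {T T' : Finset Plane} (hT : T ∈ M.elems) (hT' : T' ∈ M.elems)
    (hne : T ≠ T') : volume (hull T ∩ hull T') = 0 := by
  classical
  refine measure_mono_null (fun x hx => mem_hull_inter (mem_elems.1 hT).1 (mem_elems.1 hT').1
    hx.1 hx.2) (volume_hull_of_card_le_two ?_)
  by_contra hcon
  push Not at hcon
  have h3 := (mem_elems.1 hT).2
  have h3' := (mem_elems.1 hT').2
  have e1 := Finset.eq_of_subset_of_card_le (Finset.inter_subset_left : T ∩ T' ⊆ T) (by omega)
  have e2 := Finset.eq_of_subset_of_card_le (Finset.inter_subset_right : T ∩ T' ⊆ T') (by omega)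
  exact hne (e1.symm.trans e2)

lemma sum_volume_inter_le (s : Finset (Finset Plane)) (hs : s ⊆ M.elems) {K : Set Plane}
    (hK : volume K ≠ ⊤) : ∑ T ∈ s, volume.real (hull T ∩ K) ≤ volume.real K := by
  have h1 : ∀ T, volume.real (hull T ∩ K) = (volume.restrict K).real (hull T) := fun T => by
    rw [measureReal_restrict_apply (measurableSet_hull T)]
  have h : (volume.restrict K) (⋃ T ∈ s, hull T) = ∑ T ∈ s, (volume.restrict K) (hull T) := by
    refine measure_biUnion_finset₀ (fun T hT T' hT' hne => ?_)
      fun T _ => (measurableSet_hull T).nullMeasurableSet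
    exact Measure.absolutelyContinuous_of_le Measure.restrict_le_self
      (volume_inter_hull (hs hT) (hs hT') hne)
  have hfin : IsFiniteMeasure (volume.restrict K) := ⟨by simpa using hK.lt_top⟩
  calc ∑ T ∈ s, volume.real (hull T ∩ K) = (volume.restrict K).real (⋃ T ∈ s, hull T) := by
        simp only [h1, measureReal_def, h]
        rw [ENNReal.toReal_sum fun T _ => measure_ne_top _ _]
    _ ≤ (volume.restrict K).real Set.univ := measureReal_mono (Set.subset_univ _)
    _ = volume.real K := by simp [measureReal_def]

lemma area_pos {T : Finset Plane} (hT : T ∈ M.elems) : 0 < area T := by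
  obtain ⟨p, hp⟩ : T.Nonempty := Finset.card_pos.1 (by rw [(mem_elems.1 hT).2]; norm_num)
  obtain ⟨q, r, rfl, -, -, -, hD⟩ := exists_two hT hp
  exact area_triple_pos hD

/-- A shape regular mesh has boundedly many elements at a vertex. -/
lemma card_around_le {κ : ℝ} (hκ : 0 ≤ κ) (hM : M.ShapeRegular κ) (p : Plane) :
    ((M.around {p}).card : ℝ) ≤ volume.real (Metric.ball (0 : Plane) 1) * κ := by
  rcases (M.around {p}).eq_empty_or_nonempty with hs | hs
  · rw [hs]
    simpa using mul_nonneg measureReal_nonneg hκ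
  have hd : ∀ T ∈ M.around {p}, 0 < Metric.diam (T : Set Plane) := by
    intro T hT
    obtain ⟨hT, hp⟩ := mem_around.1 hT
    obtain ⟨q, r, rfl, hpq, -⟩ := exists_two hT (by simpa using hp)
    refine (dist_pos.2 hpq).trans_le (Metric.dist_le_diam_of_mem ?_ (by simp) (by simp))
    exact (Finset.finite_toSet _).isBounded
  obtain ⟨T₀, hT₀, hmin⟩ := Finset.exists_min_image (M.around {p})
    (fun T => Metric.diam (T : Set Plane)) hs
  set r := Metric.diam (T₀ : Set Plane) with hr
  have hr0 : 0 < r := hd T₀ hT₀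
  have hκ0 : 0 < κ := by
    refine hκ.lt_of_ne fun h => ?_
    have h1 := hM T₀ (mem_around.1 hT₀).1
    rw [← h, zero_mul] at h1
    have : 0 < r ^ 2 := by positivity
    exact absurd h1 (not_le.2 this)
  have hlow : ∀ T ∈ M.around {p}, r ^ 2 / κ ≤ volume.real (hull T ∩ Metric.closedBall p r) := by
    intro T hT
    obtain ⟨hTe, hp⟩ := mem_around.1 hT
    have hp : p ∈ hull T := subset_convexHull ℝ _ (by simpa using hp)
    set d := Metric.diam (T : Set Plane) with hdd
    have hd0 : 0 < d := hd T hT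
    have hsub : AffineMap.homothety p (r / d) '' hull T ⊆ hull T ∩ Metric.closedBall p r := by
      rintro _ ⟨x, hx, rfl⟩
      have e : AffineMap.homothety p (r / d) x = p + (r / d) • (x - p) := by
        simp [AffineMap.homothety_apply, add_comm]
      rw [e]
      refine ⟨(convex_convexHull ℝ _).add_smul_sub_mem hp hx
        ⟨by positivity, (div_le_one hd0).2 (hmin T hT)⟩, ?_⟩
      have hxp : ‖x - p‖ ≤ d := by
        rw [← dist_eq_norm, hdd, ← convexHull_diam]
        exact Metric.dist_le_diam_of_mem (isCompact_hull T).isBounded hx hp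
      rw [Metric.mem_closedBall, dist_eq_norm, add_sub_cancel_left, norm_smul, Real.norm_eq_abs,
        abs_of_pos (by positivity)]
      calc r / d * ‖x - p‖ ≤ r / d * d := by gcongr
        _ = r := by field_simp
    have hvol : volume.real (AffineMap.homothety p (r / d) '' hull T) = (r / d) ^ 2 * area T := by
      rw [measureReal_def, Measure.addHaar_image_homothety, ENNReal.toReal_mul,
        ENNReal.toReal_ofReal (abs_nonneg _), area, measureReal_def]
      simp
    have hfin : volume (hull T ∩ Metric.closedBall p r) ≠ ⊤ :=
      measure_ne_top_of_subset Set.inter_subset_left (volume_hull_ne_top T)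
    refine le_trans ?_ (measureReal_mono hsub hfin)
    rw [hvol, div_pow, div_mul_eq_mul_div, div_le_div_iff₀ hκ0 (by positivity)]
    have := hM T hTe
    rw [mul_assoc, mul_comm (area T)]
    gcongr
  have hsum := sum_volume_inter_le (M.around {p}) (fun T hT => (mem_around.1 hT).1)
    (measure_closedBall_lt_top (μ := volume) (x := p) (r := r)).ne
  have hball : volume.real (Metric.closedBall p r) =
      r ^ 2 * volume.real (Metric.ball (0 : Plane) 1) := by
    rw [measureReal_def, Measure.addHaar_closedBall _ _ hr0.le, ENNReal.toReal_mul,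
      ENNReal.toReal_ofReal (by positivity), measureReal_def]
    simp
  have h3 := (Finset.card_nsmul_le_sum _ _ _ hlow).trans hsum
  rw [hball, nsmul_eq_mul, ← mul_div_assoc, div_le_iff₀ hκ0, mul_comm, mul_assoc] at h3
  exact le_of_mul_le_mul_left h3 (by positivity)

end Triangulation

/-! ### The lattice and its micro-triangulation -/

lemma sqrt_three_sq : Real.sqrt 3 ^ 2 = 3 := Real.sq_sqrt (by norm_num)

lemma sqrt_three_pos : 0 < Real.sqrt 3 := Real.sqrt_pos.2 (by norm_num)

lemma latticeMatrix_eq : latticeMatrix = !![1, 1 / 2; 0, Real.sqrt 3 / 2] := by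
  rw [latticeMatrix, Real.cos_pi_div_three, Real.sin_pi_div_three]

lemma latticeMatrix_det : latticeMatrix.det = Real.sqrt 3 / 2 := by
  rw [latticeMatrix_eq, Matrix.det_fin_two_of]; ring

lemma latticeMatrix_inv : latticeMatrix⁻¹ = !![1, -(1 / Real.sqrt 3); 0, 2 / Real.sqrt 3] := by
  apply Matrix.inv_eq_right_inv
  have := sqrt_three_pos
  rw [latticeMatrix_eq]
  ext i j
  fin_cases i <;> fin_cases j <;> simp
  all_goals field_simp
  all_goals norm_num

@[simp] lemma pos_apply_zero (ξ : Site) : pos ξ 0 = ξ.1 + ξ.2 / 2 := by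
  simp [pos, latticeMatrix_eq]; ring

@[simp] lemma pos_apply_one (ξ : Site) : pos ξ 1 = Real.sqrt 3 / 2 * ξ.2 := by
  simp [pos, latticeMatrix_eq, mul_comm]

lemma plane_ext {x y : Plane} (h0 : x 0 = y 0) (h1 : x 1 = y 1) : x = y := by
  ext i; fin_cases i <;> assumption

lemma pos_add (ξ η : Site) : pos (ξ + η) = pos ξ + pos η := by
  apply plane_ext <;> simp <;> ring

/-- The first lattice coordinate of a point. -/
def lc1 (x : Plane) : ℝ := x 0 - x 1 / Real.sqrt 3

/-- The second lattice coordinate of a point. -/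
def lc2 (x : Plane) : ℝ := 2 * x 1 / Real.sqrt 3

@[simp] lemma lc1_pos (ξ : Site) : lc1 (pos ξ) = ξ.1 := by
  have := sqrt_three_pos
  simp [lc1]; field_simp; ring

@[simp] lemma lc2_pos (ξ : Site) : lc2 (pos ξ) = ξ.2 := by
  have := sqrt_three_pos
  simp [lc2]; field_simp

lemma lc1_add (x y : Plane) : lc1 (x + y) = lc1 x + lc1 y := by simp [lc1]; ring
lemma lc2_add (x y : Plane) : lc2 (x + y) = lc2 x + lc2 y := by simp [lc2]; ring
lemma lc1_sub (x y : Plane) : lc1 (x - y) = lc1 x - lc1 y := by simp [lc1]; ring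
lemma lc2_sub (x y : Plane) : lc2 (x - y) = lc2 x - lc2 y := by simp [lc2]; ring
lemma lc1_smul (c : ℝ) (x : Plane) : lc1 (c • x) = c * lc1 x := by simp [lc1]; ring
lemma lc2_smul (c : ℝ) (x : Plane) : lc2 (c • x) = c * lc2 x := by simp [lc2]; ring

lemma ext_lc {x y : Plane} (h1 : lc1 x = lc1 y) (h2 : lc2 x = lc2 y) : x = y := by
  have := sqrt_three_pos
  have e : x 1 = y 1 := by
    simp only [lc2] at h2
    field_simp at h2
    linarith
  refine plane_ext ?_ e
  simp only [lc1, e] at h1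
  linarith

lemma pos_injective : Function.Injective pos := by
  intro ξ η h
  have h1 := congrArg lc1 h
  have h2 := congrArg lc2 h
  simp only [lc1_pos, lc2_pos, Int.cast_inj] at h1 h2
  exact Prod.ext h1 h2

lemma norm_sq_plane (x : Plane) : ‖x‖ ^ 2 = x 0 ^ 2 + x 1 ^ 2 := by
  rw [EuclideanSpace.norm_sq_eq]; simp

lemma norm_sq_lc (x : Plane) : ‖x‖ ^ 2 = lc1 x ^ 2 + lc1 x * lc2 x + lc2 x ^ 2 := by
  have := sqrt_three_pos
  rw [norm_sq_plane, lc1, lc2]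
  field_simp
  linear_combination x 1 ^ 2 * sqrt_three_sq

lemma norm_nn (j : Fin 6) : ‖nn j‖ = 1 := by
  have h : ‖nn j‖ ^ 2 = 1 := by
    rw [nn, norm_sq_lc, lc1_pos, lc2_pos]
    fin_cases j <;> simp [dir]
  exact (pow_eq_one_iff_of_nonneg (norm_nonneg _) two_ne_zero).1 h

namespace Micro

lemma sgn_mul_self (τ : Micro) : (τ.sgn : ℝ) * τ.sgn = 1 := by
  unfold sgn; split_ifs <;> norm_num

lemma verts_eq (τ : Micro) :
    τ.verts = {pos τ.1, pos (τ.1 + (τ.sgn, 0)), pos (τ.1 + (0, τ.sgn))} := by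
  ext x
  simp [verts, sites]

lemma cr_verts (τ : Micro) : cr (pos (τ.1 + (τ.sgn, 0)) - pos τ.1)
    (pos (τ.1 + (0, τ.sgn)) - pos τ.1) = Real.sqrt 3 / 2 := by
  simp [cr]
  linear_combination Real.sqrt 3 / 2 * τ.sgn_mul_self

lemma cr_verts_ne_zero (τ : Micro) : cr (pos (τ.1 + (τ.sgn, 0)) - pos τ.1)
    (pos (τ.1 + (0, τ.sgn)) - pos τ.1) ≠ 0 := by
  rw [cr_verts]; have := sqrt_three_pos; positivity

lemma area_verts (τ : Micro) : area τ.verts = Real.sqrt 3 / 4 := by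
  rw [verts_eq, area_triple τ.cr_verts_ne_zero, cr_verts,
    abs_of_pos (by have := sqrt_three_pos; positivity)]
  ring

lemma mem_hull_verts (τ : Micro) (x : Plane) : x ∈ hull τ.verts ↔
    0 ≤ τ.sgn * (lc1 x - τ.1.1) ∧ 0 ≤ τ.sgn * (lc2 x - τ.1.2) ∧
      τ.sgn * (lc1 x - τ.1.1) + τ.sgn * (lc2 x - τ.1.2) ≤ 1 := by
  have hs := τ.sgn_mul_self
  rw [verts_eq, hull_triple]
  constructor
  · rintro ⟨a, b, c, ha, hb, hc, habc, rfl⟩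
    simp only [lc1_add, lc2_add, lc1_smul, lc2_smul, lc1_pos, lc2_pos, Prod.fst_add, Prod.snd_add]
    push_cast
    have e1 : (τ.sgn : ℝ) * (a * τ.1.1 + b * (τ.1.1 + τ.sgn) + c * (τ.1.1 + 0) - τ.1.1) = b := by
      linear_combination b * hs + τ.sgn * (τ.1.1 : ℝ) * habc
    have e2 : (τ.sgn : ℝ) * (a * τ.1.2 + b * (τ.1.2 + 0) + c * (τ.1.2 + τ.sgn) - τ.1.2) = c := by
      linear_combination c * hs + τ.sgn * (τ.1.2 : ℝ) * habc
    rw [e1, e2]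
    exact ⟨hb, hc, by linarith⟩
  · rintro ⟨hb, hc, hbc⟩
    refine ⟨1 - τ.sgn * (lc1 x - τ.1.1) - τ.sgn * (lc2 x - τ.1.2), _, _, by linarith, hb, hc,
      by ring, ?_⟩
    apply ext_lc
    · simp only [lc1_add, lc1_smul, lc1_pos, Prod.fst_add]
      push_cast
      linear_combination (τ.1.1 - lc1 x) * hs
    · simp only [lc2_add, lc2_smul, lc2_pos, Prod.snd_add]
      push_cast
      linear_combination (τ.1.2 - lc2 x) * hs

/-- The vertices of a micro-triangle are at distance at most one from its points. -/
lemma dist_le_one (τ : Micro) {x y : Plane} (hx : x ∈ hull τ.verts) (hy : y ∈ hull τ.verts) :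
    dist x y ≤ 1 := by
  have hle : ∀ z ∈ (τ.verts : Set Plane), ∀ z' ∈ (τ.verts : Set Plane), dist z z' ≤ 1 := by
    have key : ∀ z z' : Plane, lc1 (z - z') ^ 2 + lc1 (z - z') * lc2 (z - z') +
        lc2 (z - z') ^ 2 ≤ 1 → dist z z' ≤ 1 := by
      intro z z' h
      rwa [dist_eq_norm, ← sq_le_one_iff₀ (norm_nonneg _), norm_sq_lc]
    obtain ⟨ξ, b⟩ := τ
    simp only [verts_eq, Finset.coe_insert, Finset.coe_singleton, Set.mem_insert_iff,
      Set.mem_singleton_iff]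
    rintro z (rfl | rfl | rfl) z' (rfl | rfl | rfl) <;> apply key <;>
    simp only [lc1_sub, lc2_sub, lc1_pos, lc2_pos, Prod.fst_add, Prod.snd_add] <;> push_cast <;>
    cases b <;> simp [sgn]
  have hd : Metric.diam (hull τ.verts) ≤ 1 := by
    rw [hull, convexHull_diam]
    exact Metric.diam_le_of_forall_dist_le zero_le_one hle
  exact (Metric.dist_le_diam_of_mem (isCompact_hull _).isBounded hx hy).trans hd

lemma mem_verts_iff (τ : Micro) (ℓ : Site) : pos ℓ ∈ τ.verts ↔ ℓ ∈ τ.sites := by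
  simp [verts, pos_injective.eq_iff]

lemma pos_mem_hull {τ : Micro} {ℓ : Site} (h : ℓ ∈ τ.sites) : pos ℓ ∈ hull τ.verts :=
  subset_convexHull ℝ _ (by simpa [mem_verts_iff] using h)

end Micro

/-! ### Gradients on micro-triangles -/

lemma microGrad_apply_zero (w : Site → Plane) (τ : Micro) (i : Fin 2) :
    microGrad w τ i 0 = τ.sgn * (w (τ.1 + (τ.sgn, 0)) i - w τ.1 i) := by
  simp [microGrad, latticeMatrix_inv, Matrix.mul_apply, Fin.sum_univ_two]

lemma microGrad_apply_one (w : Site → Plane) (τ : Micro) (i : Fin 2) :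
    microGrad w τ i 1 = τ.sgn * (2 * (w (τ.1 + (0, τ.sgn)) i - w τ.1 i) -
      (w (τ.1 + (τ.sgn, 0)) i - w τ.1 i)) / Real.sqrt 3 := by
  simp [microGrad, latticeMatrix_inv, Matrix.mul_apply, Fin.sum_univ_two]
  ring

/-- The gradient on a micro-triangle in lattice coordinates. -/
lemma microGrad_mulVec (w : Site → Plane) (τ : Micro) (x : Plane) (i : Fin 2) :
    (microGrad w τ).mulVec x.ofLp i = τ.sgn * lc1 x * (w (τ.1 + (τ.sgn, 0)) i - w τ.1 i) +
      τ.sgn * lc2 x * (w (τ.1 + (0, τ.sgn)) i - w τ.1 i) := by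
  have := sqrt_three_pos
  simp only [Matrix.mulVec, dotProduct, Fin.sum_univ_two, microGrad_apply_zero,
    microGrad_apply_one, lc1, lc2]
  field_simp
  ring

lemma microGrad_mulVec_sub (w : Site → Plane) (τ : Micro) {ℓ ℓ' : Site} (h : ℓ ∈ τ.sites)
    (h' : ℓ' ∈ τ.sites) (i : Fin 2) :
    (microGrad w τ).mulVec (pos ℓ' - pos ℓ).ofLp i = w ℓ' i - w ℓ i := by
  have hs := τ.sgn_mul_self
  rw [microGrad_mulVec, lc1_sub, lc2_sub, lc1_pos, lc2_pos, lc1_pos, lc2_pos]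
  simp only [Micro.sites, Finset.mem_insert, Finset.mem_singleton] at h h'
  rcases h with rfl | rfl | rfl <;> rcases h' with rfl | rfl | rfl <;>
    simp only [Prod.fst_add, Prod.snd_add] <;> push_cast
  · ring
  · linear_combination (w (τ.1 + (τ.sgn, 0)) i - w τ.1 i) * hs
  · linear_combination (w (τ.1 + (0, τ.sgn)) i - w τ.1 i) * hs
  · linear_combination -(w (τ.1 + (τ.sgn, 0)) i - w τ.1 i) * hs
  · ring
  · linear_combination (-(w (τ.1 + (τ.sgn, 0)) i - w τ.1 i) +
      (w (τ.1 + (0, τ.sgn)) i - w τ.1 i)) * hs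
  · linear_combination -(w (τ.1 + (0, τ.sgn)) i - w τ.1 i) * hs
  · linear_combination ((w (τ.1 + (τ.sgn, 0)) i - w τ.1 i) -
      (w (τ.1 + (0, τ.sgn)) i - w τ.1 i)) * hs
  · ring

lemma microGrad_eq_zero {w : Site → Plane} {τ : Micro} {c : Plane} (h : ∀ ℓ ∈ τ.sites, w ℓ = c) :
    microGrad w τ = 0 := by
  have h0 := h τ.1 (by simp [Micro.sites])
  have h1 := h (τ.1 + (τ.sgn, 0)) (by simp [Micro.sites])
  have h2 := h (τ.1 + (0, τ.sgn)) (by simp [Micro.sites])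
  ext i j
  fin_cases j
  · simp [microGrad_apply_zero, h0, h1]
  · simp [microGrad_apply_one, h0, h1, h2]

/-! ### The piecewise affine interpolant -/

/-- The nodal basis function of the origin. -/
def hat (x : Plane) : ℝ := max 0 (1 - max |lc1 x| (max |lc2 x| |lc1 x + lc2 x|))

/-- The piecewise affine interpolant of a lattice function that vanishes outside `F`. -/
def interp (F : Finset Site) (w : Site → Plane) (i : Fin 2) (x : Plane) : ℝ :=
  ∑ ℓ ∈ F, hat (x - pos ℓ) * w ℓ i

lemma lipschitz_hat : ∃ C, LipschitzWith C hat := by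
  let f : Plane →L[ℝ] ℝ := EuclideanSpace.proj 0 - (1 / Real.sqrt 3) • EuclideanSpace.proj 1
  let g : Plane →L[ℝ] ℝ := (2 / Real.sqrt 3) • EuclideanSpace.proj 1
  have hf : ∀ x, lc1 x = f x := fun x => by simp [f, lc1]; ring
  have hg : ∀ x, lc2 x = g x := fun x => by simp [g, lc2]; ring
  have h1 := lipschitzWith_one_norm.comp f.lipschitz
  have h2 := lipschitzWith_one_norm.comp g.lipschitz
  have h3 := lipschitzWith_one_norm.comp (f + g).lipschitz
  have e : hat = fun x => max 0 (1 - max ((norm ∘ f) x) (max ((norm ∘ g) x) ((norm ∘ (f + g)) x))) := by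
    funext x
    simp [hat, hf, hg]
  rw [e]
  exact ⟨_, ((LipschitzWith.const (1 : ℝ)).sub (h1.max (h2.max h3))).const_max 0⟩

lemma hat_eq_zero {x : Plane} (h : 1 ≤ |lc1 x| ∨ 1 ≤ |lc2 x| ∨ 1 ≤ |lc1 x + lc2 x|) :
    hat x = 0 := by
  unfold hat
  apply max_eq_left
  have : 1 ≤ max |lc1 x| (max |lc2 x| |lc1 x + lc2 x|) := by
    simp only [le_max_iff]
    exact h
  linarith

lemma lipschitz_interp (F : Finset Site) (w : Site → Plane) (i : Fin 2) :
    ∃ C, LipschitzWith C (interp F w i) := by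
  classical
  obtain ⟨C, hC⟩ := lipschitz_hat
  unfold interp
  induction F using Finset.induction_on with
  | empty => exact ⟨0, by simp⟩
  | insert ℓ F hℓ ih =>
    obtain ⟨C', hC'⟩ := ih
    simp only [Finset.sum_insert hℓ]
    have h1 : LipschitzWith (C * 1) fun x => hat (x - pos ℓ) :=
      hC.comp (LipschitzWith.of_dist_le_mul fun x y => by simp)
    have h2 : LipschitzWith (‖w ℓ i‖₊ * (C * 1)) fun x => hat (x - pos ℓ) * w ℓ i := by
      refine LipschitzWith.of_dist_le_mul fun x y => ?_
      have := h1.dist_le_mul x y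
      rw [Real.dist_eq] at this ⊢
      rw [← sub_mul, abs_mul, NNReal.coe_mul, mul_comm, mul_assoc]
      exact mul_le_mul_of_nonneg_left this (abs_nonneg _)
    exact ⟨_, h2.add hC'⟩

lemma hat_sub_eq_zero (τ : Micro) {x : Plane} (hx : x ∈ hull τ.verts) {ℓ : Site}
    (hℓ : ℓ ∉ τ.sites) : hat (x - pos ℓ) = 0 := by
  obtain ⟨ha, hb, hab⟩ := (τ.mem_hull_verts x).1 hx
  obtain ⟨⟨ξ1, ξ2⟩, b⟩ := τ
  obtain ⟨l1, l2⟩ := ℓ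
  apply hat_eq_zero
  simp only [lc1_sub, lc2_sub, lc1_pos, lc2_pos, le_abs]
  by_contra! hcon
  obtain ⟨⟨h1, h2⟩, ⟨h3, h4⟩, h5, h6⟩ := hcon
  cases b
  · simp only [Micro.sites, Micro.sgn, Finset.mem_insert, Finset.mem_singleton,
      Prod.mk_add_mk, Prod.mk.injEq, Bool.false_eq_true, if_false] at hℓ ha hb hab
    push_cast at ha hb hab
    have i1 : (l1 : ℝ) < ξ1 + 1 := by linarith
    have i2 : (ξ1 : ℝ) - 2 < l1 := by linarith
    have i3 : (l2 : ℝ) < ξ2 + 1 := by linarith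
    have i4 : (ξ2 : ℝ) - 2 < l2 := by linarith
    have i5 : (ξ1 : ℝ) + ξ2 - 2 < l1 + l2 := by linarith
    norm_cast at i1 i2 i3 i4 i5
    omega
  · simp only [Micro.sites, Micro.sgn, Finset.mem_insert, Finset.mem_singleton,
      Prod.mk_add_mk, Prod.mk.injEq, if_true] at hℓ ha hb hab
    push_cast at ha hb hab
    have i1 : (l1 : ℝ) < ξ1 + 2 := by linarith
    have i2 : (ξ1 : ℝ) - 1 < l1 := by linarith
    have i3 : (l2 : ℝ) < ξ2 + 2 := by linarith
    have i4 : (ξ2 : ℝ) - 1 < l2 := by linarith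
    have i5 : (l1 : ℝ) + l2 < ξ1 + ξ2 + 2 := by linarith
    norm_cast at i1 i2 i3 i4 i5
    omega

lemma Micro.abs_sgn_mul (τ : Micro) (a : ℝ) : |τ.sgn * a| = |a| := by
  unfold sgn; split_ifs <;> simp

lemma hat_of_lc {τ : Micro} {x : Plane} {a b : ℝ} (h1 : lc1 x = τ.sgn * a)
    (h2 : lc2 x = τ.sgn * b) : hat x = max 0 (1 - max |a| (max |b| |a + b|)) := by
  rw [hat, h1, h2, ← mul_add, τ.abs_sgn_mul, τ.abs_sgn_mul, τ.abs_sgn_mul]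

/-- The interpolant is affine on every micro-triangle. -/
lemma interp_eq {F : Finset Site} {w : Site → Plane} (hF : ∀ ℓ ∉ F, w ℓ = 0) (i : Fin 2)
    (τ : Micro) {x : Plane} (hx : x ∈ hull τ.verts) :
    interp F w i x = w τ.1 i + (microGrad w τ).mulVec (x - pos τ.1).ofLp i := by
  classical
  have e1 : interp F w i x = ∑ ℓ ∈ τ.sites, hat (x - pos ℓ) * w ℓ i := by
    have h1 : interp F w i x = ∑ ℓ ∈ F ∪ τ.sites, hat (x - pos ℓ) * w ℓ i :=
      Finset.sum_subset Finset.subset_union_left fun ℓ _ h => by simp [hF ℓ h]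
    rw [h1]
    refine (Finset.sum_subset Finset.subset_union_right fun ℓ _ h => ?_).symm
    rw [hat_sub_eq_zero τ hx h, zero_mul]
  obtain ⟨ha, hb, hab⟩ := (τ.mem_hull_verts x).1 hx
  set a := (τ.sgn : ℝ) * (lc1 x - τ.1.1) with ha'
  set b := (τ.sgn : ℝ) * (lc2 x - τ.1.2) with hb'
  have hs := τ.sgn_mul_self
  have hs0 : τ.sgn ≠ 0 := by
    rintro h; rw [h] at hs; simp at hs
  have ea : τ.sgn * a = lc1 x - τ.1.1 := by rw [ha']; linear_combination (lc1 x - τ.1.1) * hs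
  have eb : τ.sgn * b = lc2 x - τ.1.2 := by rw [hb']; linear_combination (lc2 x - τ.1.2) * hs
  have t0 : hat (x - pos τ.1) = 1 - a - b := by
    rw [hat_of_lc (τ := τ) (a := a) (b := b) (by simp [lc1_sub, ea]) (by simp [lc2_sub, eb]),
      abs_of_nonneg ha, abs_of_nonneg hb, abs_of_nonneg (by linarith),
      max_eq_right (a := b) (by linarith), max_eq_right (a := a) (by linarith),
      max_eq_right (by linarith)]
    ring
  have t1 : hat (x - pos (τ.1 + (τ.sgn, 0))) = a := by
    rw [hat_of_lc (τ := τ) (a := a - 1) (b := b)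
      (by simp [lc1_sub, mul_sub, ea]; ring) (by simp [lc2_sub, eb]),
      abs_of_nonpos (a := a - 1) (by linarith), abs_of_nonneg hb,
      abs_of_nonpos (a := a - 1 + b) (by linarith),
      max_eq_left (a := -(a - 1)) (max_le (by linarith) (by linarith)),
      max_eq_right (by linarith)]
    ring
  have t2 : hat (x - pos (τ.1 + (0, τ.sgn))) = b := by
    rw [hat_of_lc (τ := τ) (a := a) (b := b - 1)
      (by simp [lc1_sub, ea]) (by simp [lc2_sub, mul_sub, eb]; ring),
      abs_of_nonneg ha, abs_of_nonpos (a := b - 1) (by linarith),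
      abs_of_nonpos (a := a + (b - 1)) (by linarith),
      max_eq_left (a := -(b - 1)) (by linarith), max_eq_right (a := a) (by linarith),
      max_eq_right (by linarith)]
    ring
  rw [e1, Micro.sites, Finset.sum_insert, Finset.sum_insert, Finset.sum_singleton, t0, t1, t2,
    microGrad_mulVec, lc1_sub, lc2_sub, lc1_pos, lc2_pos, ← ha', ← hb']
  · ring
  · simp [hs0]
  · simp [hs0]

/-! ### Almost every point lies in exactly one micro-triangle -/

/-- Points that lie on no lattice line. -/
def Generic (x : Plane) : Prop :=
  ∀ n : ℤ, lc1 x ≠ n ∧ lc2 x ≠ n ∧ lc1 x + lc2 x ≠ n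

lemma volume_level_set (f : Plane →ₗ[ℝ] ℝ) (hf : f ≠ 0) (c : ℝ) : volume {x | f x = c} = 0 := by
  obtain ⟨v, hv⟩ : ∃ v, f v ≠ 0 := by
    by_contra! h
    exact hf (LinearMap.ext h)
  have hk : LinearMap.ker f ≠ ⊤ := fun h => hf (LinearMap.ker_eq_top.1 h)
  have : {x | f x = c} = (fun x => x + -((c / f v) • v)) ⁻¹' (LinearMap.ker f : Set Plane) := by
    ext x
    simp [hv, ← sub_eq_add_neg, sub_eq_zero]
  rw [this, measure_preimage_add_right]
  exact Measure.addHaar_submodule _ _ hk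

lemma ae_generic : ∀ᵐ x : Plane, Generic x := by
  let f : Plane →ₗ[ℝ] ℝ := ⟨⟨lc1, lc1_add⟩, lc1_smul⟩
  let g : Plane →ₗ[ℝ] ℝ := ⟨⟨lc2, lc2_add⟩, lc2_smul⟩
  have e1 : f (pos (1, 0)) = 1 := by simp [f]
  have e2 : g (pos (1, 0)) = 0 := by simp [g]
  have e3 : g (pos (0, 1)) = 1 := by simp [g]
  have h1 : f ≠ 0 := fun h => by rw [h] at e1; simp at e1
  have h2 : g ≠ 0 := fun h => by rw [h] at e3; simp at e3
  have h3 : f + g ≠ 0 := fun h => by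
    have := congrArg (fun l : Plane →ₗ[ℝ] ℝ => l (pos (1, 0))) h
    simp [e1, e2] at this
  unfold Generic
  rw [ae_all_iff]
  intro n
  have a1 : ∀ᵐ x : Plane, f x ≠ n := by rw [ae_iff]; simpa using volume_level_set f h1 n
  have a2 : ∀ᵐ x : Plane, g x ≠ n := by rw [ae_iff]; simpa using volume_level_set g h2 n
  have a3 : ∀ᵐ x : Plane, (f + g) x ≠ n := by
    rw [ae_iff]; simpa only [not_not] using volume_level_set (f + g) h3 n
  filter_upwards [a1, a2, a3] with x b1 b2 b3
  exact ⟨b1, b2, b3⟩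

/-- The micro-triangles cover the plane. -/
lemma exists_mem_hull (x : Plane) : ∃ τ : Micro, x ∈ hull τ.verts := by
  have h1 := Int.floor_le (lc1 x)
  have h2 := Int.lt_floor_add_one (lc1 x)
  have h3 := Int.floor_le (lc2 x)
  have h4 := Int.lt_floor_add_one (lc2 x)
  rcases le_total (lc1 x - ⌊lc1 x⌋ + (lc2 x - ⌊lc2 x⌋)) 1 with h | h
  · refine ⟨((⌊lc1 x⌋, ⌊lc2 x⌋), true), ?_⟩
    rw [Micro.mem_hull_verts]
    simp only [Micro.sgn, if_true, Int.cast_one, one_mul]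
    exact ⟨by linarith, by linarith, h⟩
  · refine ⟨((⌊lc1 x⌋ + 1, ⌊lc2 x⌋ + 1), false), ?_⟩
    rw [Micro.mem_hull_verts]
    simp only [Micro.sgn, Bool.false_eq_true, if_false]
    push_cast
    exact ⟨by linarith, by linarith, by linarith⟩

lemma Generic.strict {x : Plane} (hx : Generic x) {τ : Micro} (h : x ∈ hull τ.verts) :
    0 < τ.sgn * (lc1 x - τ.1.1) ∧ 0 < τ.sgn * (lc2 x - τ.1.2) ∧
      τ.sgn * (lc1 x - τ.1.1) + τ.sgn * (lc2 x - τ.1.2) < 1 := by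
  obtain ⟨h1, h2, h3⟩ := (τ.mem_hull_verts x).1 h
  have hs := τ.sgn_mul_self
  refine ⟨h1.lt_of_ne fun h0 => (hx τ.1.1).1 ?_, h2.lt_of_ne fun h0 => (hx τ.1.2).2.1 ?_,
    h3.lt_of_ne fun h0 => (hx (τ.1.1 + τ.1.2 + τ.sgn)).2.2 ?_⟩
  · linear_combination (-(τ.sgn : ℝ)) * h0 - (lc1 x - τ.1.1) * hs
  · linear_combination (-(τ.sgn : ℝ)) * h0 - (lc2 x - τ.1.2) * hs
  · push_cast
    linear_combination (τ.sgn : ℝ) * h0 - (lc1 x - τ.1.1 + lc2 x - τ.1.2) * hs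

lemma Generic.unique {x : Plane} (hx : Generic x) {τ τ' : Micro} (h : x ∈ hull τ.verts)
    (h' : x ∈ hull τ'.verts) : τ = τ' := by
  obtain ⟨a1, a2, a3⟩ := hx.strict h
  obtain ⟨b1, b2, b3⟩ := hx.strict h'
  obtain ⟨⟨ξ1, ξ2⟩, b⟩ := τ
  obtain ⟨⟨η1, η2⟩, b'⟩ := τ'
  cases b <;> cases b' <;>
    simp only [Micro.sgn, Bool.false_eq_true, if_false, if_true] at a1 a2 a3 b1 b2 b3 <;>
    push_cast at a1 a2 a3 b1 b2 b3
  · have i1 : (ξ1 : ℝ) < η1 + 1 := by linarith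
    have i2 : (η1 : ℝ) < ξ1 + 1 := by linarith
    have i3 : (ξ2 : ℝ) < η2 + 1 := by linarith
    have i4 : (η2 : ℝ) < ξ2 + 1 := by linarith
    norm_cast at i1 i2 i3 i4
    simp only [Prod.mk.injEq, and_true]
    omega
  · exfalso
    have i1 : (ξ1 : ℝ) - 1 < η1 + 1 := by linarith
    have i2 : (η1 : ℝ) < ξ1 := by linarith
    have i3 : (ξ2 : ℝ) - 1 < η2 + 1 := by linarith
    have i4 : (η2 : ℝ) < ξ2 := by linarith
    have i5 : (ξ1 : ℝ) + ξ2 - 1 < η1 + η2 + 1 := by linarith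
    norm_cast at i1 i2 i3 i4 i5
    omega
  · exfalso
    have i1 : (η1 : ℝ) - 1 < ξ1 + 1 := by linarith
    have i2 : (ξ1 : ℝ) < η1 := by linarith
    have i3 : (η2 : ℝ) - 1 < ξ2 + 1 := by linarith
    have i4 : (ξ2 : ℝ) < η2 := by linarith
    have i5 : (η1 : ℝ) + η2 - 1 < ξ1 + ξ2 + 1 := by linarith
    norm_cast at i1 i2 i3 i4 i5
    omega
  · have i1 : (ξ1 : ℝ) < η1 + 1 := by linarith
    have i2 : (η1 : ℝ) < ξ1 + 1 := by linarith
    have i3 : (ξ2 : ℝ) < η2 + 1 := by linarith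
    have i4 : (η2 : ℝ) < ξ2 + 1 := by linarith
    norm_cast at i1 i2 i3 i4
    simp only [Prod.mk.injEq, and_true]
    omega

/-! ### Mean values over edges -/

/-- The mean value of `u` over the segment from `p` to `q`. -/
def segMean (u : Plane → ℝ) (p q : Plane) : ℝ := ∫ t in (0 : ℝ)..1, u ((1 - t) • p + t • q)

lemma segMean_comm (u : Plane → ℝ) (p q : Plane) : segMean u p q = segMean u q p := by
  have := intervalIntegral.integral_comp_sub_left (a := 0) (b := 1)
    (fun t : ℝ => u ((1 - t) • q + t • p)) 1
  simp only [sub_self, sub_zero] at this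
  rw [segMean, segMean, ← this]
  congr 1
  funext t
  rw [sub_sub_cancel, add_comm]

lemma integral_deriv_of_lipschitz {φ : ℝ → ℝ} {C : NNReal} (h : LipschitzWith C φ) (a b : ℝ) :
    ∫ s in a..b, deriv φ s = φ b - φ a :=
  (h.lipschitzOnWith (s := Set.uIcc a b)).absolutelyContinuousOnInterval.integral_deriv_eq_sub

/-- The divergence theorem on a triangle, for Lipschitz functions and in the direction of one of
the edges. -/
lemma setIntegral_lineDeriv {u g : Plane → ℝ} {C : NNReal} (hu : LipschitzWith C u)
    {p q r : Plane} (hD : cr (q - p) (r - p) ≠ 0)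
    (hg : IntegrableOn g (hull {p, q, r}))
    (hder : ∀ᵐ x : Plane, HasDerivAt (fun s : ℝ => u (x + s • (q - r))) (g x) 0) :
    ∫ x in hull {p, q, r}, g x = 2 * area {p, q, r} * (segMean u p q - segMean u p r) := by
  have hD' : cr (r - p) (q - r) ≠ 0 := by rw [cr_chart]; exact neg_ne_zero.2 hD
  have hmp := measurePreserving_chart p (r - p) (q - r) hD'
  have hgi : IntegrableOn (fun z => g (chart p (r - p) (q - r) z)) refTriangle := by
    rw [← chart_preimage_hull hD]
    have := (hmp.integrableOn_comp_preimage (chart_isClosedEmbedding p (r - p) (q - r) hD')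
      (f := g) (s := hull {p, q, r})).2 ?_
    · exact this
    · rw [IntegrableOn, Measure.restrict_smul]
      exact hg.smul_measure ENNReal.ofReal_ne_top
  rw [setIntegral_chart p (r - p) (q - r) hD', chart_preimage_hull hD,
    setIntegral_refTriangle _ hgi, area_triple hD, cr_chart, abs_neg, mul_div_cancel₀ _ two_ne_zero]
  congr 1
  have hae : ∀ᵐ z : ℝ × ℝ, HasDerivAt
      (fun s : ℝ => u (chart p (r - p) (q - r) z + s • (q - r)))
      (g (chart p (r - p) (q - r) z)) 0 := by
    have hq : Measure.QuasiMeasurePreserving (chart p (r - p) (q - r)) volume volume := by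
      refine ⟨hmp.measurable, ?_⟩
      rw [hmp.map_eq]
      exact Measure.smul_absolutelyContinuous
    exact hq.ae hder
  rw [Measure.volume_eq_prod] at hae
  have hae2 := Measure.ae_ae_of_ae_prod hae
  have hcont : ∀ a b : Plane, Continuous fun t : ℝ => u ((1 - t) • a + t • b) := fun a b =>
    hu.continuous.comp (by fun_prop)
  rw [segMean, segMean, ← intervalIntegral.integral_sub
    ((hcont p q).intervalIntegrable _ _) ((hcont p r).intervalIntegrable _ _)]
  apply intervalIntegral.integral_congr_ae
  filter_upwards [hae2] with t ht _
  let φ : ℝ → ℝ := fun s => u (chart p (r - p) (q - r) (t, s))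
  have hφ : ∃ K, LipschitzWith K φ := by
    have h1 : LipschitzWith (‖q - r‖₊) fun s : ℝ => chart p (r - p) (q - r) (t, s) := by
      refine LipschitzWith.of_dist_le_mul fun s s' => ?_
      simp only [chart]
      rw [dist_add_left, dist_eq_norm, ← sub_smul, norm_smul, mul_comm, coe_nnnorm, dist_eq_norm]
    exact ⟨_, hu.comp h1⟩
  obtain ⟨K, hφ⟩ := hφ
  have e := integral_deriv_of_lipschitz hφ 0 t
  have e1 : φ t = u ((1 - t) • p + t • q) := by
    simp only [φ, chart]
    congr 1
    simp only [smul_sub, sub_smul, one_smul]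
    abel
  have e0 : φ 0 = u ((1 - t) • p + t • r) := by
    simp only [φ, chart]
    congr 1
    simp only [smul_sub, sub_smul, one_smul, zero_smul]
    abel
  rw [← e1, ← e0, ← e]
  apply intervalIntegral.integral_congr_ae
  filter_upwards [ht] with s hs _
  have h2 : HasDerivAt φ (g (chart p (r - p) (q - r) (t, s))) s := by
    have h3 : HasDerivAt (fun s' : ℝ => s' - s) 1 s := (hasDerivAt_id s).sub_const s
    have h4 : HasDerivAt (fun s' : ℝ => u (chart p (r - p) (q - r) (t, s) + s' • (q - r)))
        (g (chart p (r - p) (q - r) (t, s))) (s - s) := by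
      rw [sub_self]; exact hs
    have h5 := HasDerivAt.comp (h := fun s' : ℝ => s' - s) s h4 h3
    rw [mul_one] at h5
    convert! h5 using 1
    funext s'
    simp only [φ, Function.comp, chart]
    congr 1
    simp only [sub_smul]
    abel
  exact h2.deriv.symm

/-! ### Averages of the gradient over arbitrary triangles -/

/-- The integral over `T` of the gradient of the interpolant of `w`, when the gradient vanishes
outside the finite set `Q` of micro-triangles. -/
def gradOver (Q : Finset Micro) (w : Site → Plane) (T : Finset Plane) :
    Matrix (Fin 2) (Fin 2) ℝ :=
  ∑ τ ∈ Q, volume.real (hull T ∩ hull τ.verts) • microGrad w τ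

lemma hasDerivAt_interp {F : Finset Site} {w : Site → Plane} (hF : ∀ ℓ ∉ F, w ℓ = 0) (i : Fin 2)
    {τ : Micro} {x : Plane} (hx : Generic x) (hxτ : x ∈ hull τ.verts) (d : Plane) :
    HasDerivAt (fun s : ℝ => interp F w i (x + s • d)) ((microGrad w τ).mulVec d.ofLp i) 0 := by
  obtain ⟨h1, h2, h3⟩ := hx.strict hxτ
  have hev : ∀ᶠ s : ℝ in 𝓝 0, x + s • d ∈ hull τ.verts := by
    have hc1 : Continuous fun s : ℝ => (τ.sgn : ℝ) * (lc1 (x + s • d) - τ.1.1) := by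
      simp only [lc1_add, lc1_smul]; fun_prop
    have hc2 : Continuous fun s : ℝ => (τ.sgn : ℝ) * (lc2 (x + s • d) - τ.1.2) := by
      simp only [lc2_add, lc2_smul]; fun_prop
    have e1 : ∀ᶠ s : ℝ in 𝓝 0, 0 < (τ.sgn : ℝ) * (lc1 (x + s • d) - τ.1.1) :=
      hc1.continuousAt.eventually_const_lt (by simpa using h1)
    have e2 : ∀ᶠ s : ℝ in 𝓝 0, 0 < (τ.sgn : ℝ) * (lc2 (x + s • d) - τ.1.2) :=
      hc2.continuousAt.eventually_const_lt (by simpa using h2)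
    have e3 : ∀ᶠ s : ℝ in 𝓝 0, (τ.sgn : ℝ) * (lc1 (x + s • d) - τ.1.1) +
        (τ.sgn : ℝ) * (lc2 (x + s • d) - τ.1.2) < 1 :=
      (hc1.add hc2).continuousAt.eventually_lt_const (by simpa using h3)
    filter_upwards [e1, e2, e3] with s s1 s2 s3
    exact (τ.mem_hull_verts _).2 ⟨s1.le, s2.le, s3.le⟩
  have hlin : HasDerivAt (fun s : ℝ => w τ.1 i + ((microGrad w τ).mulVec (x - pos τ.1).ofLp i +
      s * (microGrad w τ).mulVec d.ofLp i)) ((microGrad w τ).mulVec d.ofLp i) 0 := by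
    simpa using (((hasDerivAt_id (0 : ℝ)).mul_const
      ((microGrad w τ).mulVec d.ofLp i)).const_add
      ((microGrad w τ).mulVec (x - pos τ.1).ofLp i)).const_add (w τ.1 i)
  refine hlin.congr_of_eventuallyEq ?_
  filter_upwards [hev] with s hs
  rw [interp_eq hF i τ hs]
  congr 1
  have : x + s • d - pos τ.1 = (x - pos τ.1) + s • d := by abel
  rw [this, WithLp.ofLp_add, WithLp.ofLp_smul, Matrix.mulVec_add, Matrix.mulVec_smul,
    Pi.add_apply, Pi.smul_apply, smul_eq_mul]

/-- The divergence theorem for the interpolant of a lattice function. -/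
lemma gradOver_mulVec {F : Finset Site} {w : Site → Plane} (hF : ∀ ℓ ∉ F, w ℓ = 0)
    {Q : Finset Micro} (hQ : ∀ τ ∉ Q, microGrad w τ = 0) {p q r : Plane}
    (hD : cr (q - p) (r - p) ≠ 0) (i : Fin 2) :
    (gradOver Q w {p, q, r}).mulVec (q - r).ofLp i =
      2 * area {p, q, r} * (segMean (interp F w i) p q - segMean (interp F w i) p r) := by
  obtain ⟨C, hC⟩ := lipschitz_interp F w i
  let g : Plane → ℝ := fun x => ∑ τ ∈ Q,
    (hull τ.verts).indicator (fun _ => (microGrad w τ).mulVec (q - r).ofLp i) x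
  have hgi : ∀ τ ∈ Q, IntegrableOn
      ((hull τ.verts).indicator fun _ => (microGrad w τ).mulVec (q - r).ofLp i)
      (hull {p, q, r}) := fun τ _ =>
    (integrableOn_const (volume_hull_ne_top _)).indicator (measurableSet_hull _)
  rw [← setIntegral_lineDeriv (g := g) hC hD (integrable_finsetSum _ hgi) ?_]
  · rw [integral_finsetSum _ hgi, gradOver, Matrix.sum_mulVec, Finset.sum_apply]
    refine Finset.sum_congr rfl fun τ _ => ?_
    rw [setIntegral_indicator (measurableSet_hull _), setIntegral_const, Matrix.smul_mulVec,
      Pi.smul_apply]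
  · filter_upwards [ae_generic] with x hx
    obtain ⟨τ, hτ⟩ := exists_mem_hull x
    have e : g x = (microGrad w τ).mulVec (q - r).ofLp i := by
      have h1 : ∀ τ' ∈ Q, τ' ≠ τ → (hull τ'.verts).indicator
          (fun _ => (microGrad w τ').mulVec (q - r).ofLp i) x = 0 := fun τ' _ hne =>
        Set.indicator_of_notMem (fun h => hne (hx.unique h hτ)) _
      by_cases hτQ : τ ∈ Q
      · simp only [g]
        rw [Finset.sum_eq_single_of_mem τ hτQ h1, Set.indicator_of_mem hτ]
      · rw [hQ τ hτQ]
        simp only [g, Matrix.zero_mulVec, Pi.zero_apply]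
        exact Finset.sum_eq_zero fun τ' hτ' => h1 τ' hτ' fun h => hτQ (h ▸ hτ')
    rw [e]
    exact hasDerivAt_interp hF i hx hτ _

/-! ### The Frobenius product and partial gradients -/

/-- The Frobenius inner product of matrices. -/
def frob (M N : Matrix (Fin 2) (Fin 2) ℝ) : ℝ := ∑ i, ∑ j, M i j * N i j

/-- The Euclidean inner product in coordinates. -/
def dot (u v : Plane) : ℝ := ∑ i, u i * v i

/-- The matrix of a linear map of the plane. -/
def matOf (G : Plane →L[ℝ] Plane) : Matrix (Fin 2) (Fin 2) ℝ :=
  Matrix.of fun i j => G (EuclideanSpace.single j 1) i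

lemma matOf_mulVec (G : Plane →L[ℝ] Plane) (a : Plane) (i : Fin 2) :
    (matOf G).mulVec a.ofLp i = G a i := by
  have : a = a 0 • EuclideanSpace.single 0 1 + a 1 • EuclideanSpace.single 1 1 := by
    apply plane_ext <;> simp
  conv_rhs => rw [this]
  simp only [map_add, map_smul, PiLp.add_apply, PiLp.smul_apply, smul_eq_mul]
  simp only [matOf, Matrix.mulVec, dotProduct, Fin.sum_univ_two, Matrix.of_apply]
  ring

lemma frob_add_left (M M' N : Matrix (Fin 2) (Fin 2) ℝ) :
    frob (M + M') N = frob M N + frob M' N := by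
  simp only [frob, Fin.sum_univ_two, Matrix.add_apply]; ring

lemma frob_add_right (M N N' : Matrix (Fin 2) (Fin 2) ℝ) :
    frob M (N + N') = frob M N + frob M N' := by
  simp only [frob, Fin.sum_univ_two, Matrix.add_apply]; ring

lemma frob_sub_left (M M' N : Matrix (Fin 2) (Fin 2) ℝ) :
    frob (M - M') N = frob M N - frob M' N := by
  simp only [frob, Fin.sum_univ_two, Matrix.sub_apply]; ring

lemma frob_smul_left (c : ℝ) (M N : Matrix (Fin 2) (Fin 2) ℝ) :
    frob (c • M) N = c * frob M N := by
  simp only [frob, Fin.sum_univ_two, Matrix.smul_apply, smul_eq_mul]; ring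

lemma frob_smul_right (c : ℝ) (M N : Matrix (Fin 2) (Fin 2) ℝ) :
    frob M (c • N) = c * frob M N := by
  simp only [frob, Fin.sum_univ_two, Matrix.smul_apply, smul_eq_mul]; ring

@[simp] lemma frob_zero_left (N : Matrix (Fin 2) (Fin 2) ℝ) : frob 0 N = 0 := by simp [frob]

@[simp] lemma frob_zero_right (N : Matrix (Fin 2) (Fin 2) ℝ) : frob N 0 = 0 := by simp [frob]

lemma frob_sum_left {ι : Type*} (s : Finset ι) (M : ι → Matrix (Fin 2) (Fin 2) ℝ)
    (N : Matrix (Fin 2) (Fin 2) ℝ) : frob (∑ k ∈ s, M k) N = ∑ k ∈ s, frob (M k) N := by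
  classical
  induction s using Finset.induction_on with
  | empty => simp
  | insert k s hk ih => rw [Finset.sum_insert hk, Finset.sum_insert hk, frob_add_left, ih]

lemma frob_sum_right {ι : Type*} (s : Finset ι) (M : ι → Matrix (Fin 2) (Fin 2) ℝ)
    (N : Matrix (Fin 2) (Fin 2) ℝ) : frob N (∑ k ∈ s, M k) = ∑ k ∈ s, frob N (M k) := by
  classical
  induction s using Finset.induction_on with
  | empty => simp
  | insert k s hk ih => rw [Finset.sum_insert hk, Finset.sum_insert hk, frob_add_right, ih]

lemma frob_tensor (u a : Plane) (N : Matrix (Fin 2) (Fin 2) ℝ) :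
    frob (tensor u a) N = ∑ i, u i * N.mulVec a.ofLp i := by
  simp only [frob, tensor, Matrix.vecMulVec_apply, Matrix.mulVec, dotProduct, Fin.sum_univ_two]
  ring

lemma frob_tensor_of_mulVec {u a b : Plane} {N : Matrix (Fin 2) (Fin 2) ℝ}
    (h : ∀ i, N.mulVec a.ofLp i = b i) : frob (tensor u a) N = dot u b := by
  rw [frob_tensor, dot]
  simp only [h]

@[simp] lemma dot_zero_right (u : Plane) : dot u 0 = 0 := by simp [dot]

@[simp] lemma dot_zero_left (u : Plane) : dot 0 u = 0 := by simp [dot]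

lemma frob_sq_le (M N : Matrix (Fin 2) (Fin 2) ℝ) : frob M N ^ 2 ≤ frobSq M * frobSq N := by
  have h : ∀ M N : Matrix (Fin 2) (Fin 2) ℝ,
      frob M N = ∑ k : Fin 2 × Fin 2, M k.1 k.2 * N k.1 k.2 := fun M N => by
    rw [frob, Fintype.sum_prod_type]
  have h' : ∀ M : Matrix (Fin 2) (Fin 2) ℝ,
      frobSq M = ∑ k : Fin 2 × Fin 2, M k.1 k.2 ^ 2 := fun M => by
    rw [frobSq, Fintype.sum_prod_type]
  rw [h, h', h']
  exact Finset.sum_mul_sq_le_sq_mul_sq _ _ _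

lemma fderiv_eq_sum_partialGrad (V : Stencil → ℝ) (g h : Stencil) :
    fderiv ℝ V g h = ∑ j, dot (partialGrad V g j) (h j) := by
  have e : h = ∑ j, ∑ i, (h j i) • (Pi.single j (EuclideanSpace.single i 1) : Stencil) := by
    funext j
    rw [Finset.sum_apply, Finset.sum_eq_single j]
    · apply plane_ext <;> simp
    · intro k _ hk
      simp [hk.symm]
    · simp
  conv_lhs => rw [e]
  simp only [map_sum, map_smul, smul_eq_mul, dot, partialGrad]
  refine Finset.sum_congr rfl fun j _ => Finset.sum_congr rfl fun i _ => ?_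
  ring

/-- The directional derivative in terms of the partial gradients. -/
lemma hasDerivAt_stencil {V : Stencil → ℝ} (hV : Differentiable ℝ V) (g h : Stencil) :
    HasDerivAt (fun t : ℝ => V (g + t • h)) (∑ j, dot (partialGrad V g j) (h j)) 0 := by
  rw [← fderiv_eq_sum_partialGrad]
  have h1 : HasDerivAt (fun t : ℝ => g + t • h) h 0 := by
    simpa using ((hasDerivAt_id (0 : ℝ)).smul_const h).const_add g
  have h2 : HasFDerivAt V (fderiv ℝ V g) (g + (0 : ℝ) • h) := by
    simpa using (hV g).hasFDerivAt
  exact h2.comp_hasDerivAt (0 : ℝ) h1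

lemma Crystal.stencil_add_smul (X : Crystal) (y v : Site → Plane) (t : ℝ) (ℓ : Site) :
    X.stencil (y + t • v) ℓ = X.stencil y ℓ + t • X.stencil v ℓ := by
  funext j
  simp only [Crystal.stencil, Pi.add_apply, Pi.smul_apply]
  split_ifs
  · simp
  · rw [smul_sub]; abel

/-! ### Gradients on elements -/

lemma centroid_triple {p q r : Plane} (hpq : p ≠ q) (hpr : p ≠ r) (hqr : q ≠ r) :
    ({p, q, r} : Finset Plane).centroid ℝ id =
      (1 / 3 : ℝ) • p + (1 / 3 : ℝ) • q + (1 / 3 : ℝ) • r := by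
  have hc : ({p, q, r} : Finset Plane).card = 3 :=
    Finset.card_eq_three.2 ⟨p, q, r, hpq, hpr, hqr, rfl⟩
  rw [Finset.centroid_def, Finset.affineCombination_eq_linear_combination]
  · rw [Finset.sum_insert (by simp [hpq, hpr]), Finset.sum_insert (by simp [hqr]),
      Finset.sum_singleton]
    simp only [Finset.centroidWeights_apply, hc, id]
    norm_num [add_assoc]
  · exact Finset.sum_centroidWeights_eq_one_of_card_ne_zero _ _ (by rw [hc]; norm_num)

lemma Triangulation.hull_mem_nhds_centroid {M : Triangulation} {T : Finset Plane}
    (hT : T ∈ M.elems) : hull T ∈ 𝓝 (T.centroid ℝ id) := by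
  obtain ⟨p, hp⟩ : T.Nonempty := Finset.card_pos.1 (by rw [(mem_elems.1 hT).2]; norm_num)
  obtain ⟨q, r, rfl, hpq, hpr, hqr, hD⟩ := exists_two hT hp
  rw [centroid_triple hpq hpr hqr]
  have h1 : 0 < bary p q r ((1 / 3 : ℝ) • p + (1 / 3 : ℝ) • q + (1 / 3 : ℝ) • r) := by
    rw [bary_of_combo _ _ _ hD _ _ _ (by norm_num)]; norm_num
  have h2 : 0 < bary q r p ((1 / 3 : ℝ) • p + (1 / 3 : ℝ) • q + (1 / 3 : ℝ) • r) := by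
    rw [bary_of_combo₂ _ _ _ hD _ _ _ (by norm_num)]; norm_num
  have h3 : 0 < bary r p q ((1 / 3 : ℝ) • p + (1 / 3 : ℝ) • q + (1 / 3 : ℝ) • r) := by
    rw [bary_of_combo₃ _ _ _ hD _ _ _ (by norm_num)]; norm_num
  filter_upwards [eventually_bary_pos h1, eventually_bary_pos h2, eventually_bary_pos h3]
    with y y1 y2 y3
  exact (mem_hull_triple hD y).2 ⟨y1.le, y2.le, y3.le⟩

lemma hasFDerivAt_centroid {M : Triangulation} {T : Finset Plane} (hT : T ∈ M.elems)
    {u : Plane → Plane} {G : Plane →L[ℝ] Plane} {c : Plane} (h : ∀ x ∈ hull T, u x = G x + c) :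
    HasFDerivAt u G (T.centroid ℝ id) := by
  refine (G.hasFDerivAt.add_const c).congr_of_eventuallyEq ?_
  filter_upwards [Triangulation.hull_mem_nhds_centroid hT] with x hx
  exact h x hx

lemma elemGrad_eq {M : Triangulation} {T : Finset Plane} (hT : T ∈ M.elems)
    {u : Plane → Plane} {G : Plane →L[ℝ] Plane} {c : Plane} (h : ∀ x ∈ hull T, u x = G x + c) :
    elemGrad u T = G :=
  (hasFDerivAt_centroid hT h).fderiv

lemma elemGrad_sub {M : Triangulation} {T : Finset Plane} (hT : T ∈ M.elems)
    {v : Plane → Plane} (hv : v ∈ M.displacements) {p q : Plane} (hp : p ∈ T) (hq : q ∈ T) :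
    elemGrad v T (q - p) = v q - v p := by
  obtain ⟨G, c, h⟩ := hv.2.1 T hT
  rw [elemGrad_eq hT h, h q (subset_convexHull ℝ _ hq), h p (subset_convexHull ℝ _ hp), map_sub]
  abel

namespace Coupling

variable {X : Crystal} (S : Coupling X)

lemma elemGrad_add_smul {B : Plane →L[ℝ] Plane} {y v : Plane → Plane} (hy : S.Admissible B y)
    (hv : v ∈ S.mesh.displacements) {T : Finset Plane} (hT : T ∈ S.mesh.elems) (t : ℝ) :
    elemGrad (y + t • v) T = elemGrad y T + t • elemGrad v T := by
  obtain ⟨G, c, h⟩ := hv.2.1 T hT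
  obtain ⟨G', c', h'⟩ := hy.2.1 T hT
  have h'' : ∀ x ∈ hull T, y x = (G' + B) x + c' := fun x hx => by
    have : y x - B x = G' x + c' := h' x hx
    rw [add_apply, ← sub_add_cancel (y x) (B x), this]
    abel
  rw [elemGrad_eq hT h, elemGrad_eq hT h'']
  refine elemGrad_eq (c := c' + t • c) hT fun x hx => ?_
  simp only [Pi.add_apply, Pi.smul_apply, add_apply, smul_apply, h x hx, h'' x hx, smul_add]
  abel

/-! ### The weak form of the a/c problem -/

lemma siteV_of_mem_siteA {ℓ : Site} (h : ℓ ∈ S.siteA) : S.siteV ℓ = X.Vsite ℓ := by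
  simp [siteV, h]

lemma siteV_of_mem_siteI {ℓ : Site} (h : ℓ ∈ S.siteI) :
    S.siteV ℓ = fun g => S.wSite ℓ * S.interfaceV ℓ g := by
  have h' : ℓ ∉ S.siteA := fun hA => Finset.disjoint_left.1 S.disjoint_sites hA h
  simp [siteV, h, h']

lemma differentiable_interfaceV (ℓ : Site) : Differentiable ℝ (S.interfaceV ℓ) := by
  have hV : Differentiable ℝ X.V := X.contDiff_V.differentiable (by norm_num)
  unfold interfaceV
  exact hV.comp (by fun_prop)

lemma differentiable_siteV {ℓ : Site} (h : ℓ ∈ S.siteA ∪ S.siteI) :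
    Differentiable ℝ (S.siteV ℓ) := by
  rcases Finset.mem_union.1 h with h | h
  · rw [S.siteV_of_mem_siteA h]
    exact (X.contDiff_Vsite ℓ).differentiable (by norm_num)
  · rw [S.siteV_of_mem_siteI h]
    exact (S.differentiable_interfaceV ℓ).const_mul _

lemma energy_eq (y : Plane → Plane) : S.energy y =
    ∑ ℓ ∈ S.siteA ∪ S.siteI, S.siteV ℓ (X.stencil (y ∘ pos) ℓ) +
    ∑ T ∈ S.mesh.elems, S.wElem T * X.cauchyBorn (elemGrad y T) := by
  rw [energy, Finset.sum_union S.disjoint_sites]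
  congr 2
  · exact Finset.sum_congr rfl fun ℓ h => by rw [S.siteV_of_mem_siteA h]
  · exact Finset.sum_congr rfl fun ℓ h => by rw [S.siteV_of_mem_siteI h]

lemma hasDerivAt_cauchyBorn (F G : Plane →L[ℝ] Plane) :
    HasDerivAt (fun t : ℝ => X.cauchyBorn (F + t • G)) (frob (X.stressCB F) (matOf G)) 0 := by
  have hV : Differentiable ℝ X.V := X.contDiff_V.differentiable (by norm_num)
  have h := (hasDerivAt_stencil hV (fun j => F (nn j)) (fun j => G (nn j))).const_mul
    (1 / latticeMatrix.det)
  have e : frob (X.stressCB F) (matOf G) = 1 / latticeMatrix.det *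
      ∑ j, dot (partialGrad X.V (fun j => F (nn j)) j) (G (nn j)) := by
    rw [Crystal.stressCB, frob_smul_left, frob_sum_left]
    congr 1
    exact Finset.sum_congr rfl fun j _ => frob_tensor_of_mulVec fun i => matOf_mulVec G _ i
  rw [e]
  exact h

/-- The first variation of the a/c energy. -/
lemma hasDerivAt_energy {B : Plane →L[ℝ] Plane} {y v : Plane → Plane} (hy : S.Admissible B y)
    (hv : v ∈ S.mesh.displacements) :
    HasDerivAt (fun t : ℝ => S.energy (y + t • v))
      (∑ ℓ ∈ S.siteA ∪ S.siteI, ∑ j,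
        dot (partialGrad (S.siteV ℓ) (X.stencil (y ∘ pos) ℓ) j) (X.stencil (v ∘ pos) ℓ j) +
      ∑ T ∈ S.mesh.elems, S.wElem T * frob (X.stressCB (elemGrad y T)) (matOf (elemGrad v T))) 0 := by
  simp only [S.energy_eq]
  refine HasDerivAt.add ?_ ?_
  · refine HasDerivAt.fun_sum fun ℓ hℓ => ?_
    have h := hasDerivAt_stencil (S.differentiable_siteV hℓ) (X.stencil (y ∘ pos) ℓ)
      (X.stencil (v ∘ pos) ℓ)
    refine h.congr_of_eventuallyEq (Eventually.of_forall fun t => ?_)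
    simp only
    rw [← Crystal.stencil_add_smul]
    rfl
  · refine HasDerivAt.fun_sum fun T hT => ?_
    refine HasDerivAt.const_mul _ ?_
    refine (hasDerivAt_cauchyBorn (elemGrad y T) (elemGrad v T)).congr_of_eventuallyEq
      (Eventually.of_forall fun t => ?_)
    simp only
    rw [S.elemGrad_add_smul hy hv hT]

lemma partialGrad_siteV_eq_zero {ℓ : Site} (hℓ : ℓ ∈ S.siteI) {j : Fin 6}
    (hC : ∀ i, S.C ℓ i j = 0) (g : Stencil) : partialGrad (S.siteV ℓ) g j = 0 := by
  have hd := S.differentiable_siteV (Finset.mem_union_right _ hℓ)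
  have key : ∀ e : Plane, fderiv ℝ (S.siteV ℓ) g (Pi.single j e) = 0 := by
    intro e
    have h1 : HasDerivAt (fun t : ℝ => S.siteV ℓ (g + t • (Pi.single j e : Stencil)))
        (fderiv ℝ (S.siteV ℓ) g (Pi.single j e)) 0 := by
      rw [fderiv_eq_sum_partialGrad]
      exact hasDerivAt_stencil hd g _
    have h2 : (fun t : ℝ => S.siteV ℓ (g + t • (Pi.single j e : Stencil))) =
        fun _ => S.siteV ℓ g := by
      funext t
      rw [S.siteV_of_mem_siteI hℓ]
      simp only [interfaceV]
      congr 2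
      funext i
      refine Finset.sum_congr rfl fun k _ => ?_
      by_cases hk : k = j
      · subst hk; simp [hC i]
      · simp [hk]
    rw [h2] at h1
    exact h1.unique (hasDerivAt_const _ _)
  apply plane_ext <;> simp [partialGrad, key]

/-- The a/c stress represents the first variation of the a/c energy. -/
lemma sum_stressH {B : Plane →L[ℝ] Plane} {y v : Plane → Plane} (hy : S.IsSolution B y)
    (hv : v ∈ S.mesh.displacements) :
    ∑ T ∈ S.mesh.elems, area T * frob (S.stressH y T) (matOf (elemGrad v T)) = 0 := by
  classical
  have h0 := hy.2 v hv
  rw [(S.hasDerivAt_energy hy.1 hv).deriv] at h0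
  set P : Site → Fin 6 → Plane := fun ℓ j =>
    partialGrad (S.siteV ℓ) (X.stencil (y ∘ pos) ℓ) j with hP
  have e1 : ∀ T ∈ S.mesh.elems, area T * frob (S.stressH y T) (matOf (elemGrad v T)) =
      (∑ ℓ ∈ S.siteA ∪ S.siteI, ∑ j : Fin 6,
        if pos ℓ ∈ T ∧ pos (ℓ + dir j) ∈ T ∧ ℓ + dir j ∉ X.vac then
          1 / 2 * dot (P ℓ j) (X.stencil (v ∘ pos) ℓ j) else 0) +
      S.wElem T * frob (X.stressCB (elemGrad y T)) (matOf (elemGrad v T)) := by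
    intro T hT
    have ha := Triangulation.area_pos hT
    rw [stressH, frob_smul_left, ← mul_assoc, mul_inv_cancel₀ ha.ne', one_mul, frob_add_left,
      frob_smul_left, frob_smul_left, frob_sum_left, Finset.mul_sum]
    congr 1
    refine Finset.sum_congr rfl fun ℓ _ => ?_
    rw [frob_sum_left, Finset.mul_sum]
    refine Finset.sum_congr rfl fun j _ => ?_
    split_ifs with hc
    · rw [frob_tensor_of_mulVec (b := X.stencil (v ∘ pos) ℓ j)]
      intro i
      rw [matOf_mulVec]
      have : nn j = pos (ℓ + dir j) - pos ℓ := by rw [pos_add, nn]; abel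
      rw [this, elemGrad_sub hT hv hc.1 hc.2.1, Crystal.stencil, if_neg hc.2.2]
      rfl
    · simp
  refine Eq.trans ?_ h0
  rw [Finset.sum_congr rfl e1, Finset.sum_add_distrib, add_left_inj, Finset.sum_comm]
  refine Finset.sum_congr rfl fun ℓ hℓ => ?_
  rw [Finset.sum_comm]
  refine Finset.sum_congr rfl fun j _ => ?_
  by_cases hvac : ℓ + dir j ∈ X.vac
  · simp [hvac, Crystal.stencil]
  have e2 : (∑ T ∈ S.mesh.elems, if pos ℓ ∈ T ∧ pos (ℓ + dir j) ∈ T ∧ ℓ + dir j ∉ X.vac then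
      1 / 2 * dot (P ℓ j) (X.stencil (v ∘ pos) ℓ j) else 0) =
      (S.mesh.around {pos ℓ, pos (ℓ + dir j)}).card *
        (1 / 2 * dot (P ℓ j) (X.stencil (v ∘ pos) ℓ j)) := by
    rw [← Finset.sum_filter, Finset.sum_const, nsmul_eq_mul]
    congr 3
    ext T
    simp [Triangulation.mem_around, hvac, Finset.insert_subset_iff]
  rw [e2]
  by_cases hc : (S.mesh.around {pos ℓ, pos (ℓ + dir j)}).card = 2
  · rw [hc]; push_cast; ring
  have hne : pos (ℓ + dir j) ≠ pos ℓ := by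
    intro h
    have h1 := norm_nn j
    rw [pos_add, add_eq_left] at h
    rw [nn, h, norm_zero] at h1
    exact zero_ne_one h1
  by_cases hex : ∃ T ∈ S.mesh.elems, pos ℓ ∈ T ∧ pos (ℓ + dir j) ∈ T
  · obtain ⟨T, hT, h1, h2⟩ := hex
    have i1 : pos ℓ ∉ interior S.mesh.domain := fun h =>
      hc (Triangulation.card_around_of_mem_interior hT h1 h2 hne h)
    have i2 : pos (ℓ + dir j) ∉ interior S.mesh.domain := fun h => by
      rw [Finset.pair_comm] at hc
      exact hc (Triangulation.card_around_of_mem_interior hT h2 h1 hne.symm h)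
    have : X.stencil (v ∘ pos) ℓ j = 0 := by
      rw [Crystal.stencil, if_neg hvac, Function.comp, Function.comp, hv.2.2 _ i1, hv.2.2 _ i2,
        sub_zero]
    rw [this]
    simp
  · rcases Finset.mem_union.1 hℓ with hA | hI
    · exact absurd (S.bondA ℓ hA j hvac) hex
    · have hC : ∀ i, S.C ℓ i j = 0 := by
        by_contra! hC
        exact hex (S.bondI ℓ hI j hC)
      have : P ℓ j = 0 := S.partialGrad_siteV_eq_zero hI hC _
      change _ = dot (P ℓ j) _
      rw [this]
      simp

end Coupling

/-! ### Finite element functions with given nodal values -/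

lemma bary_affine (p q r x : Plane) :
    bary p q r x = cr (r - q) x / cr (q - p) (r - p) + bary p q r 0 := by
  rw [bary, bary, ← add_div]
  congr 1
  simp only [cr, PiLp.sub_apply, PiLp.zero_apply]
  ring

/-- The linear functional `x ↦ cr a x / D`. -/
def crDiv (a : Plane) (D : ℝ) : Plane →ₗ[ℝ] ℝ where
  toFun x := cr a x / D
  map_add' x y := by simp only [cr, PiLp.add_apply]; ring
  map_smul' c x := by simp only [cr, PiLp.smul_apply, smul_eq_mul, RingHom.id_apply]; ring

/-- The affine function with given values at the vertices of a triangle. -/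
lemma exists_affine_interp {p q r : Plane} (hD : cr (q - p) (r - p) ≠ 0) (a : Plane → Plane) :
    ∃ (G : Plane →L[ℝ] Plane) (c : Plane),
      (∀ x, G x + c = bary p q r x • a p + bary q r p x • a q + bary r p q x • a r) ∧
      ∀ z ∈ ({p, q, r} : Finset Plane), G z + c = a z := by
  let G : Plane →ₗ[ℝ] Plane :=
    (crDiv (r - q) (cr (q - p) (r - p))).smulRight (a p) +
    (crDiv (p - r) (cr (r - q) (p - q))).smulRight (a q) +
    (crDiv (q - p) (cr (p - r) (q - r))).smulRight (a r)
  have hG : ∀ x, LinearMap.toContinuousLinearMap G x +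
      (bary p q r 0 • a p + bary q r p 0 • a q + bary r p q 0 • a r) =
      bary p q r x • a p + bary q r p x • a q + bary r p q x • a r := fun x => by
    rw [bary_affine p q r x, bary_affine q r p x, bary_affine r p q x]
    simp only [LinearMap.coe_toContinuousLinearMap', G, LinearMap.add_apply,
      LinearMap.smulRight_apply, crDiv, LinearMap.coe_mk, AddHom.coe_mk, add_smul]
    abel
  refine ⟨_, _, hG, fun z hz => ?_⟩
  rw [hG]
  have key : ∀ α β γ : ℝ, α + β + γ = 1 → z = α • p + β • q + γ • r →
      bary p q r z • a p + bary q r p z • a q + bary r p q z • a r =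
        α • a p + β • a q + γ • a r := by
    intro α β γ hs hz
    rw [hz, bary_of_combo _ _ _ hD _ _ _ hs, bary_of_combo₂ _ _ _ hD _ _ _ hs,
      bary_of_combo₃ _ _ _ hD _ _ _ hs]
  simp only [Finset.mem_insert, Finset.mem_singleton] at hz
  rcases hz with rfl | rfl | rfl
  · rw [key 1 0 0 (by norm_num) (by simp)]; simp
  · rw [key 0 1 0 (by norm_num) (by simp)]; simp
  · rw [key 0 0 1 (by norm_num) (by simp)]; simp

namespace Triangulation

variable {M : Triangulation}

lemma exists_nodal (M : Triangulation) (a : Plane → Plane) {T : Finset Plane} (hT : T ∈ M.elems) :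
    ∃ Gc : (Plane →L[ℝ] Plane) × Plane, ∀ p ∈ T, Gc.1 p + Gc.2 = a p := by
  obtain ⟨p, hp⟩ : T.Nonempty := Finset.card_pos.1 (by rw [(mem_elems.1 hT).2]; norm_num)
  obtain ⟨q, r, rfl, -, -, -, hD⟩ := exists_two hT hp
  obtain ⟨G, c, -, h⟩ := exists_affine_interp hD a
  exact ⟨(G, c), h⟩

lemma affine_eq_on_hull {s : Finset Plane} {G G' : Plane →L[ℝ] Plane} {c c' : Plane}
    (h : ∀ p ∈ s, G p + c = G' p + c') : ∀ x ∈ hull s, G x + c = G' x + c' := by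
  have hconv : Convex ℝ {x | G x + c = G' x + c'} := by
    intro x hx y hy α β _ _ hab
    simp only [Set.mem_ofPred_eq] at hx hy ⊢
    have e : ∀ (H : Plane →L[ℝ] Plane) (d : Plane), H (α • x + β • y) + d =
        α • (H x + d) + β • (H y + d) := by
      intro H d
      have : d = (α + β) • d := by rw [hab, one_smul]
      conv_lhs => rw [this]
      simp only [map_add, map_smul, smul_add, add_smul]
      abel
    rw [e, e, hx, hy]
  exact fun x hx => convexHull_min (fun p hp => h p hp) hconv hx

open Classical in
/-- The continuous function that is affine on every element and has the nodal values `a`,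
extended by zero. -/
def nodal (M : Triangulation) (a : Plane → Plane) (x : Plane) : Plane :=
  if h : ∃ T ∈ M.elems, x ∈ hull T then
    (M.exists_nodal a h.choose_spec.1).choose.1 x + (M.exists_nodal a h.choose_spec.1).choose.2
  else 0

lemma nodal_eq {a : Plane → Plane} {T : Finset Plane} (hT : T ∈ M.elems)
    {G : Plane →L[ℝ] Plane} {c : Plane} (h : ∀ p ∈ T, G p + c = a p) :
    ∀ x ∈ hull T, M.nodal a x = G x + c := by
  intro x hx
  have hex : ∃ T ∈ M.elems, x ∈ hull T := ⟨T, hT, hx⟩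
  rw [nodal, dif_pos hex]
  have h1 := hex.choose_spec.1
  have h2 := hex.choose_spec.2
  have h3 := (M.exists_nodal a h1).choose_spec
  refine affine_eq_on_hull (s := hex.choose ∩ T) (fun p hp => ?_) x
    (mem_hull_inter (mem_elems.1 h1).1 (mem_elems.1 hT).1 h2 hx)
  rw [Finset.mem_inter] at hp
  rw [h3 p hp.1, h p hp.2]

lemma nodal_vertex {a : Plane → Plane} {T : Finset Plane} (hT : T ∈ M.elems) {p : Plane}
    (hp : p ∈ T) : M.nodal a p = a p := by
  obtain ⟨⟨G, c⟩, h⟩ := M.exists_nodal a hT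
  rw [nodal_eq hT h p (subset_convexHull ℝ _ hp), h p hp]

lemma nodal_boundary {a : Plane → Plane} (ha : ∀ p ∉ interior M.domain, a p = 0) {x : Plane}
    (hx : x ∉ interior M.domain) : M.nodal a x = 0 := by
  by_cases hxd : x ∈ M.domain
  · obtain ⟨T, hT, hxT⟩ := mem_domain.1 hxd
    obtain ⟨p, hp⟩ : T.Nonempty := Finset.card_pos.1 (by rw [(mem_elems.1 hT).2]; norm_num)
    obtain ⟨q, r, rfl, hpq, hpr, hqr, hD⟩ := exists_two hT hp
    have hterm : ∀ p q r : Plane, p ≠ q → p ≠ r → cr (q - p) (r - p) ≠ 0 →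
        {p, q, r} ∈ M.elems → x ∈ hull {p, q, r} → 0 ≤ bary p q r x → bary p q r x • a p = 0 := by
      intro p q r hpq hpr hD hT hxT h0
      rcases h0.eq_or_lt with h0 | h0
      · rw [← h0, zero_smul]
      · rw [ha p (vertex_notMem_interior hT hpq hpr hD hxT hx h0), smul_zero]
    obtain ⟨b1, b2, b3⟩ := (mem_hull_triple hD x).1 hxT
    have e1 : ({q, r, p} : Finset Plane) = {p, q, r} := by ext z; simp; tauto
    have e2 : ({r, p, q} : Finset Plane) = {p, q, r} := by ext z; simp; tauto
    have t1 := hterm p q r hpq hpr hD hT hxT b1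
    have t2 := hterm q r p hqr hpq.symm (by rwa [cr_rotate]) (by rwa [e1]) (by rwa [e1]) b2
    have t3 := hterm r p q hpr.symm hqr.symm (by rwa [cr_rotate, cr_rotate]) (by rwa [e2])
      (by rwa [e2]) b3
    obtain ⟨G, c, h, hv⟩ := exists_affine_interp hD a
    rw [nodal_eq hT hv x hxT, h, t1, t2, t3]
    simp
  · rw [nodal, dif_neg]
    rwa [mem_domain] at hxd

lemma nodal_mem_displacements {a : Plane → Plane} (ha : ∀ p ∉ interior M.domain, a p = 0) :
    M.nodal a ∈ M.displacements := by
  refine ⟨?_, fun T hT => ?_, fun x hx => nodal_boundary ha hx⟩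
  · let K : Option M.elems → Set Plane := fun o =>
      match o with
      | none => (interior M.domain)ᶜ
      | some T => hull T.1
    refine (locallyFinite_of_finite K).continuous ?_ ?_ ?_
    · rw [Set.eq_univ_iff_forall]
      intro x
      by_cases hx : x ∈ interior M.domain
      · obtain ⟨T, hT, hxT⟩ := mem_domain.1 (interior_subset hx)
        exact Set.mem_iUnion.2 ⟨some ⟨T, hT⟩, hxT⟩
      · exact Set.mem_iUnion.2 ⟨none, hx⟩
    · rintro (_ | T)
      · exact isOpen_interior.isClosed_compl
      · exact (isCompact_hull _).isClosed
    · rintro (_ | T)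
      · exact continuousOn_const.congr fun x hx => nodal_boundary ha hx
      · obtain ⟨⟨G, c⟩, h⟩ := M.exists_nodal a T.2
        have hc : Continuous fun x => G x + c := by fun_prop
        exact hc.continuousOn.congr fun x hx => nodal_eq T.2 h x hx
  · obtain ⟨⟨G, c⟩, h⟩ := M.exists_nodal a hT
    exact ⟨G, c, nodal_eq hT h⟩

end Triangulation

/-! ### Outward normals -/

lemma inner_plane (a b : Plane) : inner ℝ a b = a 0 * b 0 + a 1 * b 1 := by
  simp [PiLp.inner_apply, Fin.sum_univ_two, mul_comm]

lemma exists_isOutwardNormal {p q r : Plane} (hD : cr (q - p) (r - p) ≠ 0) :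
    ∃ ν, IsOutwardNormal {p, q, r} {p, q} ν := by
  have hd : q - p ≠ 0 := by
    intro h; rw [h] at hD; simp [cr] at hD
  have hn : 0 < ‖q - p‖ := norm_pos_iff.2 hd
  set D := cr (q - p) (r - p) with hDdef
  obtain ⟨s, hs, hsD⟩ : ∃ s : ℝ, s ^ 2 = 1 ∧ 0 < s * D := by
    rcases lt_or_gt_of_ne hD with h | h
    · exact ⟨-1, by norm_num, by linarith⟩
    · exact ⟨1, by norm_num, by linarith⟩
  let ν : Plane := WithLp.toLp 2 ![s * (q - p) 1 / ‖q - p‖, -(s * (q - p) 0) / ‖q - p‖]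
  have ν0 : ν 0 = s * (q - p) 1 / ‖q - p‖ := rfl
  have ν1 : ν 1 = -(s * (q - p) 0) / ‖q - p‖ := rfl
  have horth : inner ℝ ν (q - p) = 0 := by rw [inner_plane, ν0, ν1]; ring
  have hneg : inner ℝ ν (r - p) < 0 := by
    have : inner ℝ ν (r - p) = -(s * D / ‖q - p‖) := by
      rw [inner_plane, ν0, ν1, hDdef, cr]; ring
    rw [this]
    exact neg_neg_of_pos (by positivity)
  refine ⟨ν, ?_, ?_, ?_⟩
  · have h1 : ‖ν‖ ^ 2 = 1 := by
      rw [norm_sq_plane, ν0, ν1]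
      have := norm_sq_plane (q - p)
      field_simp
      rw [this]
      linear_combination ((q - p) 0 ^ 2 + (q - p) 1 ^ 2) * hs
    exact (pow_eq_one_iff_of_nonneg (norm_nonneg _) two_ne_zero).1 h1
  · have h' : inner ℝ ν (p - q) = 0 := by rw [← neg_sub, inner_neg_right, horth, neg_zero]
    intro a ha b hb
    simp only [Finset.mem_insert, Finset.mem_singleton] at ha hb
    rcases ha with rfl | rfl <;> rcases hb with rfl | rfl
    · simp
    · exact horth
    · exact h'
    · simp
  · intro a ha b hb hbn
    simp only [Finset.mem_insert, Finset.mem_singleton] at ha hb hbn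
    have hb : b = r := by tauto
    subst hb
    rcases ha with rfl | rfl
    · exact hneg
    · have : b - a = (b - p) - (a - p) := by abel
      rw [this, inner_sub_right, horth, sub_zero]
      exact hneg

/-- The components of the scaled outward normal along the edges of a triangle. -/
lemma outwardNormal_spec {p q r : Plane} (hpr : p ≠ r) (hqr : q ≠ r)
    (hD : cr (q - p) (r - p) ≠ 0) :
    inner ℝ (outwardNormal {p, q, r} {p, q}) (q - p) = 0 ∧
    dist p q * inner ℝ (outwardNormal {p, q, r} {p, q}) (r - p) = -(2 * area {p, q, r}) := by
  obtain ⟨h1, h2, h3⟩ := Classical.epsilon_spec (exists_isOutwardNormal hD)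
  change ‖outwardNormal {p, q, r} {p, q}‖ = 1 at h1
  change ∀ a ∈ _, ∀ b ∈ _, inner ℝ (outwardNormal {p, q, r} {p, q}) (b - a) = 0 at h2
  change ∀ a ∈ _, ∀ b ∈ _, b ∉ _ → inner ℝ (outwardNormal {p, q, r} {p, q}) (b - a) < 0 at h3
  set ν := outwardNormal {p, q, r} {p, q}
  have horth := h2 p (by simp) q (by simp)
  have hneg := h3 p (by simp) r (by simp) (by simp [hpr.symm, hqr.symm])
  refine ⟨horth, ?_⟩
  have hν : ν 0 ^ 2 + ν 1 ^ 2 = 1 := by rw [← norm_sq_plane, h1]; norm_num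
  have ho : ν 0 * (q - p) 0 + ν 1 * (q - p) 1 = 0 := by rw [← inner_plane]; exact horth
  have e1 : cr (q - p) (r - p) = cr (q - p) ν * inner ℝ ν (r - p) := by
    rw [inner_plane, cr, cr]
    linear_combination ((q - p) 1 * (r - p) 0 - (q - p) 0 * (r - p) 1) * hν -
      (ν 1 * (r - p) 0 - ν 0 * (r - p) 1) * ho
  have e2 : cr (q - p) ν ^ 2 = ‖q - p‖ ^ 2 := by
    rw [norm_sq_plane, cr]
    linear_combination ((q - p) 0 ^ 2 + (q - p) 1 ^ 2) * hν -
      (ν 0 * (q - p) 0 + ν 1 * (q - p) 1) * ho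
  have e3 : |cr (q - p) ν| = ‖q - p‖ := by
    rw [← abs_of_nonneg (norm_nonneg (q - p))]
    exact (sq_eq_sq_iff_abs_eq_abs _ _).1 e2
  rw [area_triple hD, e1, abs_mul, e3, abs_of_neg hneg, dist_comm, dist_eq_norm]
  ring

/-! ### Edge representation of element gradients -/

/-- The scaled normal of an edge. -/
def scaledNormal (T f : Finset Plane) : Plane := Metric.diam (f : Set Plane) • outwardNormal T f

lemma inner_scaledNormal {p q r : Plane} (hpr : p ≠ r) (hqr : q ≠ r)
    (hD : cr (q - p) (r - p) ≠ 0) :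
    inner ℝ (scaledNormal {p, q, r} {p, q}) (q - p) = 0 ∧
    inner ℝ (scaledNormal {p, q, r} {p, q}) (r - p) = -(2 * area {p, q, r}) := by
  obtain ⟨h1, h2⟩ := outwardNormal_spec hpr hqr hD
  rw [scaledNormal, Finset.coe_pair, Metric.diam_pair, real_inner_smul_left, real_inner_smul_left, h1]
  exact ⟨mul_zero _, h2⟩

lemma matrix_eq_of_mulVec {M N : Matrix (Fin 2) (Fin 2) ℝ} {a b : Plane} (h : cr a b ≠ 0)
    (ha : ∀ i, M.mulVec a.ofLp i = N.mulVec a.ofLp i)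
    (hb : ∀ i, M.mulVec b.ofLp i = N.mulVec b.ofLp i) : M = N := by
  ext i j
  have h1 := ha i
  have h2 := hb i
  simp only [Matrix.mulVec, dotProduct, Fin.sum_univ_two] at h1 h2
  have e0 : (M i 0 - N i 0) * cr a b = 0 := by
    unfold cr; linear_combination b 1 * h1 - a 1 * h2
  have e1 : (M i 1 - N i 1) * cr a b = 0 := by
    unfold cr; linear_combination a 0 * h2 - b 0 * h1
  fin_cases j
  · exact sub_eq_zero.1 ((mul_eq_zero.1 e0).resolve_right h)
  · exact sub_eq_zero.1 ((mul_eq_zero.1 e1).resolve_right h)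

lemma tensor_mulVec (u a x : Plane) (i : Fin 2) :
    (tensor u a).mulVec x.ofLp i = u i * inner ℝ a x := by
  simp only [tensor, Matrix.mulVec, dotProduct, Fin.sum_univ_two, Matrix.vecMulVec_apply,
    inner_plane]
  ring

lemma powersetCard_two_triple {p q r : Plane} (hpq : p ≠ q) (hpr : p ≠ r) (hqr : q ≠ r) :
    ({p, q, r} : Finset Plane).powersetCard 2 = {{p, q}, {p, r}, {q, r}} := by
  ext f
  rw [Finset.mem_powersetCard]
  simp only [Finset.mem_insert, Finset.mem_singleton]
  constructor
  · rintro ⟨hs, hc⟩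
    obtain ⟨a, b, hab, rfl⟩ := Finset.card_eq_two.1 hc
    have ha : a = p ∨ a = q ∨ a = r := by simpa using hs (by simp : a ∈ ({a, b} : Finset Plane))
    have hb : b = p ∨ b = q ∨ b = r := by simpa using hs (by simp : b ∈ ({a, b} : Finset Plane))
    rcases ha with rfl | rfl | rfl <;> rcases hb with rfl | rfl | rfl <;>
      simp_all [Finset.pair_comm]
  · rintro (rfl | rfl | rfl)
    · exact ⟨by intro z; simp; tauto, Finset.card_pair hpq⟩
    · exact ⟨by intro z; simp; tauto, Finset.card_pair hpr⟩
    · exact ⟨by intro z; simp; tauto, Finset.card_pair hqr⟩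

/-- A matrix that satisfies the discrete divergence identities with edge values `e` is the sum of
the tensor products of the edge values with the scaled normals. -/
lemma eq_sum_tensor {p q r : Plane} (hpq : p ≠ q) (hpr : p ≠ r) (hqr : q ≠ r)
    (hD : cr (q - p) (r - p) ≠ 0) {D : Matrix (Fin 2) (Fin 2) ℝ} {e : Finset Plane → Plane}
    (h1 : ∀ i, D.mulVec (q - r).ofLp i = 2 * area {p, q, r} * (e {p, q} i - e {p, r} i))
    (h2 : ∀ i, D.mulVec (r - p).ofLp i = 2 * area {p, q, r} * (e {q, r} i - e {p, q} i)) :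
    D = ∑ f ∈ ({p, q, r} : Finset Plane).powersetCard 2,
      tensor (e f) (scaledNormal {p, q, r} f) := by
  have n1 := inner_scaledNormal hpr hqr hD
  have n2 : _ ∧ _ := inner_scaledNormal (p := p) (q := r) (r := q) hpq hqr.symm (by
    rw [cr_swap]; exact neg_ne_zero.2 hD)
  have n3 : _ ∧ _ := inner_scaledNormal (p := q) (q := r) (r := p) hpq.symm hpr.symm (by
    rwa [cr_rotate])
  have s1 : ({p, r, q} : Finset Plane) = {p, q, r} := by ext z; simp; tauto
  have s2 : ({q, r, p} : Finset Plane) = {p, q, r} := by ext z; simp; tauto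
  rw [s1] at n2
  rw [s2] at n3
  simp only [inner_sub_right] at n1 n2 n3
  apply matrix_eq_of_mulVec (a := q - r) (b := r - p)
  · have : cr (q - r) (r - p) = cr (q - p) (r - p) := by
      simp only [cr, PiLp.sub_apply]; ring
    rwa [this]
  all_goals
    intro i
    rw [powersetCard_two_triple hpq hpr hqr, Finset.sum_insert, Finset.sum_insert,
      Finset.sum_singleton]
    · first | rw [h1] | rw [h2]
      simp only [Matrix.add_mulVec, Pi.add_apply, tensor_mulVec, inner_sub_right]
      first
      | linear_combination (-e {p, q} i) * (n1.1 - n1.2) - e {p, r} i * (n2.2 - n2.1) +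
          e {q, r} i * n3.1
      | linear_combination (-e {p, q} i) * n1.2 - e {p, r} i * n2.1 - e {q, r} i * (n3.1 - n3.2)
    · simp only [Finset.mem_singleton]
      intro h
      have : p ∈ ({q, r} : Finset Plane) := by rw [← h]; simp
      simp [hpq, hpr] at this
    · simp only [Finset.mem_insert, Finset.mem_singleton]
      rintro (h | h)
      · have : q ∈ ({p, r} : Finset Plane) := by rw [← h]; simp
        simp [hpq.symm, hqr] at this
      · have : p ∈ ({q, r} : Finset Plane) := by rw [← h]; simp
        simp [hpq, hpr] at this

/-! ### Gradient energy on elements -/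

/-- The squared `L²(T)` norm of a piecewise constant gradient field. -/
def gradSq (Q : Finset Micro) (w : Site → Plane) (T : Finset Plane) : ℝ :=
  ∑ τ ∈ Q, volume.real (hull T ∩ hull τ.verts) * frobSq (microGrad w τ)

lemma gradSq_nonneg (Q : Finset Micro) (w : Site → Plane) (T : Finset Plane) :
    0 ≤ gradSq Q w T :=
  Finset.sum_nonneg fun _ _ => mul_nonneg measureReal_nonneg (frobSq_nonneg _)

lemma sum_gradSq_le (M : Triangulation) (Q : Finset Micro) (w : Site → Plane) :
    ∑ T ∈ M.elems, gradSq Q w T ≤ ∑ τ ∈ Q, area τ.verts * frobSq (microGrad w τ) := by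
  unfold gradSq
  rw [Finset.sum_comm]
  refine Finset.sum_le_sum fun τ _ => ?_
  rw [← Finset.sum_mul]
  exact mul_le_mul_of_nonneg_right
    (Triangulation.sum_volume_inter_le M.elems subset_rfl (volume_hull_ne_top _)) (frobSq_nonneg _)

lemma volume_micro_inter {τ τ' : Micro} (h : τ ≠ τ') :
    volume (hull τ.verts ∩ hull τ'.verts) = 0 := by
  refine measure_mono_null (fun x hx => ?_) (ae_iff.1 ae_generic)
  exact fun hg => h (hg.unique hx.1 hx.2)

lemma sum_volume_micro_le (Q : Finset Micro) (T : Finset Plane) :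
    ∑ τ ∈ Q, volume.real (hull T ∩ hull τ.verts) ≤ area T := by
  have h : volume (⋃ τ ∈ Q, hull T ∩ hull τ.verts) =
      ∑ τ ∈ Q, volume (hull T ∩ hull τ.verts) := by
    refine measure_biUnion_finset₀ (fun τ _ τ' _ hne => ?_) fun τ _ =>
      ((measurableSet_hull T).inter (measurableSet_hull _)).nullMeasurableSet
    refine measure_mono_null (t := hull τ.verts ∩ hull τ'.verts) ?_ (volume_micro_inter hne)
    rintro x ⟨⟨-, h1⟩, -, h2⟩
    exact ⟨h1, h2⟩
  have hsub : (⋃ τ ∈ Q, hull T ∩ hull τ.verts) ⊆ hull T :=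
    Set.iUnion₂_subset fun _ _ => Set.inter_subset_left
  have := measureReal_mono hsub (volume_hull_ne_top T)
  rw [measureReal_def, h, ENNReal.toReal_sum fun τ _ =>
    measure_ne_top_of_subset Set.inter_subset_left (volume_hull_ne_top T)] at this
  exact this

lemma frobSq_gradOver_le (Q : Finset Micro) (w : Site → Plane) (T : Finset Plane) :
    frobSq (gradOver Q w T) ≤ area T * gradSq Q w T := by
  have key : ∀ i j, (gradOver Q w T i j) ^ 2 ≤ area T *
      ∑ τ ∈ Q, volume.real (hull T ∩ hull τ.verts) * microGrad w τ i j ^ 2 := by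
    intro i j
    have e : gradOver Q w T i j = ∑ τ ∈ Q, Real.sqrt (volume.real (hull T ∩ hull τ.verts)) *
        (Real.sqrt (volume.real (hull T ∩ hull τ.verts)) * microGrad w τ i j) := by
      rw [gradOver, Matrix.sum_apply]
      refine Finset.sum_congr rfl fun τ _ => ?_
      rw [← mul_assoc, Real.mul_self_sqrt measureReal_nonneg, Matrix.smul_apply, smul_eq_mul]
    rw [e]
    refine (Finset.sum_mul_sq_le_sq_mul_sq _ _ _).trans ?_
    simp only [mul_pow, Real.sq_sqrt measureReal_nonneg]
    exact mul_le_mul_of_nonneg_right (sum_volume_micro_le Q T)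
      (Finset.sum_nonneg fun _ _ => mul_nonneg measureReal_nonneg (sq_nonneg _))
  calc frobSq (gradOver Q w T) = ∑ i, ∑ j, (gradOver Q w T i j) ^ 2 := rfl
    _ ≤ ∑ i, ∑ j, area T *
        ∑ τ ∈ Q, volume.real (hull T ∩ hull τ.verts) * microGrad w τ i j ^ 2 :=
      Finset.sum_le_sum fun i _ => Finset.sum_le_sum fun j _ => key i j
    _ = area T * gradSq Q w T := by
      simp only [gradSq, frobSq, Fin.sum_univ_two, ← mul_add, ← Finset.sum_add_distrib]

lemma mulVec_sq_le (N : Matrix (Fin 2) (Fin 2) ℝ) (x : Plane) :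
    ∑ i, (N.mulVec x.ofLp i) ^ 2 ≤ frobSq N * ‖x‖ ^ 2 := by
  rw [norm_sq_plane]
  simp only [frobSq, Fin.sum_univ_two, Matrix.mulVec, dotProduct]
  nlinarith [sq_nonneg (N 0 0 * x 1 - N 0 1 * x 0), sq_nonneg (N 1 0 * x 1 - N 1 1 * x 0)]

/-! ### Edge means and the quasi-interpolant -/

open Classical in
/-- The mean value over an edge of a vector field. -/
def edgeMean (u : Fin 2 → Plane → ℝ) (f : Finset Plane) : Plane :=
  if h : ∃ z : Plane × Plane, f = {z.1, z.2} then
    WithLp.toLp 2 fun i => segMean (u i) h.choose.1 h.choose.2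
  else 0

lemma edgeMean_pair (u : Fin 2 → Plane → ℝ) (p q : Plane) (i : Fin 2) :
    edgeMean u {p, q} i = segMean (u i) p q := by
  have h : ∃ z : Plane × Plane, ({p, q} : Finset Plane) = {z.1, z.2} := ⟨(p, q), rfl⟩
  have hs := h.choose_spec
  rw [edgeMean, dif_pos h]
  simp only
  generalize h.choose = z at hs
  obtain ⟨a, b⟩ := z
  simp only at hs ⊢
  have ha : a = p ∨ a = q := by
    have : a ∈ ({p, q} : Finset Plane) := by rw [hs]; simp
    simpa using this
  have hb : b = p ∨ b = q := by
    have : b ∈ ({p, q} : Finset Plane) := by rw [hs]; simp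
    simpa using this
  have hp : p = a ∨ p = b := by
    have : p ∈ ({a, b} : Finset Plane) := by rw [← hs]; simp
    simpa using this
  have hq : q = a ∨ q = b := by
    have : q ∈ ({a, b} : Finset Plane) := by rw [← hs]; simp
    simpa using this
  rcases hp with rfl | rfl
  · rcases hb with rfl | rfl
    · rcases hq with rfl | rfl <;> rfl
    · rfl
  · rcases ha with rfl | rfl
    · rcases hq with rfl | rfl <;> rfl
    · exact segMean_comm _ _ _

namespace Triangulation

variable {M : Triangulation}

open Classical in
/-- The nodal values of the quasi-interpolant: the value on some edge at an interior vertex, and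
zero at the boundary. -/
def vertexValue (M : Triangulation) (m : Finset Plane → Plane) (p : Plane) : Plane :=
  if h : p ∈ interior M.domain ∧ ∃ q, q ≠ p ∧ ∃ T ∈ M.around {p}, q ∈ T then
    m {p, h.2.choose} else 0

lemma vertexValue_boundary (m : Finset Plane → Plane) {p : Plane} (hp : p ∉ interior M.domain) :
    M.vertexValue m p = 0 := by
  rw [vertexValue, dif_neg fun h => hp h.1]

lemma norm_sub_vertexValue_le {m : Finset Plane → Plane} {p : Plane} {D : ℝ}
    (hadj : ∀ T ∈ M.around {p}, ∀ q ∈ T, ∀ r ∈ T, q ≠ p → r ≠ p → ‖m {p, q} - m {p, r}‖ ≤ D)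
    (hzero : ∀ T ∈ M.around {p}, ∀ q ∈ T, q ≠ p → (M.around {p, q}).card ≠ 2 → m {p, q} = 0)
    (hD : 0 ≤ D) {T : Finset Plane} (hT : T ∈ M.around {p}) {q : Plane} (hq : q ∈ T)
    (hqp : q ≠ p) : ‖m {p, q} - M.vertexValue m p‖ ≤ (M.around {p}).card * D := by
  by_cases hp : p ∈ interior M.domain
  · have h : p ∈ interior M.domain ∧ ∃ q, q ≠ p ∧ ∃ T ∈ M.around {p}, q ∈ T :=
      ⟨hp, q, hqp, T, hT, hq⟩
    rw [vertexValue, dif_pos h]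
    obtain ⟨h1, T', hT', h2⟩ := h.2.choose_spec
    exact norm_sub_le_of_mem_interior hadj hD hp hT hT' hq h2 hqp h1
  · rw [vertexValue_boundary m hp, sub_zero]
    exact norm_le_of_notMem_interior hadj hzero hD hp hT hq hqp

/-- The edges of the mesh. -/
def edges (M : Triangulation) : Finset (Finset Plane) :=
  M.finite_faces.toFinset.filter fun f => f.card = 2

lemma mem_edges {f : Finset Plane} : f ∈ M.edges ↔ f ∈ M.faces ∧ f.card = 2 := by
  simp [edges]

lemma exists_elem_of_mem_edges {f : Finset Plane} (hf : f ∈ M.edges) :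
    ∃ T ∈ M.elems, f ⊆ T := by
  obtain ⟨T, hT, hs, hc⟩ := M.pure f (mem_edges.1 hf).1
  exact ⟨T, mem_elems.2 ⟨hT, hc⟩, hs⟩

lemma sum_elems_edges {N : Type*} [AddCommMonoid N] (g : Finset Plane → Finset Plane → N) :
    ∑ T ∈ M.elems, ∑ f ∈ T.powersetCard 2, g T f = ∑ f ∈ M.edges, ∑ T ∈ M.around f, g T f := by
  refine Finset.sum_comm' fun T f => ?_
  rw [Finset.mem_powersetCard, mem_edges, mem_around]
  constructor
  · rintro ⟨hT, hs, hc⟩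
    exact ⟨⟨hT, hs⟩, face_of_subset hT hs (Finset.card_pos.1 (by omega)), hc⟩
  · rintro ⟨⟨hT, hs⟩, -, hc⟩
    exact ⟨hT, hs, hc⟩

lemma card_edges_at_le (M : Triangulation) (p : Plane) :
    (M.edges.filter fun f => p ∈ f).card ≤ 3 * (M.around {p}).card := by
  have hsub : (M.edges.filter fun f => p ∈ f) ⊆
      (M.around {p}).biUnion fun T => T.powersetCard 2 := by
    intro f hf
    rw [Finset.mem_filter] at hf
    obtain ⟨T, hT, hs⟩ := exists_elem_of_mem_edges hf.1
    rw [Finset.mem_biUnion]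
    exact ⟨T, mem_around.2 ⟨hT, by simpa using hs hf.2⟩,
      Finset.mem_powersetCard.2 ⟨hs, (mem_edges.1 hf.1).2⟩⟩
  refine (Finset.card_le_card hsub).trans ?_
  rw [mul_comm]
  refine Finset.card_biUnion_le_card_mul _ _ _ fun T hT => ?_
  rw [Finset.card_powersetCard, (mem_elems.1 (mem_around.1 hT).1).2]
  decide

/-- Summation over edges of vertex quantities that are sums over the adjacent elements. -/
lemma sum_edges_le {g : Finset Plane → ℝ} (hg : ∀ T, 0 ≤ g T) {N : ℝ}
    (hN : ∀ p, ((M.around {p}).card : ℝ) ≤ N) :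
    ∑ f ∈ M.edges, ∑ p ∈ f, ∑ T ∈ M.around {p}, g T ≤ 9 * N * ∑ T ∈ M.elems, g T := by
  have e : ∑ f ∈ M.edges, ∑ p ∈ f, ∑ T ∈ M.around {p}, g T =
      ∑ T ∈ M.elems, ∑ p ∈ T, ((M.edges.filter fun f => p ∈ f).card : ℝ) * g T := by
    have h1 : ∀ f ∈ M.edges, ∑ p ∈ f, ∑ T ∈ M.around {p}, g T =
        ∑ T ∈ M.elems, ∑ p ∈ T, if p ∈ f then g T else 0 := by
      intro f _
      have : ∀ T ∈ M.elems, (∑ p ∈ T, if p ∈ f then g T else 0) =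
          ∑ p ∈ f.filter (fun p => p ∈ T), g T := by
        intro T _
        rw [← Finset.sum_filter]
        refine Finset.sum_congr ?_ fun _ _ => rfl
        ext z; simp [and_comm]
      rw [Finset.sum_congr rfl this]
      refine Finset.sum_comm' fun p T => ?_
      rw [mem_around, Finset.singleton_subset_iff, Finset.mem_filter]
      tauto
    rw [Finset.sum_congr rfl h1, Finset.sum_comm]
    refine Finset.sum_congr rfl fun T _ => ?_
    rw [Finset.sum_comm]
    refine Finset.sum_congr rfl fun p _ => ?_
    rw [← Finset.sum_filter, Finset.sum_const, nsmul_eq_mul]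
  rw [e, Finset.mul_sum]
  refine Finset.sum_le_sum fun T hT => ?_
  have h2 : ∀ p ∈ T, ((M.edges.filter fun f => p ∈ f).card : ℝ) * g T ≤ 3 * N * g T := by
    intro p _
    refine mul_le_mul_of_nonneg_right ?_ (hg T)
    have h3 : ((M.edges.filter fun f => p ∈ f).card : ℝ) ≤ 3 * (M.around {p}).card := by
      exact_mod_cast M.card_edges_at_le p
    linarith [hN p]
  refine (Finset.sum_le_sum h2).trans ?_
  rw [Finset.sum_const, (mem_elems.1 hT).2, nsmul_eq_mul]
  push_cast
  linarith

end Triangulation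

/-! ### The coarsening estimate -/

section EdgeMeans

variable {M : Triangulation} {F : Finset Site} {w : Site → Plane} {Q : Finset Micro}

lemma norm_edgeMean_sub_sq_le {κ : ℝ} (hM : M.ShapeRegular κ) (hF : ∀ ℓ ∉ F, w ℓ = 0)
    (hQ : ∀ τ ∉ Q, microGrad w τ = 0) {p q r : Plane} (hT : {p, q, r} ∈ M.elems)
    (hD : cr (q - p) (r - p) ≠ 0) :
    ‖edgeMean (interp F w) {p, q} - edgeMean (interp F w) {p, r}‖ ^ 2 ≤
      κ / 4 * gradSq Q w {p, q, r} := by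
  have hA := area_triple_pos hD
  have hκ := hM _ hT
  have hqr : ‖q - r‖ ^ 2 ≤ κ * area {p, q, r} := by
    refine le_trans ?_ hκ
    gcongr
    rw [← dist_eq_norm]
    exact Metric.dist_le_diam_of_mem (Finset.finite_toSet _).isBounded (by simp) (by simp)
  have h1 : ∀ i, edgeMean (interp F w) {p, q} i - edgeMean (interp F w) {p, r} i =
      (gradOver Q w {p, q, r}).mulVec (q - r).ofLp i / (2 * area {p, q, r}) := by
    intro i
    rw [edgeMean_pair, edgeMean_pair, gradOver_mulVec hF hQ hD, mul_div_cancel_left₀]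
    positivity
  have h2 : ‖edgeMean (interp F w) {p, q} - edgeMean (interp F w) {p, r}‖ ^ 2 =
      (∑ i, (gradOver Q w {p, q, r}).mulVec (q - r).ofLp i ^ 2) / (2 * area {p, q, r}) ^ 2 := by
    rw [norm_sq_plane, PiLp.sub_apply, PiLp.sub_apply, h1, h1, Fin.sum_univ_two]
    ring
  rw [h2, div_le_iff₀ (by positivity)]
  calc ∑ i, (gradOver Q w {p, q, r}).mulVec (q - r).ofLp i ^ 2
      ≤ frobSq (gradOver Q w {p, q, r}) * ‖q - r‖ ^ 2 := mulVec_sq_le _ _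
    _ ≤ (area {p, q, r} * gradSq Q w {p, q, r}) * (κ * area {p, q, r}) :=
        mul_le_mul (frobSq_gradOver_le Q w _) hqr (sq_nonneg _)
          (mul_nonneg hA.le (gradSq_nonneg _ _ _))
    _ = _ := by ring

lemma edgeMean_eq_zero
    (hbd : ∀ x ∉ interior M.domain, ∀ i, interp F w i x = 0) {T : Finset Plane}
    (hT : T ∈ M.elems) {p q : Plane} (hp : p ∈ T) (hq : q ∈ T) (hqp : q ≠ p)
    (hc : (M.around {p, q}).card ≠ 2) : edgeMean (interp F w) {p, q} = 0 := by
  have hp' : p ∉ interior M.domain := fun h =>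
    hc (Triangulation.card_around_of_mem_interior hT hp hq hqp h)
  have hq' : q ∉ interior M.domain := fun h => by
    rw [Finset.pair_comm] at hc
    exact hc (Triangulation.card_around_of_mem_interior hT hq hp hqp.symm h)
  have key : ∀ i, edgeMean (interp F w) {p, q} i = 0 := by
    intro i
    rw [edgeMean_pair, segMean, intervalIntegral.integral_congr (g := fun _ => 0)]
    · simp
    · intro t ht
      rw [Set.uIcc_of_le zero_le_one] at ht
      apply hbd
      rcases ht.1.eq_or_lt with h0 | h0
      · rw [← h0]; simpa using hp'
      rcases ht.2.eq_or_lt with h1 | h1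
      · rw [h1]; simpa using hq'
      intro hi
      exact hc (Triangulation.card_around_eq_two hT hp hq hqp.symm
        ⟨1 - t, t, by linarith, h0, by ring, rfl⟩ hi)
  ext i
  exact key i

/-- The defect of the quasi-interpolant on an edge. -/
def edgeDefect (M : Triangulation) (m : Finset Plane → Plane) (f : Finset Plane) : Plane :=
  m f - (1 / 2 : ℝ) • ∑ p ∈ f, M.vertexValue m p

lemma edgeDefect_pair (m : Finset Plane → Plane) {p q : Plane} (hpq : p ≠ q) (i : Fin 2) :
    edgeDefect M m {p, q} i =
      m {p, q} i - (1 / 2) * (M.vertexValue m p i + M.vertexValue m q i) := by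
  rw [edgeDefect, Finset.sum_pair hpq]
  simp
  ring

lemma edgeDefect_eq_zero
    (hbd : ∀ x ∉ interior M.domain, ∀ i, interp F w i x = 0) {f : Finset Plane}
    (hf : f ∈ M.edges) (hc : (M.around f).card ≠ 2) :
    edgeDefect M (edgeMean (interp F w)) f = 0 := by
  obtain ⟨T, hT, hs⟩ := Triangulation.exists_elem_of_mem_edges hf
  obtain ⟨p, q, hpq, rfl⟩ := Finset.card_eq_two.1 (Triangulation.mem_edges.1 hf).2
  have hp : p ∈ T := hs (by simp)
  have hq : q ∈ T := hs (by simp)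
  have hp' : p ∉ interior M.domain := fun h =>
    hc (Triangulation.card_around_of_mem_interior hT hp hq hpq.symm h)
  have hq' : q ∉ interior M.domain := fun h => by
    rw [Finset.pair_comm] at hc
    exact hc (Triangulation.card_around_of_mem_interior hT hq hp hpq h)
  rw [edgeDefect, Finset.sum_pair hpq, edgeMean_eq_zero hbd hT hp hq hpq.symm hc,
    Triangulation.vertexValue_boundary _ hp', Triangulation.vertexValue_boundary _ hq']
  simp

lemma norm_sub_vertexValue_sq_le {κ N : ℝ} (hκ : 0 ≤ κ) (hM : M.ShapeRegular κ)
    (hF : ∀ ℓ ∉ F, w ℓ = 0) (hQ : ∀ τ ∉ Q, microGrad w τ = 0)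
    (hbd : ∀ x ∉ interior M.domain, ∀ i, interp F w i x = 0)
    {p q : Plane} {T : Finset Plane} (hN : ((M.around {p}).card : ℝ) ≤ N) (hT : T ∈ M.elems)
    (hp : p ∈ T) (hq : q ∈ T) (hqp : q ≠ p) :
    ‖edgeMean (interp F w) {p, q} - M.vertexValue (edgeMean (interp F w)) p‖ ^ 2 ≤
      N ^ 2 * (κ / 4 * ∑ T ∈ M.around {p}, gradSq Q w T) := by
  set G := κ / 4 * ∑ T ∈ M.around {p}, gradSq Q w T with hG
  have hsum : 0 ≤ ∑ T ∈ M.around {p}, gradSq Q w T :=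
    Finset.sum_nonneg fun T _ => gradSq_nonneg _ _ _
  have hG0 : 0 ≤ G := by positivity
  have h := Triangulation.norm_sub_vertexValue_le (m := edgeMean (interp F w))
    (D := Real.sqrt G) (T := T) (p := p) (M := M) ?_ ?_ (Real.sqrt_nonneg _)
    (Triangulation.mem_around.2 ⟨hT, by simpa using hp⟩) hq hqp
  · have h2 := h.trans (mul_le_mul_of_nonneg_right hN (Real.sqrt_nonneg _))
    calc _ ≤ (N * Real.sqrt G) ^ 2 := by gcongr
      _ = N ^ 2 * G := by rw [mul_pow, Real.sq_sqrt hG0]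
  · intro T' hT' a ha b hb hap hbp
    rw [Triangulation.mem_around, Finset.singleton_subset_iff] at hT'
    by_cases hab : a = b
    · subst hab; simp
    · obtain ⟨c, rfl, -, -, hD⟩ := Triangulation.exists_third hT'.1 hT'.2 ha hap.symm
      have hbc : b = c := by
        simp only [Finset.mem_insert, Finset.mem_singleton] at hb
        rcases hb with h | h | h
        · exact absurd h hbp
        · exact absurd h.symm hab
        · exact h
      subst hbc
      apply Real.le_sqrt_of_sq_le
      refine (norm_edgeMean_sub_sq_le hM hF hQ hT'.1 hD).trans ?_
      rw [hG]
      refine mul_le_mul_of_nonneg_left ?_ (by positivity)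
      exact Finset.single_le_sum (f := fun T => gradSq Q w T) (fun T _ => gradSq_nonneg _ _ _)
        (Triangulation.mem_around.2 ⟨hT'.1, by simp⟩)
  · intro T' hT' a ha hap hc
    rw [Triangulation.mem_around, Finset.singleton_subset_iff] at hT'
    exact edgeMean_eq_zero hbd hT'.1 hT'.2 ha hap hc

lemma norm_half_add_sq_le (x y : Plane) :
    ‖(1 / 2 : ℝ) • (x + y)‖ ^ 2 ≤ 1 / 2 * (‖x‖ ^ 2 + ‖y‖ ^ 2) := by
  simp only [norm_sq_plane, PiLp.smul_apply, PiLp.add_apply, smul_eq_mul]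
  nlinarith [sq_nonneg (x 0 - y 0), sq_nonneg (x 1 - y 1)]

/-- The quasi-interpolation error on the edges is bounded by the gradient norm. -/
lemma sum_edgeDefect_sq_le {κ N : ℝ} (hκ : 0 ≤ κ) (hM : M.ShapeRegular κ)
    (hF : ∀ ℓ ∉ F, w ℓ = 0) (hQ : ∀ τ ∉ Q, microGrad w τ = 0)
    (hbd : ∀ x ∉ interior M.domain, ∀ i, interp F w i x = 0) (hN0 : 0 ≤ N)
    (hN : ∀ p, ((M.around {p}).card : ℝ) ≤ N) :
    ∑ f ∈ M.edges, ‖edgeDefect M (edgeMean (interp F w)) f‖ ^ 2 ≤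
      N ^ 3 * κ * 9 / 8 * ∑ τ ∈ Q, area τ.verts * frobSq (microGrad w τ) := by
  set m := edgeMean (interp F w) with hm
  have h1 : ∀ f ∈ M.edges, ‖edgeDefect M m f‖ ^ 2 ≤
      N ^ 2 * κ / 8 * ∑ p ∈ f, ∑ T ∈ M.around {p}, gradSq Q w T := by
    intro f hf
    obtain ⟨T, hT, hs⟩ := Triangulation.exists_elem_of_mem_edges hf
    obtain ⟨p, q, hpq, rfl⟩ := Finset.card_eq_two.1 (Triangulation.mem_edges.1 hf).2
    have hp : p ∈ T := hs (by simp)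
    have hq : q ∈ T := hs (by simp)
    have e : edgeDefect M m {p, q} = (1 / 2 : ℝ) • ((m {p, q} - M.vertexValue m p) +
        (m {q, p} - M.vertexValue m q)) := by
      rw [edgeDefect, Finset.sum_pair hpq, Finset.pair_comm q p]
      have : m {p, q} = (1 / 2 : ℝ) • (m {p, q} + m {p, q}) := by
        rw [← two_smul ℝ (m {p, q}), smul_smul]; norm_num
      conv_lhs => rw [this]
      rw [← smul_sub]
      congr 1
      abel
    have a1 := norm_sub_vertexValue_sq_le hκ hM hF hQ hbd (hN p) hT hp hq hpq.symm
    have a2 := norm_sub_vertexValue_sq_le hκ hM hF hQ hbd (hN q) hT hq hp hpq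
    rw [← hm] at a1 a2
    rw [e, Finset.sum_pair hpq]
    refine (norm_half_add_sq_le _ _).trans ?_
    linarith
  refine (Finset.sum_le_sum h1).trans ?_
  rw [← Finset.mul_sum]
  have h2 := Triangulation.sum_edges_le (M := M) (g := gradSq Q w)
    (fun T => gradSq_nonneg _ _ _) hN
  have h3 := sum_gradSq_le M Q w
  calc _ ≤ N ^ 2 * κ / 8 * (9 * N * ∑ τ ∈ Q, area τ.verts * frobSq (microGrad w τ)) := by
        refine mul_le_mul_of_nonneg_left (h2.trans ?_) (by positivity)
        exact mul_le_mul_of_nonneg_left h3 (by positivity)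
    _ = _ := by ring

end EdgeMeans

namespace Coupling

variable {X : Crystal} (S : Coupling X)

lemma frob_tensor_scaledNormal (σ : Matrix (Fin 2) (Fin 2) ℝ) (e : Plane) (T f : Finset Plane) :
    frob σ (tensor e (scaledNormal T f)) = Metric.diam (f : Set Plane) *
      inner ℝ e (WithLp.toLp 2 (σ.mulVec (outwardNormal T f).ofLp) : Plane) := by
  simp only [frob, tensor, scaledNormal, Matrix.vecMulVec_apply, Fin.sum_univ_two, inner_plane,
    Matrix.mulVec, dotProduct, PiLp.smul_apply, smul_eq_mul]
  ring

/-- The residual of the a/c stress in terms of the jumps over interior edges. -/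
lemma sum_stressH_gradOver_eq {B : Plane →L[ℝ] Plane} {y : Plane → Plane}
    (hy : S.IsSolution B y) {F : Finset Site} {w : Site → Plane} {Q : Finset Micro}
    (hF : ∀ ℓ ∉ F, w ℓ = 0) (hQ : ∀ τ ∉ Q, microGrad w τ = 0)
    (hbd : ∀ x ∉ interior S.mesh.domain, ∀ i, interp F w i x = 0) :
    ∑ T ∈ S.mesh.elems, frob (S.stressH y T) (gradOver Q w T) =
      ∑ f ∈ S.mesh.interiorEdges, Metric.diam (f : Set Plane) *
        inner ℝ (edgeDefect S.mesh (edgeMean (interp F w)) f) (S.jump y f) := by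
  classical
  set m := edgeMean (interp F w) with hm
  set e := edgeDefect S.mesh m with he
  set v := S.mesh.nodal (S.mesh.vertexValue m) with hvdef
  have hv : v ∈ S.mesh.displacements := Triangulation.nodal_mem_displacements fun p hp =>
    Triangulation.vertexValue_boundary m hp
  have hvv : ∀ {T}, T ∈ S.mesh.elems → ∀ z ∈ T, v z = S.mesh.vertexValue m z :=
    fun hT z hz => Triangulation.nodal_vertex hT hz
  have h1 : ∀ T ∈ S.mesh.elems, gradOver Q w T = area T • matOf (elemGrad v T) +
      ∑ f ∈ T.powersetCard 2, tensor (e f) (scaledNormal T f) := by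
    intro T hT
    obtain ⟨p, hp⟩ : T.Nonempty :=
      Finset.card_pos.1 (by rw [(Triangulation.mem_elems.1 hT).2]; norm_num)
    obtain ⟨q, r, rfl, hpq, hpr, hqr, hD⟩ := Triangulation.exists_two hT hp
    rw [← eq_sum_tensor (D := gradOver Q w {p, q, r} - area {p, q, r} • matOf (elemGrad v {p, q, r}))
      hpq hpr hqr hD]
    · abel
    · intro i
      rw [Matrix.sub_mulVec, Pi.sub_apply, gradOver_mulVec hF hQ hD, Matrix.smul_mulVec,
        Pi.smul_apply, matOf_mulVec, elemGrad_sub hT hv (by simp) (by simp),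
        hvv hT q (by simp), hvv hT r (by simp), he,
        edgeDefect_pair _ hpq, edgeDefect_pair _ hpr, hm, edgeMean_pair, edgeMean_pair,
        PiLp.sub_apply, smul_eq_mul]
      ring
    · intro i
      have s2 : ({q, r, p} : Finset Plane) = {p, q, r} := by ext z; simp; tauto
      have h3 := gradOver_mulVec hF hQ (p := q) (q := r) (r := p) (by rwa [cr_rotate]) i
      rw [s2] at h3
      rw [Matrix.sub_mulVec, Pi.sub_apply, h3, Matrix.smul_mulVec,
        Pi.smul_apply, matOf_mulVec, elemGrad_sub hT hv (by simp) (by simp),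
        hvv hT r (by simp), hvv hT p (by simp), he,
        edgeDefect_pair _ hqr, edgeDefect_pair _ hpq, hm, edgeMean_pair, edgeMean_pair,
        PiLp.sub_apply, smul_eq_mul, segMean_comm _ q p]
      ring
  have h2 : ∀ T ∈ S.mesh.elems, frob (S.stressH y T) (gradOver Q w T) =
      area T * frob (S.stressH y T) (matOf (elemGrad v T)) +
        ∑ f ∈ T.powersetCard 2, Metric.diam (f : Set Plane) * inner ℝ (e f)
          (WithLp.toLp 2 ((S.stressH y T).mulVec (outwardNormal T f).ofLp) : Plane) := by
    intro T hT
    rw [h1 T hT, frob_add_right, frob_smul_right, frob_sum_right]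
    simp only [frob_tensor_scaledNormal]
  rw [Finset.sum_congr rfl h2, Finset.sum_add_distrib, S.sum_stressH hy hv, zero_add,
    Triangulation.sum_elems_edges]
  have hsub : S.mesh.interiorEdges ⊆ S.mesh.edges := fun f hf => by
    rw [Triangulation.mem_interiorEdges] at hf
    exact Triangulation.mem_edges.2 ⟨hf.1, hf.2.1⟩
  rw [← Finset.sum_subset hsub]
  · refine Finset.sum_congr rfl fun f _ => ?_
    rw [← Finset.mul_sum, ← inner_sum, jump]
    congr 2
  · intro f hf hfi
    have hc : (S.mesh.around f).card ≠ 2 := fun hc => hfi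
      (Triangulation.mem_interiorEdges.2 ⟨(Triangulation.mem_edges.1 hf).1,
        (Triangulation.mem_edges.1 hf).2, hc⟩)
    have : e f = 0 := edgeDefect_eq_zero hbd hf hc
    simp [this]

/-- The constant of the coarsening estimate. -/
def coarseConst (κ : ℝ) : ℝ :=
  Real.sqrt ((volume.real (Metric.ball (0 : Plane) 1) * κ) ^ 3 * κ * 9 / 8)

lemma sum_stressH_gradOver_le {B : Plane →L[ℝ] Plane} {y : Plane → Plane}
    (hy : S.IsSolution B y) {κ : ℝ} (hκ : 0 ≤ κ) (hM : S.mesh.ShapeRegular κ)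
    {F : Finset Site} {w : Site → Plane} {Q : Finset Micro}
    (hF : ∀ ℓ ∉ F, w ℓ = 0) (hQ : ∀ τ ∉ Q, microGrad w τ = 0)
    (hbd : ∀ x ∉ interior S.mesh.domain, ∀ i, interp F w i x = 0) :
    ∑ T ∈ S.mesh.elems, frob (S.stressH y T) (gradOver Q w T) ≤
      coarseConst κ * S.coarsening y *
        Real.sqrt (∑ τ ∈ Q, area τ.verts * frobSq (microGrad w τ)) := by
  rw [S.sum_stressH_gradOver_eq hy hF hQ hbd]
  set e := edgeDefect S.mesh (edgeMean (interp F w))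
  have hvol : 0 ≤ volume.real (Metric.ball (0 : Plane) 1) := measureReal_nonneg
  have hb := sum_edgeDefect_sq_le hκ hM hF hQ hbd (by positivity)
    (Triangulation.card_around_le hκ hM)
  have hsub : S.mesh.interiorEdges ⊆ S.mesh.edges := fun f hf => by
    rw [Triangulation.mem_interiorEdges] at hf
    exact Triangulation.mem_edges.2 ⟨hf.1, hf.2.1⟩
  have hb' : ∑ f ∈ S.mesh.interiorEdges, ‖e f‖ ^ 2 ≤ ∑ f ∈ S.mesh.edges, ‖e f‖ ^ 2 :=
    Finset.sum_le_sum_of_subset_of_nonneg hsub fun _ _ _ => sq_nonneg _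
  calc _ ≤ ∑ f ∈ S.mesh.interiorEdges,
        (Metric.diam (f : Set Plane) * ‖S.jump y f‖) * ‖e f‖ := by
        refine Finset.sum_le_sum fun f _ => ?_
        rw [mul_assoc, mul_comm ‖S.jump y f‖]
        exact mul_le_mul_of_nonneg_left (real_inner_le_norm _ _) Metric.diam_nonneg
    _ ≤ Real.sqrt (∑ f ∈ S.mesh.interiorEdges,
          (Metric.diam (f : Set Plane) * ‖S.jump y f‖) ^ 2) *
        Real.sqrt (∑ f ∈ S.mesh.interiorEdges, ‖e f‖ ^ 2) :=
        Real.sum_mul_le_sqrt_mul_sqrt _ _ _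
    _ ≤ S.coarsening y * (coarseConst κ *
        Real.sqrt (∑ τ ∈ Q, area τ.verts * frobSq (microGrad w τ))) := by
        refine mul_le_mul_of_nonneg_left ?_ (Real.sqrt_nonneg _)
        rw [coarseConst, ← Real.sqrt_mul (by positivity)]
        exact Real.sqrt_le_sqrt (hb'.trans hb)
    _ = _ := by ring

end Coupling

/-! ### Sums over bonds -/

/-- The sum over the directed bonds that are edges of a micro-triangle. -/
def bondSum {E : Type*} [AddCommMonoid E] (f : Site → Fin 6 → E) (τ : Micro) : E :=
  ∑ ℓ ∈ τ.sites, ∑ j : Fin 6, if ℓ + dir j ∈ τ.sites then f ℓ j else 0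

lemma bondSum_true {E : Type*} [AddCommMonoid E] (f : Site → Fin 6 → E) (ξ : Site) :
    bondSum f (ξ, true) = f ξ 0 + f ξ 5 + (f (ξ + (1, 0)) 3 + f (ξ + (1, 0)) 4) +
      (f (ξ + (0, 1)) 1 + f (ξ + (0, 1)) 2) := by
  obtain ⟨a, b⟩ := ξ
  simp [bondSum, Micro.sites, Micro.sgn, Fin.sum_univ_six, dir, add_assoc]

lemma bondSum_false {E : Type*} [AddCommMonoid E] (f : Site → Fin 6 → E) (ξ : Site) :
    bondSum f (ξ, false) = f ξ 2 + f ξ 3 + (f (ξ + (-1, 0)) 0 + f (ξ + (-1, 0)) 1) +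
      (f (ξ + (0, -1)) 4 + f (ξ + (0, -1)) 5) := by
  obtain ⟨a, b⟩ := ξ
  simp [bondSum, Micro.sites, Micro.sgn, Fin.sum_univ_six, dir, add_assoc]

/-- Every directed bond is an edge of two micro-triangles. -/
lemma hasSum_bondSum {f : Site → Fin 6 → ℝ} {s : Fin 6 → ℝ}
    (hf : ∀ j, HasSum (fun ℓ => f ℓ j) (s j)) :
    HasSum (fun τ : Micro => bondSum f τ) (2 * ∑ j, s j) := by
  have hf' : ∀ j (a : Site), HasSum (fun ℓ => f (ℓ + a) j) (s j) := fun j a =>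
    (Equiv.addRight a).hasSum_iff.2 (hf j)
  have ht : HasSum (fun ξ : Site => bondSum f (ξ, true)) (∑ j, s j) := by
    simp only [bondSum_true]
    convert (((hf 0).add (hf 5)).add ((hf' 3 (1, 0)).add (hf' 4 (1, 0)))).add
      ((hf' 1 (0, 1)).add (hf' 2 (0, 1))) using 1
    rw [Fin.sum_univ_six]; ring
  have hb : HasSum (fun ξ : Site => bondSum f (ξ, false)) (∑ j, s j) := by
    simp only [bondSum_false]
    convert (((hf 2).add (hf 3)).add ((hf' 0 (-1, 0)).add (hf' 1 (-1, 0)))).add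
      ((hf' 4 (0, -1)).add (hf' 5 (0, -1))) using 1
    rw [Fin.sum_univ_six]; ring
  have key : ∀ b : Bool, HasSum (fun ξ : Site => bondSum f (ξ, b)) (∑ j, s j) →
      HasSum (fun τ : Micro => if τ.2 = b then bondSum f τ else 0) (∑ j, s j) := by
    intro b h
    have hi : Function.Injective fun ξ : Site => ((ξ, b) : Micro) := fun _ _ h => by simpa using h
    refine (hi.hasSum_iff ?_).1 ?_
    · rintro ⟨ξ, b'⟩ h
      have : b' ≠ b := by rintro rfl; exact h ⟨ξ, rfl⟩
      simp [this]
    · simpa [Function.comp_def] using h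
  convert (key true ht).add (key false hb) using 1
  · funext τ
    obtain ⟨ξ, b⟩ := τ
    cases b <;> simp
  · ring

/-- The stress of bond forces. -/
def bondStress (p : Site → Fin 6 → Plane) (τ : Micro) : Matrix (Fin 2) (Fin 2) ℝ :=
  bondSum (fun ℓ j => tensor (p ℓ j) (nn j)) τ

lemma frob_bondStress (p : Site → Fin 6 → Plane) (w : Site → Plane) (τ : Micro) :
    frob (bondStress p τ) (microGrad w τ) =
      bondSum (fun ℓ j => dot (p ℓ j) (w (ℓ + dir j) - w ℓ)) τ := by
  rw [bondStress, bondSum, bondSum, frob_sum_left]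
  refine Finset.sum_congr rfl fun ℓ hℓ => ?_
  rw [frob_sum_left]
  refine Finset.sum_congr rfl fun j _ => ?_
  split_ifs with h
  · refine frob_tensor_of_mulVec fun i => ?_
    have : nn j = pos (ℓ + dir j) - pos ℓ := by rw [pos_add, nn]; abel
    rw [this, microGrad_mulVec_sub w τ hℓ h]
    rfl
  · simp

lemma bondStress_congr {p p' : Site → Fin 6 → Plane} {τ : Micro}
    (h : ∀ ℓ ∈ τ.sites, ∀ j, p ℓ j = p' ℓ j) : bondStress p τ = bondStress p' τ := by
  rw [bondStress, bondStress, bondSum, bondSum]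
  refine Finset.sum_congr rfl fun ℓ hℓ => Finset.sum_congr rfl fun j _ => ?_
  rw [h ℓ hℓ j]

/-- The six directed bonds of a micro-triangle have the six lattice directions. -/
lemma bondStress_const (p : Fin 6 → Plane) (τ : Micro) :
    bondStress (fun _ j => p j) τ = ∑ j, tensor (p j) (nn j) := by
  obtain ⟨ξ, b⟩ := τ
  rw [bondStress]
  cases b
  · rw [bondSum_false, Fin.sum_univ_six]; abel
  · rw [bondSum_true, Fin.sum_univ_six]; abel

/-! ### Lattice functions with compactly supported gradient -/

lemma eq_of_microGrad_eq_zero {w : Site → Plane} {τ : Micro} (h : microGrad w τ = 0)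
    {ℓ ℓ' : Site} (hℓ : ℓ ∈ τ.sites) (hℓ' : ℓ' ∈ τ.sites) : w ℓ' = w ℓ := by
  have key : ∀ i, w ℓ' i = w ℓ i := fun i => by
    have := microGrad_mulVec_sub w τ hℓ hℓ' i
    rw [h] at this
    simp at this
    linarith
  ext i; exact key i

lemma int_const_of_succ {E : Type*} {f : ℤ → E} (h : ∀ a, f (a + 1) = f a) (a b : ℤ) :
    f a = f b := by
  have key : ∀ a, f a = f 0 := by
    intro a
    induction a using Int.induction_on with
    | zero => rfl
    | succ n ih => rw [h, ih]
    | pred n ih => rw [← h, sub_add_cancel, ih]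
  rw [key a, key b]

lemma abs_le_two_mul_norm_pos (ℓ : Site) :
    |(ℓ.1 : ℝ)| ≤ 2 * ‖pos ℓ‖ ∧ |(ℓ.2 : ℝ)| ≤ 2 * ‖pos ℓ‖ := by
  have h := norm_sq_lc (pos ℓ)
  rw [lc1_pos, lc2_pos] at h
  have h0 := norm_nonneg (pos ℓ)
  constructor <;> refine abs_le_of_sq_le_sq ?_ (by positivity)
  · nlinarith [sq_nonneg ((ℓ.1 : ℝ) + 2 * ℓ.2)]
  · nlinarith [sq_nonneg (2 * (ℓ.1 : ℝ) + ℓ.2)]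

/-- The lattice points in a large box. -/
def box (n : ℕ) : Finset Site := Finset.Icc (-(n : ℤ)) n ×ˢ Finset.Icc (-(n : ℤ)) n

lemma mem_box {n : ℕ} {ℓ : Site} (h : 2 * ‖pos ℓ‖ ≤ n) : ℓ ∈ box n := by
  obtain ⟨h1, h2⟩ := abs_le_two_mul_norm_pos ℓ
  have h1 := abs_le.1 (h1.trans h)
  have h2 := abs_le.1 (h2.trans h)
  simp only [box, Finset.mem_product, Finset.mem_Icc]
  exact ⟨⟨by exact_mod_cast h1.1, by exact_mod_cast h1.2⟩, by exact_mod_cast h2.1,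
    by exact_mod_cast h2.2⟩

lemma finite_norm_pos_le (r : ℝ) : {ℓ : Site | ‖pos ℓ‖ ≤ r}.Finite := by
  obtain ⟨N, hN⟩ := exists_nat_ge (2 * r)
  refine (box N).finite_toSet.subset fun ℓ hℓ => mem_box ?_
  have hℓ' : ‖pos ℓ‖ ≤ r := hℓ
  linarith

/-- A lattice function with compactly supported gradient is constant off a finite set. -/
lemma CompactGrad.exists_const {w : Site → Plane} (hw : CompactGrad w) :
    ∃ c, {ℓ | w ℓ ≠ c}.Finite := by
  obtain ⟨N, hN⟩ : ∃ N : ℤ, ∀ ξ : Site, N ≤ |ξ.1| ∨ N ≤ |ξ.2| → microGrad w (ξ, true) = 0 := by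
    obtain ⟨M, hM⟩ := (hw.image fun τ : Micro => max |τ.1.1| |τ.1.2|).bddAbove
    refine ⟨M + 1, fun ξ hξ => ?_⟩
    by_contra h
    have h2 : max |ξ.1| |ξ.2| ≤ M := hM ⟨(ξ, true), h, rfl⟩
    rw [max_le_iff] at h2
    omega
  have hrow : ∀ a a' b : ℤ, N ≤ |b| → w (a, b) = w (a', b) := fun a a' b hb =>
    int_const_of_succ (f := fun a => w (a, b)) (fun a =>
      eq_of_microGrad_eq_zero (hN (a, b) (Or.inr hb)) (by simp [Micro.sites])
        (by simp [Micro.sites, Micro.sgn])) a a'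
  have hcol : ∀ a b b' : ℤ, N ≤ |a| → w (a, b) = w (a, b') := fun a b b' ha =>
    int_const_of_succ (f := fun b => w (a, b)) (fun b =>
      eq_of_microGrad_eq_zero (hN (a, b) (Or.inl ha)) (by simp [Micro.sites])
        (by simp [Micro.sites, Micro.sgn])) b b'
  refine ⟨w (N, N), ((Set.finite_Icc (-N) N).prod (Set.finite_Icc (-N) N)).subset ?_⟩
  rintro ⟨a, b⟩ h
  by_contra hout
  apply h
  have : N ≤ |a| ∨ N ≤ |b| := by
    by_contra! hcon
    rw [abs_lt, abs_lt] at hcon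
    apply hout
    simp only [Set.mem_prod, Set.mem_Icc]
    omega
  rcases this with ha | hb
  · rw [hcol a b N ha, hrow a N N (le_abs_self N)]
  · rw [hrow a N b hb, hcol N b N (le_abs_self N)]

lemma CompactGrad.finite_bonds {w : Site → Plane} (hw : CompactGrad w) :
    {ℓ | ∃ j, w (ℓ + dir j) ≠ w ℓ}.Finite := by
  obtain ⟨c, hc⟩ := hw.exists_const
  have h : ∀ j : Fin 6, {ℓ | w (ℓ + dir j) ≠ c}.Finite := fun j =>
    hc.preimage (f := fun ℓ => ℓ + dir j) (add_left_injective _).injOn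
  refine (hc.union (Set.finite_iUnion h)).subset ?_
  rintro ℓ ⟨j, hj⟩
  by_cases h1 : w ℓ = c
  · refine Or.inr (Set.mem_iUnion.2 ⟨j, ?_⟩)
    rw [h1] at hj
    exact hj
  · exact Or.inl h1

/-- A homogeneous stress does no work on a displacement with compact gradient. -/
lemma CompactGrad.hasSum_dot {w : Site → Plane} (hw : CompactGrad w) (p : Plane) (j : Fin 6) :
    HasSum (fun ℓ => dot p (w (ℓ + dir j) - w ℓ)) 0 := by
  obtain ⟨c, hc⟩ := hw.exists_const
  have h1 : Summable fun ℓ => dot p (w ℓ - c) := by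
    refine summable_of_hasFiniteSupport (hc.subset fun ℓ hℓ => ?_)
    rintro h : w ℓ = c
    simp [h] at hℓ
  have h2 : HasSum (fun ℓ => dot p (w (ℓ + dir j) - c)) (∑' ℓ, dot p (w ℓ - c)) :=
    (Equiv.addRight (dir j)).hasSum_iff (f := fun ℓ => dot p (w ℓ - c)) |>.2 h1.hasSum
  convert! h2.sub h1.hasSum using 1
  · funext ℓ
    simp only [dot, PiLp.sub_apply, Fin.sum_univ_two]
    ring
  · ring

/-! ### The first variation of the atomistic energy -/

lemma sum_frob_le {ι : Type*} (Q : Finset ι) (a : ι → ℝ) (ha : ∀ k ∈ Q, 0 ≤ a k)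
    (M N : ι → Matrix (Fin 2) (Fin 2) ℝ) :
    |∑ k ∈ Q, a k * frob (M k) (N k)| ≤
      Real.sqrt (∑ k ∈ Q, a k * frobSq (M k)) * Real.sqrt (∑ k ∈ Q, a k * frobSq (N k)) := by
  refine (Finset.abs_sum_le_sum_abs _ _).trans ?_
  have h : ∀ k ∈ Q, |a k * frob (M k) (N k)| ≤
      Real.sqrt (a k * frobSq (M k)) * Real.sqrt (a k * frobSq (N k)) := by
    intro k hk
    rw [← Real.sqrt_mul (mul_nonneg (ha k hk) (frobSq_nonneg _))]
    apply Real.abs_le_sqrt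
    nlinarith [mul_le_mul_of_nonneg_left (frob_sq_le (M k) (N k)) (sq_nonneg (a k))]
  refine (Finset.sum_le_sum h).trans ((Real.sum_mul_le_sqrt_mul_sqrt _ _ _).trans_eq ?_)
  congr 2 <;> refine Finset.sum_congr rfl fun k hk => Real.sq_sqrt ?_ <;>
    exact mul_nonneg (ha k hk) (frobSq_nonneg _)

lemma sqrt_sum_le_gradNorm {v : Site → Plane} (hv : v ∈ energySpace) (Q : Finset Micro) :
    Real.sqrt (∑ τ ∈ Q, area τ.verts * frobSq (microGrad v τ)) ≤ gradNorm v := by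
  apply Real.sqrt_le_sqrt
  exact Summable.sum_le_tsum Q (fun τ _ => mul_nonneg (area_nonneg _) (frobSq_nonneg _)) hv

lemma CompactGrad.mem_energySpace {w : Site → Plane} (hw : CompactGrad w) : w ∈ energySpace := by
  refine summable_of_hasFiniteSupport (hw.subset fun τ hτ => ?_)
  intro h
  simp [h, frobSq] at hτ

namespace Crystal

variable (X : Crystal)

/-- The bond forces `∂_ρ V_ℓ`, zero on bonds to vacancies. -/
def bondForce (y : Site → Plane) (ℓ : Site) (j : Fin 6) : Plane := by
  classical exact
    if ℓ ∉ X.vac ∧ ℓ + dir j ∉ X.vac then partialGrad (X.Vsite ℓ) (X.stencil y ℓ) j else 0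

/-- The bond forces of the homogeneous deformation `B`. -/
def homForce (B : Plane →L[ℝ] Plane) (j : Fin 6) : Plane := partialGrad X.V (fun k => B (nn k)) j

lemma stressA_eq (y : Site → Plane) (τ : Micro) :
    X.stressA y τ = (1 / latticeMatrix.det) • bondStress (X.bondForce y) τ := by
  rw [stressA, bondStress, bondSum]
  congr 1
  refine Finset.sum_congr rfl fun ℓ _ => Finset.sum_congr rfl fun j _ => ?_
  by_cases h1 : ℓ + dir j ∈ τ.sites <;> by_cases h2 : ℓ ∉ X.vac ∧ ℓ + dir j ∉ X.vac <;>
    simp [bondForce, h1, h2, tensor]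

lemma stressCB_eq (B : Plane →L[ℝ] Plane) (τ : Micro) :
    X.stressCB B = (1 / latticeMatrix.det) • bondStress (fun _ => X.homForce B) τ := by
  rw [stressCB, bondStress_const]
  rfl

lemma area_mul_frob_stress (p : Site → Fin 6 → Plane) (w : Site → Plane) (τ : Micro) :
    area τ.verts * frob ((1 / latticeMatrix.det) • bondStress p τ) (microGrad w τ) =
      1 / 2 * bondSum (fun ℓ j => dot (p ℓ j) (w (ℓ + dir j) - w ℓ)) τ := by
  have := sqrt_three_pos
  rw [frob_smul_left, frob_bondStress, Micro.area_verts, latticeMatrix_det]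
  field_simp
  norm_num

/-- The work of the stress is the work of the bond forces. -/
lemma hasSum_stressA_sub (y : Site → Plane) (B : Plane →L[ℝ] Plane) {w : Site → Plane}
    (hw : CompactGrad w) :
    HasSum (fun τ => area τ.verts * frob (X.stressA y τ - X.stressCB B) (microGrad w τ))
      (∑ j, ∑ ℓ ∈ hw.finite_bonds.toFinset,
        dot (X.bondForce y ℓ j) (w (ℓ + dir j) - w ℓ)) := by
  have h1 := hasSum_bondSum (fun j => hw.hasSum_dot (X.homForce B j) j)
  have h2 := hasSum_bondSum (f := fun ℓ j => dot (X.bondForce y ℓ j) (w (ℓ + dir j) - w ℓ))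
    (fun j => hasSum_sum_of_ne_finset_zero (s := hw.finite_bonds.toFinset) (fun ℓ hℓ => by
      have h : w (ℓ + dir j) - w ℓ = 0 := by
        by_contra hne
        exact hℓ (by simpa using ⟨j, sub_ne_zero.1 hne⟩)
      rw [h, dot_zero_right]))
  convert! (h2.mul_left (1 / 2)).sub (h1.mul_left (1 / 2)) using 1
  · funext τ
    rw [frob_sub_left, mul_sub, X.stressA_eq, X.stressCB_eq B τ, area_mul_frob_stress,
      area_mul_frob_stress]
  · simp

lemma hasDerivAt_energyDiff (y : Site → Plane) {w : Site → Plane} (hw : CompactGrad w) :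
    HasDerivAt (fun t : ℝ => X.energyDiff y (y + t • w))
      (∑ j, ∑ ℓ ∈ hw.finite_bonds.toFinset,
        dot (X.bondForce y ℓ j) (w (ℓ + dir j) - w ℓ)) 0 := by
  classical
  set P := hw.finite_bonds.toFinset with hP
  have hz : ∀ ℓ ∉ P, X.stencil w ℓ = 0 := by
    intro ℓ hℓ
    funext j
    have h : w (ℓ + dir j) - w ℓ = 0 := by
      by_contra hne
      exact hℓ (by simpa [hP] using ⟨j, sub_ne_zero.1 hne⟩)
    simp [stencil, h]
  have e : (fun t : ℝ => X.energyDiff y (y + t • w)) = fun t =>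
      ∑ ℓ ∈ P with ℓ ∉ X.vac,
        (X.Vsite ℓ (X.stencil y ℓ + t • X.stencil w ℓ) - X.Vsite ℓ (X.stencil y ℓ)) := by
    funext t
    rw [energyDiff, tsum_eq_sum (s := P.subtype (· ∉ X.vac)), ← Finset.sum_subtype_eq_sum_filter]
    · simp only [stencil_add_smul]
    · intro ℓ hℓ
      rw [stencil_add_smul, hz ℓ (by simpa using hℓ)]
      simp
  rw [e, Finset.sum_comm, ← Finset.sum_filter_of_ne (p := fun ℓ => ℓ ∉ X.vac)]
  · refine HasDerivAt.fun_sum fun ℓ hℓ => ?_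
    have h := hasDerivAt_stencil ((X.contDiff_Vsite ℓ).differentiable (by norm_num))
      (X.stencil y ℓ) (X.stencil w ℓ)
    convert h.sub_const _ using 1
    refine Finset.sum_congr rfl fun j _ => ?_
    by_cases hj : ℓ + dir j ∈ X.vac
    · simp [bondForce, stencil, hj]
    · simp [bondForce, stencil, hj, (Finset.mem_filter.1 hℓ).2]
  · intro ℓ _ h hv
    exact h (Finset.sum_eq_zero fun j _ => by simp [bondForce, hv])

/-- The first variation as a stress functional. -/
def variation (y : Site → Plane) (B : Plane →L[ℝ] Plane) (F : Finset Micro) :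
    energySpace →ₗ[ℝ] ℝ where
  toFun v := ∑ τ ∈ F, area τ.verts * frob (X.stressA y τ - X.stressCB B) (microGrad v τ)
  map_add' v w := by
    rw [← Finset.sum_add_distrib]
    refine Finset.sum_congr rfl fun τ _ => ?_
    rw [Submodule.coe_add, microGrad_add, frob_add_right, mul_add]
  map_smul' c v := by
    rw [RingHom.id_apply, smul_eq_mul, Finset.mul_sum]
    refine Finset.sum_congr rfl fun τ _ => ?_
    rw [Submodule.coe_smul, microGrad_smul, frob_smul_right]
    ring

lemma isFirstVariation_variation {y : Site → Plane} {B : Plane →L[ℝ] Plane} {F : Finset Micro}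
    (hF : ∀ τ ∉ F, X.stressA y τ = X.stressCB B) :
    X.IsFirstVariation y (X.variation y B F) := by
  constructor
  · refine ⟨_, fun v => (sum_frob_le F _ (fun τ _ => area_nonneg _) _ _).trans
      (mul_le_mul_of_nonneg_left (sqrt_sum_le_gradNorm v.2 F) (Real.sqrt_nonneg _))⟩
  · intro v hv
    convert X.hasDerivAt_energyDiff y hv using 1
    refine HasSum.unique (hasSum_sum_of_ne_finset_zero fun τ hτ => ?_)
      (X.hasSum_stressA_sub y B hv)
    rw [hF τ hτ]
    simp

/-- The atomistic stress is the Cauchy--Born stress where the crystal is homogeneous and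
deformed affinely. -/
lemma stressA_eq_stressCB {y : Site → Plane} {B : Plane →L[ℝ] Plane} {τ : Micro}
    (hc : ∀ ℓ ∈ τ.sites, pos ℓ ∉ X.core)
    (hy : ∀ ℓ ∈ τ.sites, ∀ j, y (ℓ + dir j) - y ℓ = B (nn j)) : X.stressA y τ = X.stressCB B := by
  rw [X.stressA_eq, X.stressCB_eq B τ]
  congr 1
  refine bondStress_congr fun ℓ hℓ j => ?_
  obtain ⟨hV, hvac⟩ := X.homogeneous ℓ (hc ℓ hℓ)
  have hℓv : ℓ ∉ X.vac := fun h => hc ℓ hℓ (X.vac_mem_core ℓ h)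
  have hs : X.stencil y ℓ = fun k => B (nn k) := by
    funext k
    rw [stencil, if_neg (hvac k), hy ℓ hℓ k]
  rw [bondForce, if_pos ⟨hℓv, hvac j⟩, hV, hs, homForce]

end Crystal

namespace Coupling

variable {X : Crystal} (S : Coupling X)

lemma core_subset_domain : X.core ⊆ S.mesh.domain := fun x hx => by
  have h := S.core_subset hx
  simp only [Set.mem_iUnion] at h
  obtain ⟨T, hT, hx⟩ := h
  exact Triangulation.hull_subset_domain (S.meshA_subset hT) hx

/-- Away from the domain the deformed crystal has the far-field stress. -/
lemma stressA_eq_stressCB {B : Plane →L[ℝ] Plane} {y : Plane → Plane} (hy : S.Admissible B y)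
    {τ : Micro} (hτ : ¬ hull τ.verts ⊆ Metric.cthickening 2 S.mesh.domain) :
    X.stressA (y ∘ pos) τ = X.stressCB B := by
  obtain ⟨x, hx, hx2⟩ := Set.not_subset.1 hτ
  have far : ∀ z, dist x z ≤ 2 → z ∉ S.mesh.domain := fun z hz hzd =>
    hx2 (Metric.mem_cthickening_of_dist_le x z 2 _ hzd hz)
  have hB : ∀ z, dist x z ≤ 2 → y z = B z := fun z hz =>
    sub_eq_zero.1 (hy.2.2 z fun h => far z hz (interior_subset h))
  have h1 : ∀ ℓ ∈ τ.sites, dist x (pos ℓ) ≤ 1 := fun ℓ hℓ =>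
    τ.dist_le_one hx (Micro.pos_mem_hull hℓ)
  have h2 : ∀ ℓ ∈ τ.sites, ∀ j, dist x (pos (ℓ + dir j)) ≤ 2 := fun ℓ hℓ j => by
    have : dist (pos ℓ) (pos (ℓ + dir j)) = 1 := by
      rw [pos_add, dist_self_add_right]; exact norm_nn j
    linarith [dist_triangle x (pos ℓ) (pos (ℓ + dir j)), h1 ℓ hℓ]
  refine X.stressA_eq_stressCB (fun ℓ hℓ h => far _ (by linarith [h1 ℓ hℓ])
    (S.core_subset_domain h)) fun ℓ hℓ j => ?_
  simp only [Function.comp]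
  rw [hB _ (h2 ℓ hℓ j), hB _ (by linarith [h1 ℓ hℓ]), ← map_sub, pos_add, add_sub_cancel_left, nn]

lemma finite_micro_of_bounded {s : Set Plane} (hs : Bornology.IsBounded s) :
    {τ : Micro | hull τ.verts ⊆ s}.Finite := by
  obtain ⟨r, hr⟩ := hs.subset_closedBall 0
  refine ((finite_norm_pos_le r).prod (Set.finite_univ (α := Bool))).subset fun τ hτ => ?_
  refine ⟨?_, Set.mem_univ _⟩
  simpa using hr (hτ (Micro.pos_mem_hull (by simp [Micro.sites])))

lemma finite_near : {τ : Micro | hull τ.verts ⊆ Metric.cthickening 2 S.mesh.domain}.Finite :=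
  finite_micro_of_bounded (Triangulation.isCompact_domain (M := S.mesh)).isBounded.cthickening

end Coupling

/-! ### A discrete Poincaré inequality -/

lemma norm_sub_sq_le_sum_Ico {g : ℤ → Plane} {a b : ℤ} (hab : a ≤ b) :
    ‖g b - g a‖ ^ 2 ≤ (b - a) * ∑ k ∈ Finset.Ico a b, ‖g (k + 1) - g k‖ ^ 2 := by
  have h1 : g b - g a = ∑ k ∈ Finset.Ico a b, (g (k + 1) - g k) := by
    induction b, hab using Int.leInduction with
    | base => simp
    | succ b hab ih =>
      have : Finset.Ico a (b + 1) = insert b (Finset.Ico a b) := by ext; simp; omega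
      rw [this, Finset.sum_insert (by simp), ← ih]
      abel
  have h2 : ‖g b - g a‖ ≤ ∑ k ∈ Finset.Ico a b, ‖g (k + 1) - g k‖ := by
    rw [h1]; exact norm_sum_le _ _
  calc ‖g b - g a‖ ^ 2 ≤ (∑ k ∈ Finset.Ico a b, ‖g (k + 1) - g k‖) ^ 2 := by gcongr
    _ ≤ (Finset.Ico a b).card * ∑ k ∈ Finset.Ico a b, ‖g (k + 1) - g k‖ ^ 2 :=
      sq_sum_le_card_mul_sum_sq
    _ = _ := by
      have hc : (((Finset.Ico a b).card : ℤ) : ℝ) = ((b - a : ℤ) : ℝ) := by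
        rw [Int.card_Ico, Int.toNat_of_nonneg (by omega)]
      push_cast at hc
      rw [hc]

lemma norm_sub_sq_le_sum_Icc {g : ℤ → Plane} {n : ℕ} {a b : ℤ}
    (ha : a ∈ Finset.Icc (-(n : ℤ)) n) (hb : b ∈ Finset.Icc (-(n : ℤ)) n) :
    ‖g b - g a‖ ^ 2 ≤
      (2 * n + 1) * ∑ k ∈ Finset.Icc (-(n : ℤ)) n, ‖g (k + 1) - g k‖ ^ 2 := by
  have key : ∀ a ∈ Finset.Icc (-(n : ℤ)) n, ∀ b ∈ Finset.Icc (-(n : ℤ)) n, a ≤ b →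
      ‖g b - g a‖ ^ 2 ≤
        (2 * n + 1) * ∑ k ∈ Finset.Icc (-(n : ℤ)) n, ‖g (k + 1) - g k‖ ^ 2 := by
    intro a ha b hb hab
    rw [Finset.mem_Icc] at ha hb
    have h1 : ((b - a : ℤ) : ℝ) ≤ ((2 * n + 1 : ℤ) : ℝ) := by
      rw [Int.cast_le]; omega
    push_cast at h1
    refine (norm_sub_sq_le_sum_Ico hab).trans (mul_le_mul h1 ?_
      (Finset.sum_nonneg fun _ _ => sq_nonneg _) (by positivity))
    refine Finset.sum_le_sum_of_subset_of_nonneg (fun k hk => ?_) fun _ _ _ => sq_nonneg _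
    rw [Finset.mem_Ico] at hk
    rw [Finset.mem_Icc]
    omega
  rcases le_total a b with h | h
  · exact key a ha b hb h
  · rw [norm_sub_rev]; exact key b hb a ha h

lemma card_Icc_neg (n : ℕ) : ((Finset.Icc (-(n : ℤ)) n).card : ℝ) = 2 * n + 1 := by
  have : (((Finset.Icc (-(n : ℤ)) n).card : ℤ) : ℝ) = ((2 * n + 1 : ℤ) : ℝ) := by
    rw [Int.card_Icc, Int.toNat_of_nonneg (by omega)]; congr 1; ring
  push_cast at this
  exact this

/-- A discrete Poincaré inequality on a box, with a suitable value of the function in place of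
its mean. -/
lemma exists_sum_norm_sub_sq_le (f : Site → Plane) (D : Site → ℝ)
    (h1 : ∀ ξ, ‖f (ξ + (1, 0)) - f ξ‖ ^ 2 ≤ D ξ) (h2 : ∀ ξ, ‖f (ξ + (0, 1)) - f ξ‖ ^ 2 ≤ D ξ)
    (n : ℕ) :
    ∃ a, ∑ x ∈ box n, ‖f x - a‖ ^ 2 ≤ 4 * (2 * n + 1) ^ 2 * ∑ x ∈ box n, D x := by
  set I := Finset.Icc (-(n : ℤ)) n with hI
  set m : ℝ := 2 * n + 1 with hm
  have hcard : (I.card : ℝ) = m := card_Icc_neg n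
  have hbcard : ((box n).card : ℝ) = m * m := by
    rw [box, Finset.card_product, Nat.cast_mul, ← hI, hcard]
  have hm0 : 0 < m := by positivity
  have hpt : ∀ a ∈ I, ∀ b ∈ I, ∀ a' ∈ I, ∀ b' ∈ I, ‖f (a, b) - f (a', b')‖ ^ 2 ≤
      2 * m * (∑ k ∈ I, D (k, b) + ∑ k ∈ I, D (a', k)) := by
    intro a ha b hb a' ha' b' hb'
    have e1 := norm_sub_sq_le_sum_Icc (g := fun k => f (k, b)) ha' ha
    have e2 := norm_sub_sq_le_sum_Icc (g := fun k => f (a', k)) hb' hb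
    have d1 : ∑ k ∈ I, ‖f (k + 1, b) - f (k, b)‖ ^ 2 ≤ ∑ k ∈ I, D (k, b) :=
      Finset.sum_le_sum fun k _ => by simpa using h1 (k, b)
    have d2 : ∑ k ∈ I, ‖f (a', k + 1) - f (a', k)‖ ^ 2 ≤ ∑ k ∈ I, D (a', k) :=
      Finset.sum_le_sum fun k _ => by simpa using h2 (a', k)
    have e1' := e1.trans (mul_le_mul_of_nonneg_left d1 hm0.le)
    have e2' := e2.trans (mul_le_mul_of_nonneg_left d2 hm0.le)
    have t : ‖f (a, b) - f (a', b')‖ ≤ ‖f (a, b) - f (a', b)‖ + ‖f (a', b) - f (a', b')‖ :=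
      norm_sub_le_norm_sub_add_norm_sub _ _ _
    have t2 : ‖f (a, b) - f (a', b')‖ ^ 2 ≤
        (‖f (a, b) - f (a', b)‖ + ‖f (a', b) - f (a', b')‖) ^ 2 := by gcongr
    nlinarith [sq_nonneg (‖f (a, b) - f (a', b)‖ - ‖f (a', b) - f (a', b')‖)]
  have hsum : ∑ x' ∈ box n, ∑ x ∈ box n, ‖f x - f x'‖ ^ 2 ≤
      ∑ _x' ∈ box n, 4 * m ^ 2 * ∑ x ∈ box n, D x := by
    have hle : ∀ x' ∈ box n, ∑ x ∈ box n, ‖f x - f x'‖ ^ 2 ≤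
        2 * m ^ 2 * ∑ x ∈ box n, D x + 2 * m ^ 3 * ∑ k ∈ I, D (x'.1, k) := by
      intro x' hx'
      obtain ⟨ha', hb'⟩ := Finset.mem_product.1 hx'
      calc _ ≤ ∑ x ∈ box n, 2 * m * (∑ k ∈ I, D (k, x.2) + ∑ k ∈ I, D (x'.1, k)) := by
            refine Finset.sum_le_sum fun x hx => ?_
            obtain ⟨ha, hb⟩ := Finset.mem_product.1 hx
            exact hpt _ ha _ hb _ ha' _ hb'
        _ = _ := by
            rw [← Finset.mul_sum, Finset.sum_add_distrib, Finset.sum_const, nsmul_eq_mul, hbcard]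
            have : ∑ x ∈ box n, ∑ k ∈ I, D (k, x.2) = m * ∑ x ∈ box n, D x := by
              rw [box, Finset.sum_product, Finset.sum_product_right, ← hI]
              simp only [Finset.sum_const, nsmul_eq_mul, hcard]
            rw [this]
            ring
    refine (Finset.sum_le_sum hle).trans_eq ?_
    rw [Finset.sum_add_distrib, Finset.sum_const, Finset.sum_const, ← Finset.mul_sum,
      nsmul_eq_mul, nsmul_eq_mul, hbcard]
    have : ∑ x ∈ box n, ∑ k ∈ I, D (x.1, k) = m * ∑ x ∈ box n, D x := by
      rw [box, Finset.sum_product, Finset.sum_product, ← hI, Finset.mul_sum]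
      refine Finset.sum_congr rfl fun a _ => ?_
      simp only [Finset.sum_const, nsmul_eq_mul, hcard]
    rw [this]
    ring
  have hne : (box n).Nonempty := ⟨0, by simp [box]⟩
  obtain ⟨x', -, hx'⟩ := Finset.exists_le_of_sum_le hne hsum
  exact ⟨f x', hx'⟩

/-! ### Cutoff -/

lemma norm_sub_sq_le_frobSq (v : Site → Plane) {τ : Micro} {ℓ : Site} {j : Fin 6}
    (hℓ : ℓ ∈ τ.sites) (hj : ℓ + dir j ∈ τ.sites) :
    ‖v (ℓ + dir j) - v ℓ‖ ^ 2 ≤ frobSq (microGrad v τ) := by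
  have h := mulVec_sq_le (microGrad v τ) (nn j)
  rw [norm_nn, one_pow, mul_one] at h
  refine le_trans (le_of_eq ?_) h
  have e : nn j = pos (ℓ + dir j) - pos ℓ := by rw [pos_add, nn]; abel
  rw [norm_sq_plane, Fin.sum_univ_two, e, microGrad_mulVec_sub v τ hℓ hj,
    microGrad_mulVec_sub v τ hℓ hj]
  rfl

lemma frobSq_microGrad_le (w : Site → Plane) (τ : Micro) : frobSq (microGrad w τ) ≤
    4 * (‖w (τ.1 + (τ.sgn, 0)) - w τ.1‖ ^ 2 + ‖w (τ.1 + (0, τ.sgn)) - w τ.1‖ ^ 2) := by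
  have h3 := sqrt_three_sq
  have hs : (τ.sgn : ℝ) ^ 2 = 1 := by rw [sq]; exact τ.sgn_mul_self
  simp only [frobSq, Fin.sum_univ_two, microGrad_apply_zero, microGrad_apply_one, norm_sq_plane,
    div_pow, mul_pow, h3, hs, PiLp.sub_apply]
  set a := w (τ.1 + (τ.sgn, 0)) 0 - w τ.1 0
  set b := w (τ.1 + (τ.sgn, 0)) 1 - w τ.1 1
  set c := w (τ.1 + (0, τ.sgn)) 0 - w τ.1 0
  set d := w (τ.1 + (0, τ.sgn)) 1 - w τ.1 1
  nlinarith [sq_nonneg (2 * c + a), sq_nonneg (2 * d + b), sq_nonneg a, sq_nonneg b, sq_nonneg c,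
    sq_nonneg d]

lemma Micro.fst_mem_sites (τ : Micro) : τ.1 ∈ τ.sites := by simp [Micro.sites]

/-- The lattice directions of the edges of a micro-triangle at its base point. -/
lemma Micro.exists_dir (τ : Micro) :
    (∃ j, ((τ.sgn, 0) : Site) = dir j) ∧ ∃ j, ((0, τ.sgn) : Site) = dir j := by
  obtain ⟨ξ, b⟩ := τ
  cases b
  · exact ⟨⟨3, by simp [Micro.sgn, dir]⟩, 2, by simp [Micro.sgn, dir]⟩
  · exact ⟨⟨0, by simp [Micro.sgn, dir]⟩, 5, by simp [Micro.sgn, dir]⟩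

lemma microGrad_sub (v w : Site → Plane) (τ : Micro) :
    microGrad (v - w) τ = microGrad v τ - microGrad w τ := by
  have := microGrad_add v ((-1 : ℝ) • w) τ
  rw [microGrad_smul] at this
  simpa [sub_eq_add_neg] using this

lemma microGrad_eq_zero_of_le_norm {w : Site → Plane} {r : ℝ}
    (hw : ∀ ℓ, r - 1 ≤ ‖pos ℓ‖ → w ℓ = 0) {τ : Micro} {x : Plane} (hx : x ∈ hull τ.verts)
    (hr : r ≤ ‖x‖) : microGrad w τ = 0 := by
  refine microGrad_eq_zero (c := 0) fun ℓ hℓ => hw ℓ ?_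
  have h1 := τ.dist_le_one hx (Micro.pos_mem_hull hℓ)
  rw [dist_eq_norm] at h1
  linarith [norm_sub_norm_le x (pos ℓ)]

/-- The radial cutoff function. -/
def cutoff (R : ℝ) (x : Plane) : ℝ := max 0 (min 1 ((R - 1 - ‖x‖) / (R / 2 - 2)))

lemma cutoff_eq_one {R : ℝ} (hR : 6 < R) {x : Plane} (hx : ‖x‖ ≤ R / 2 + 1) : cutoff R x = 1 := by
  have : 1 ≤ (R - 1 - ‖x‖) / (R / 2 - 2) := by
    rw [le_div_iff₀ (by linarith)]; linarith
  rw [cutoff, min_eq_left this]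
  simp

lemma cutoff_eq_zero {R : ℝ} (hR : 6 < R) {x : Plane} (hx : R - 1 ≤ ‖x‖) : cutoff R x = 0 := by
  have : (R - 1 - ‖x‖) / (R / 2 - 2) ≤ 0 :=
    div_nonpos_of_nonpos_of_nonneg (by linarith) (by linarith)
  exact max_eq_left ((min_le_right _ _).trans this)

lemma abs_cutoff_sub_le {R : ℝ} (hR : 6 < R) (x y : Plane) : |cutoff R x - cutoff R y| ≤ 6 / R * ‖x - y‖ := by
  have h1 : |cutoff R x - cutoff R y| ≤
      |(R - 1 - ‖x‖) / (R / 2 - 2) - (R - 1 - ‖y‖) / (R / 2 - 2)| := by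
    have := abs_max_sub_max_le_abs (min 1 ((R - 1 - ‖x‖) / (R / 2 - 2)))
      (min 1 ((R - 1 - ‖y‖) / (R / 2 - 2))) 0
    rw [max_comm _ 0, max_comm _ 0] at this
    refine this.trans ?_
    have := abs_min_sub_min_le_max 1 ((R - 1 - ‖x‖) / (R / 2 - 2)) 1 ((R - 1 - ‖y‖) / (R / 2 - 2))
    simpa using this
  refine h1.trans ?_
  have h2 : (R - 1 - ‖x‖) / (R / 2 - 2) - (R - 1 - ‖y‖) / (R / 2 - 2) =
      (‖y‖ - ‖x‖) / (R / 2 - 2) := by ring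
  rw [h2, abs_div, abs_of_pos (show 0 < R / 2 - 2 by linarith)]
  have h3 : |‖y‖ - ‖x‖| ≤ ‖x - y‖ := by
    rw [norm_sub_rev]; exact abs_norm_sub_norm_le y x
  rw [div_le_iff₀ (by linarith)]
  have h4 : 1 ≤ 6 / R * (R / 2 - 2) := by
    rw [div_mul_eq_mul_div, le_div_iff₀ (by linarith)]; linarith
  nlinarith [norm_nonneg (x - y)]

lemma abs_cutoff_le_one (R : ℝ) (x : Plane) : |cutoff R x| ≤ 1 := by
  rw [abs_of_nonneg (le_max_left _ _)]
  exact max_le zero_le_one (min_le_left _ _)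

/-- The effect of the cutoff on a finite difference. -/
lemma norm_cutoff_sub_sq_le {R : ℝ} (hR : 6 < R) (v : Site → Plane) (a : Plane) (ℓ : Site)
    (j : Fin 6) :
    ‖cutoff R (pos (ℓ + dir j)) • (v (ℓ + dir j) - a) - cutoff R (pos ℓ) • (v ℓ - a)‖ ^ 2 ≤
      2 * ‖v (ℓ + dir j) - v ℓ‖ ^ 2 + 72 / R ^ 2 * ‖v ℓ - a‖ ^ 2 := by
  have e : cutoff R (pos (ℓ + dir j)) • (v (ℓ + dir j) - a) - cutoff R (pos ℓ) • (v ℓ - a) =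
      cutoff R (pos (ℓ + dir j)) • (v (ℓ + dir j) - v ℓ) +
        (cutoff R (pos (ℓ + dir j)) - cutoff R (pos ℓ)) • (v ℓ - a) := by
    module
  have h1 : ‖cutoff R (pos (ℓ + dir j)) • (v (ℓ + dir j) - v ℓ)‖ ≤ ‖v (ℓ + dir j) - v ℓ‖ := by
    rw [norm_smul, Real.norm_eq_abs]
    exact mul_le_of_le_one_left (norm_nonneg _) (abs_cutoff_le_one _ _)
  have h2 : ‖(cutoff R (pos (ℓ + dir j)) - cutoff R (pos ℓ)) • (v ℓ - a)‖ ≤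
      6 / R * ‖v ℓ - a‖ := by
    rw [norm_smul, Real.norm_eq_abs]
    refine mul_le_mul_of_nonneg_right ?_ (norm_nonneg _)
    have := abs_cutoff_sub_le hR (pos (ℓ + dir j)) (pos ℓ)
    rwa [pos_add, add_sub_cancel_left, show ‖pos (dir j)‖ = 1 from norm_nn j, mul_one,
      ← pos_add] at this
  rw [e]
  have h3 := (norm_add_le (cutoff R (pos (ℓ + dir j)) • (v (ℓ + dir j) - v ℓ))
    ((cutoff R (pos (ℓ + dir j)) - cutoff R (pos ℓ)) • (v ℓ - a))).trans (add_le_add h1 h2)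
  calc _ ≤ (‖v (ℓ + dir j) - v ℓ‖ + 6 / R * ‖v ℓ - a‖) ^ 2 := by gcongr
    _ ≤ 2 * ‖v (ℓ + dir j) - v ℓ‖ ^ 2 + 2 * (6 / R * ‖v ℓ - a‖) ^ 2 := by
      nlinarith [sq_nonneg (‖v (ℓ + dir j) - v ℓ‖ - 6 / R * ‖v ℓ - a‖)]
    _ = _ := by ring

lemma frobSq_microGrad_cutoff_le {R : ℝ} (hR : 6 < R) (v : Site → Plane) (a : Plane)
    (τ : Micro) :
    frobSq (microGrad (fun ℓ => cutoff R (pos ℓ) • (v ℓ - a)) τ) ≤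
      16 * frobSq (microGrad v τ) + 576 / R ^ 2 * ‖v τ.1 - a‖ ^ 2 := by
  refine (frobSq_microGrad_le _ τ).trans ?_
  obtain ⟨⟨j, hj⟩, k, hk⟩ := τ.exists_dir
  have h0 := τ.fst_mem_sites
  have h1 : τ.1 + dir j ∈ τ.sites := by simp [Micro.sites, ← hj]
  have h2 : τ.1 + dir k ∈ τ.sites := by simp [Micro.sites, ← hk]
  rw [hj, hk]
  have a1 := norm_cutoff_sub_sq_le hR v a τ.1 j
  have a2 := norm_cutoff_sub_sq_le hR v a τ.1 k
  have b1 := norm_sub_sq_le_frobSq v h0 h1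
  have b2 := norm_sub_sq_le_frobSq v h0 h2
  have e : 576 / R ^ 2 * ‖v τ.1 - a‖ ^ 2 = 8 * (72 / R ^ 2 * ‖v τ.1 - a‖ ^ 2) := by ring
  rw [e]
  linarith

/-- Truncation of a lattice function, with a bound that does not depend on the radius. -/
lemma exists_truncation {R : ℝ} (hR : 6 < R) {v : Site → Plane} (hv : v ∈ energySpace) :
    ∃ w : Site → Plane, (∀ ℓ, R - 1 ≤ ‖pos ℓ‖ → w ℓ = 0) ∧
      (∀ τ : Micro, (∀ ℓ ∈ τ.sites, ‖pos ℓ‖ ≤ R / 2 + 1) → microGrad w τ = microGrad v τ) ∧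
      gradNorm w ≤ 400 * gradNorm v := by
  obtain ⟨n, hn, hn'⟩ : ∃ n : ℕ, 2 * R ≤ n ∧ (n : ℝ) < 2 * R + 1 :=
    ⟨⌈2 * R⌉₊, Nat.le_ceil _, Nat.ceil_lt_add_one (by linarith)⟩
  obtain ⟨a, ha⟩ := exists_sum_norm_sub_sq_le v (fun ξ => frobSq (microGrad v (ξ, true)))
    (fun ξ => norm_sub_sq_le_frobSq v (τ := (ξ, true)) (ℓ := ξ) (j := 0)
      (by simp [Micro.sites]) (by simp [Micro.sites, Micro.sgn, dir]))
    (fun ξ => norm_sub_sq_le_frobSq v (τ := (ξ, true)) (ℓ := ξ) (j := 5)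
      (by simp [Micro.sites]) (by simp [Micro.sites, Micro.sgn, dir])) n
  set w : Site → Plane := fun ℓ => cutoff R (pos ℓ) • (v ℓ - a) with hw
  have hw0 : ∀ ℓ, R - 1 ≤ ‖pos ℓ‖ → w ℓ = 0 := fun ℓ hℓ => by
    simp [hw, cutoff_eq_zero hR hℓ]
  refine ⟨w, hw0, ?_, ?_⟩
  · intro τ hτ
    rw [← sub_eq_zero, ← microGrad_sub]
    refine microGrad_eq_zero (c := -a) fun ℓ hℓ => ?_
    rw [Pi.sub_apply, hw]
    simp only [cutoff_eq_one hR (hτ ℓ hℓ), one_smul]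
    abel
  · set Q : Finset Micro := box n ×ˢ Finset.univ with hQ
    have hG0 : 0 ≤ ∑' τ : Micro, area τ.verts * frobSq (microGrad v τ) :=
      tsum_nonneg fun τ => mul_nonneg (area_nonneg _) (frobSq_nonneg _)
    set G := ∑' τ : Micro, area τ.verts * frobSq (microGrad v τ) with hG
    have hsupp : ∀ τ ∉ Q, area τ.verts * frobSq (microGrad w τ) = 0 := by
      intro τ hτ
      have h1 : R < ‖pos τ.1‖ := by
        by_contra! h
        exact hτ (by simp [hQ, mem_box (n := n) (by linarith : 2 * ‖pos τ.1‖ ≤ n)])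
      rw [microGrad_eq_zero_of_le_norm hw0 (Micro.pos_mem_hull τ.fst_mem_sites) h1.le]
      simp [frobSq]
    have hQv : ∑ τ ∈ Q, area τ.verts * frobSq (microGrad v τ) ≤ G :=
      Summable.sum_le_tsum Q (fun τ _ => mul_nonneg (area_nonneg _) (frobSq_nonneg _)) hv
    have hbox : Real.sqrt 3 / 4 * ∑ ξ ∈ box n, frobSq (microGrad v (ξ, true)) ≤ G := by
      refine le_trans ?_ hQv
      rw [hQ, Finset.sum_product, Finset.mul_sum]
      refine Finset.sum_le_sum fun ξ _ => ?_
      rw [Fintype.sum_bool, Micro.area_verts]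
      exact le_add_of_nonneg_right (mul_nonneg (area_nonneg _) (frobSq_nonneg _))
    have hsum : ∑' τ : Micro, area τ.verts * frobSq (microGrad w τ) ≤ 400 ^ 2 * G := by
      rw [tsum_eq_sum hsupp]
      calc ∑ τ ∈ Q, area τ.verts * frobSq (microGrad w τ)
          ≤ ∑ τ ∈ Q, (16 * (area τ.verts * frobSq (microGrad v τ)) +
              Real.sqrt 3 / 4 * (576 / R ^ 2) * ‖v τ.1 - a‖ ^ 2) := by
            refine Finset.sum_le_sum fun τ _ => ?_
            have := mul_le_mul_of_nonneg_left (frobSq_microGrad_cutoff_le hR v a τ)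
              (area_nonneg τ.verts)
            refine this.trans_eq ?_
            rw [Micro.area_verts]
            ring
        _ = 16 * ∑ τ ∈ Q, area τ.verts * frobSq (microGrad v τ) +
              Real.sqrt 3 / 4 * (576 / R ^ 2) * (2 * ∑ x ∈ box n, ‖v x - a‖ ^ 2) := by
            rw [Finset.sum_add_distrib, ← Finset.mul_sum, ← Finset.mul_sum]
            congr 2
            rw [hQ, Finset.sum_product, Finset.mul_sum]
            refine Finset.sum_congr rfl fun x _ => ?_
            rw [Fintype.sum_bool]; ring
        _ ≤ 16 * G + Real.sqrt 3 / 4 * (576 / R ^ 2) *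
              (2 * (4 * (5 * R) ^ 2 * ∑ x ∈ box n, frobSq (microGrad v (x, true)))) := by
            have hD : 0 ≤ ∑ x ∈ box n, frobSq (microGrad v (x, true)) :=
              Finset.sum_nonneg fun _ _ => frobSq_nonneg _
            have hm : (2 * (n : ℝ) + 1) ^ 2 ≤ (5 * R) ^ 2 := by
              have : 2 * (n : ℝ) + 1 ≤ 5 * R := by linarith
              gcongr
            have := ha.trans (mul_le_mul_of_nonneg_right
              (mul_le_mul_of_nonneg_left hm (by norm_num)) hD)
            gcongr
        _ = 16 * G + 115200 *
              (Real.sqrt 3 / 4 * ∑ x ∈ box n, frobSq (microGrad v (x, true))) := by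
            have : R ≠ 0 := by linarith
            field_simp
            ring
        _ ≤ 400 ^ 2 * G := by linarith
    calc gradNorm w ≤ Real.sqrt (400 ^ 2 * G) := Real.sqrt_le_sqrt hsum
      _ = 400 * gradNorm v := by
        rw [Real.sqrt_mul (by norm_num), Real.sqrt_sq (by norm_num)]; rfl

/-! ### Density of displacements with compactly supported gradient -/

lemma compactGrad_of_eq_zero {w : Site → Plane} {r : ℝ}
    (hw : ∀ ℓ, r - 1 ≤ ‖pos ℓ‖ → w ℓ = 0) : CompactGrad w := by
  refine ((finite_norm_pos_le r).prod (Set.finite_univ (α := Bool))).subset fun τ hτ => ?_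
  refine ⟨?_, Set.mem_univ _⟩
  by_contra h
  exact hτ (microGrad_eq_zero_of_le_norm hw (Micro.pos_mem_hull (Micro.fst_mem_sites τ))
    (not_le.1 h).le)

/-- Displacements with compactly supported gradient. -/
def compactSpace : Submodule ℝ energySpace where
  carrier := {v | CompactGrad v}
  add_mem' {v w} hv hw := (hv.union hw).subset fun τ hτ => by
    by_contra! h
    simp only [Set.mem_union, not_or, Set.mem_ofPred_eq, not_not] at h
    exact hτ (by rw [Submodule.coe_add, microGrad_add, h.1, h.2, add_zero])
  zero_mem' := by
    refine Set.Finite.subset Set.finite_empty fun τ hτ => hτ ?_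
    exact microGrad_eq_zero (c := 0) fun _ _ => rfl
  smul_mem' c v hv := hv.subset fun τ hτ h => hτ (by
    rw [Submodule.coe_smul, microGrad_smul, h, smul_zero])

/-- The space of square-summable matrix fields. -/
abbrev GradSpace : Type := lp (fun _ : Micro => EuclideanSpace ℝ (Fin 2 × Fin 2)) 2

/-- The weighted gradient field of a lattice function. -/
def gradField (v : Site → Plane) (τ : Micro) : EuclideanSpace ℝ (Fin 2 × Fin 2) :=
  Real.sqrt (area τ.verts) • WithLp.toLp 2 fun k => microGrad v τ k.1 k.2

lemma norm_gradField_sq (v : Site → Plane) (τ : Micro) :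
    ‖gradField v τ‖ ^ 2 = area τ.verts * frobSq (microGrad v τ) := by
  rw [gradField, norm_smul, mul_pow, EuclideanSpace.norm_sq_eq, Real.norm_eq_abs, sq_abs,
    Real.sq_sqrt (area_nonneg _), frobSq, Fintype.sum_prod_type]
  simp

lemma memℓp_gradField {v : Site → Plane} (hv : v ∈ energySpace) : Memℓp (gradField v) 2 := by
  apply memℓp_gen
  have : Summable fun τ : Micro => area τ.verts * frobSq (microGrad v τ) := hv
  simpa [norm_gradField_sq] using this

/-- The isometric embedding of the energy space into the square-summable fields. -/
def gradMap : energySpace →ₗ[ℝ] GradSpace where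
  toFun v := ⟨gradField v, memℓp_gradField v.2⟩
  map_add' v w := by
    ext τ k
    change _ = gradField v τ k + gradField w τ k
    simp [gradField, microGrad_add, mul_add]
  map_smul' c v := by
    ext τ k
    simp [gradField, microGrad_smul]
    ring

lemma gradMap_apply (v : energySpace) (τ : Micro) : gradMap v τ = gradField v τ := rfl

lemma norm_gradMap (v : energySpace) : ‖gradMap v‖ = gradNorm v := by
  have h := lp.norm_rpow_eq_tsum (p := 2) (by norm_num) (gradMap v)
  simp only [gradMap_apply, ENNReal.toReal_ofNat, Real.rpow_ofNat, norm_gradField_sq] at h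
  rw [gradNorm, ← h, Real.sqrt_sq (norm_nonneg _)]

lemma gradNorm_sub_le (v w : energySpace) :
    gradNorm ((v - w : energySpace) : Site → Plane) ≤ gradNorm v + gradNorm w := by
  simp only [← norm_gradMap, map_sub]
  exact norm_sub_le _ _

lemma exists_compact_eq_on (v : energySpace) (s : Finset Micro) :
    ∃ w ∈ compactSpace, (∀ τ ∈ s, gradMap (v - w) τ = 0) ∧
      gradNorm w ≤ 400 * gradNorm v := by
  set R := 7 + 2 * ∑ τ ∈ s, ‖pos τ.1‖ with hRdef
  have hs0 : 0 ≤ ∑ τ ∈ s, ‖pos τ.1‖ := Finset.sum_nonneg fun _ _ => norm_nonneg _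
  have hR : 6 < R := by linarith
  obtain ⟨w, h0, h1, h2⟩ := exists_truncation hR v.2
  have hc := compactGrad_of_eq_zero h0
  refine ⟨⟨w, hc.mem_energySpace⟩, hc, fun τ hτ => ?_, h2⟩
  have hz : microGrad (v - w : Site → Plane) τ = 0 := by
    rw [microGrad_sub, h1 τ, sub_self]
    intro ℓ hℓ
    have a := τ.dist_le_one (Micro.pos_mem_hull hℓ) (Micro.pos_mem_hull τ.fst_mem_sites)
    rw [dist_eq_norm] at a
    have b := norm_sub_norm_le (pos ℓ) (pos τ.1)
    have c := Finset.single_le_sum (f := fun τ : Micro => ‖pos τ.1‖) (fun _ _ => norm_nonneg _) hτ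
    linarith
  rw [gradMap_apply, gradField, Submodule.coe_sub, hz]
  ext k
  simp

lemma gradMap_mem_closure (v : energySpace) :
    gradMap v ∈ (compactSpace.map gradMap).topologicalClosure := by
  set K := (compactSpace.map gradMap).topologicalClosure with hK
  have : CompleteSpace K := (Submodule.isClosed_topologicalClosure _).completeSpace_coe
  obtain ⟨r, hr⟩ : ∃ r, r = gradMap v - K.starProjection (gradMap v) := ⟨_, rfl⟩
  have hrK : ∀ x ∈ K, inner ℝ r x = 0 := fun x hx => by
    rw [hr]; exact Submodule.starProjection_inner_eq_zero (gradMap v) x hx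
  have hrv : inner ℝ r (gradMap v) = 0 := by
    have hbound : ∀ s : Finset Micro, |inner ℝ r (gradMap v)| ≤
        ‖r - ∑ τ ∈ s, lp.single 2 τ (r τ)‖ * (401 * gradNorm v) := by
      intro s
      obtain ⟨w, hw, he, hn⟩ := exists_compact_eq_on v s
      have hw0 : inner ℝ r (gradMap w) = 0 :=
        hrK _ (Submodule.le_topologicalClosure _ (Submodule.mem_map_of_mem hw))
      have hs0 : inner ℝ (∑ τ ∈ s, lp.single 2 τ (r τ)) (gradMap (v - w)) = 0 := by
        rw [sum_inner]
        refine Finset.sum_eq_zero fun τ hτ => ?_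
        rw [lp.inner_single_left, he τ hτ, inner_zero_right]
      have e : inner ℝ r (gradMap v) =
          inner ℝ (r - ∑ τ ∈ s, lp.single 2 τ (r τ)) (gradMap (v - w)) := by
        rw [inner_sub_left, hs0, sub_zero, map_sub, inner_sub_right, hw0, sub_zero]
      rw [e]
      refine (abs_real_inner_le_norm _ _).trans (mul_le_mul_of_nonneg_left ?_ (norm_nonneg _))
      rw [norm_gradMap]
      linarith [gradNorm_sub_le v w]
    have ht : Tendsto (fun s : Finset Micro =>
        ‖r - ∑ τ ∈ s, lp.single 2 τ (r τ)‖ * (401 * gradNorm v)) atTop (𝓝 0) := by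
      have h := (lp.hasSum_single (p := 2) (by norm_num) r)
      have h2 : Tendsto (fun s : Finset Micro => ‖r - ∑ τ ∈ s, lp.single 2 τ (r τ)‖) atTop
          (𝓝 0) := by
        simpa using (tendsto_const_nhds (x := r)).sub h |>.norm
      simpa using h2.mul_const (401 * gradNorm v)
    exact abs_nonpos_iff.1 (ge_of_tendsto' ht hbound)
  have hr0 : inner ℝ r r = 0 := by
    have : inner ℝ r r = inner ℝ r (gradMap v) - inner ℝ r (K.starProjection (gradMap v)) := by
      rw [← inner_sub_right, ← hr]
    rw [this, hrv, hrK _ (Submodule.starProjection_apply_mem _ _), sub_zero]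
  rw [inner_self_eq_zero, hr, sub_eq_zero] at hr0
  rw [hr0]
  exact Submodule.starProjection_apply_mem _ _

lemma exists_compact_gradNorm_sub_lt (v : energySpace) {ε : ℝ} (hε : 0 < ε) :
    ∃ w ∈ compactSpace, gradNorm ((v - w : energySpace) : Site → Plane) < ε := by
  obtain ⟨_, ⟨w, hw, rfl⟩, h⟩ := Metric.mem_closure_iff.1 (gradMap_mem_closure v) ε hε
  refine ⟨w, hw, ?_⟩
  rwa [dist_eq_norm, ← map_sub, norm_gradMap] at h

/-- The first variation is unique. -/
lemma Crystal.IsFirstVariation.unique {X : Crystal} {y : Site → Plane}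
    {L L' : energySpace →ₗ[ℝ] ℝ} (h : X.IsFirstVariation y L) (h' : X.IsFirstVariation y L') :
    L = L' := by
  obtain ⟨⟨K, hK⟩, hd⟩ := h
  obtain ⟨⟨K', hK'⟩, hd'⟩ := h'
  ext v
  have hb : ∀ u, |L u - L' u| ≤ (|K| + |K'|) * gradNorm u := by
    intro u
    have h0 : 0 ≤ gradNorm u := Real.sqrt_nonneg _
    calc |L u - L' u| ≤ |L u| + |L' u| := abs_sub _ _
      _ ≤ K * gradNorm u + K' * gradNorm u := add_le_add (hK u) (hK' u)
      _ ≤ (|K| + |K'|) * gradNorm u := by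
        rw [← add_mul]
        exact mul_le_mul_of_nonneg_right (add_le_add (le_abs_self _) (le_abs_self _)) h0
  have hε : ∀ ε > 0, |L v - L' v| ≤ (|K| + |K'|) * ε := by
    intro ε hε
    obtain ⟨w, hw, hlt⟩ := exists_compact_gradNorm_sub_lt v hε
    have e : L v - L' v = L (v - w) - L' (v - w) := by
      rw [map_sub, map_sub, (hd w hw).unique (hd' w hw)]
      ring
    rw [e]
    exact (hb _).trans (mul_le_mul_of_nonneg_left hlt.le (by positivity))
  have ht : Tendsto (fun ε : ℝ => (|K| + |K'|) * ε) (𝓝[>] 0) (𝓝 0) := by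
    have : Tendsto (fun ε : ℝ => (|K| + |K'|) * ε) (𝓝 0) (𝓝 ((|K| + |K'|) * 0)) :=
      tendsto_id.const_mul _
    rw [mul_zero] at this
    exact this.mono_left nhdsWithin_le_nhds
  have h0 : |L v - L' v| ≤ 0 :=
    ge_of_tendsto ht (eventually_nhdsWithin_of_forall fun ε h => hε ε h)
  exact sub_eq_zero.1 (abs_nonpos_iff.1 h0)

/-! ### The a posteriori error estimate -/

lemma interp_eq_zero_of_le_norm {F : Finset Site} {w : Site → Plane} {r : ℝ}
    (hF : ∀ ℓ ∉ F, w ℓ = 0) (hw : ∀ ℓ, r - 1 ≤ ‖pos ℓ‖ → w ℓ = 0) {x : Plane} (hx : r ≤ ‖x‖)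
    (i : Fin 2) : interp F w i x = 0 := by
  obtain ⟨τ, hτ⟩ := exists_mem_hull x
  have h1 := τ.dist_le_one hτ (Micro.pos_mem_hull τ.fst_mem_sites)
  rw [dist_eq_norm] at h1
  have h2 : r - 1 ≤ ‖pos τ.1‖ := by linarith [norm_sub_norm_le x (pos τ.1)]
  rw [interp_eq hF i τ hτ, hw _ h2, microGrad_eq_zero_of_le_norm hw hτ hx]
  simp

lemma Crystal.hasSum_stressCB (X : Crystal) (B : Plane →L[ℝ] Plane) {w : Site → Plane}
    (hw : CompactGrad w) :
    HasSum (fun τ : Micro => area τ.verts * frob (X.stressCB B) (microGrad w τ)) 0 := by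
  have h := (hasSum_bondSum (fun j => hw.hasSum_dot (X.homForce B j) j)).mul_left (1 / 2)
  convert! h using 1
  · funext τ
    rw [X.stressCB_eq B τ, Crystal.area_mul_frob_stress]
  · simp

namespace Coupling

variable {X : Crystal} (S : Coupling X) {B : Plane →L[ℝ] Plane} {y : Plane → Plane}

lemma shapeRegular_nonneg {κ : ℝ} (hM : S.mesh.ShapeRegular κ) : 0 ≤ κ := by
  have h0 : (0 : Plane) ∈ S.mesh.domain :=
    S.ball_subset (Metric.mem_closedBall_self (by linarith [S.R_gt]))
  obtain ⟨T, hT, -⟩ := Triangulation.mem_domain.1 h0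
  exact nonneg_of_mul_nonneg_left ((sq_nonneg _).trans (hM T hT)) (Triangulation.area_pos hT)

lemma le_norm_of_notMem_interior {x : Plane} (hx : x ∉ interior S.mesh.domain) : S.R ≤ ‖x‖ := by
  by_contra! h
  refine hx (interior_mono S.ball_subset (Metric.ball_subset_interior_closedBall ?_))
  simpa using h

/-- The micro-triangles that are close to the computational domain. -/
def nearMicro : Finset Micro := S.finite_near.toFinset

lemma stressA_eq_of_notMem_nearMicro (hy : S.Admissible B y) {τ : Micro} (hτ : τ ∉ S.nearMicro) :
    X.stressA (y ∘ pos) τ = X.stressCB B :=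
  S.stressA_eq_stressCB hy (by simpa [nearMicro] using hτ)

/-- The truncation error. -/
lemma sum_truncation_le (hy : S.Admissible B y) (u : energySpace)
    (hu : ∀ τ : Micro, (∀ ℓ ∈ τ.sites, ‖pos ℓ‖ ≤ S.R / 2 + 1) → microGrad u τ = 0) :
    X.variation (y ∘ pos) B S.nearMicro u ≤ S.truncation B y * gradNorm u := by
  set a : Micro → ℝ := fun τ => volume.real (hull τ.verts ∩ S.outerStrip) with ha
  have hale : ∀ τ : Micro, a τ ≤ area τ.verts := fun τ =>
    measureReal_mono Set.inter_subset_left (volume_hull_ne_top _)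
  have e : X.variation (y ∘ pos) B S.nearMicro u = ∑ τ ∈ S.nearMicro,
      a τ * frob (X.stressA (y ∘ pos) τ - X.stressCB B) (microGrad u τ) := by
    refine Finset.sum_congr rfl fun τ hτ => ?_
    by_cases h0 : microGrad u τ = 0
    · simp [h0]
    · congr 1
      have hsub : hull τ.verts ⊆ S.outerStrip := by
        intro x hx
        have hn : hull τ.verts ⊆ Metric.cthickening 2 S.mesh.domain := by
          simpa [nearMicro] using hτ
        refine ⟨hn hx, fun hx2 => h0 ?_⟩
        refine hu τ fun ℓ hℓ => ?_
        rw [mem_closedBall_zero_iff] at hx2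
        have h1 := τ.dist_le_one (Micro.pos_mem_hull hℓ) hx
        rw [dist_eq_norm] at h1
        linarith [norm_sub_norm_le (pos ℓ) x]
      rw [ha]
      simp only
      rw [Set.inter_eq_left.2 hsub]
      rfl
  rw [e]
  refine (le_abs_self _).trans ((sum_frob_le _ a (fun τ _ => measureReal_nonneg) _ _).trans ?_)
  refine mul_le_mul (le_of_eq ?_) ?_ (Real.sqrt_nonneg _) (Real.sqrt_nonneg _)
  · rw [truncation, tsum_eq_sum (s := S.nearMicro)]
    intro τ hτ
    rw [S.stressA_eq_of_notMem_nearMicro hy hτ, sub_self]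
    simp [frobSq]
  · refine (Real.sqrt_le_sqrt ?_).trans (sqrt_sum_le_gradNorm u.2 S.nearMicro)
    exact Finset.sum_le_sum fun τ _ => mul_le_mul_of_nonneg_right (hale τ) (frobSq_nonneg _)

/-- The modelling error. -/
lemma sum_modelling_le {w : Site → Plane} (hw : w ∈ energySpace) {Q : Finset Micro}
    (hQ : ∀ τ ∈ Q, hull τ.verts ⊆ S.mesh.domain) :
    ∑ τ ∈ Q, area τ.verts * frob (X.stressA (y ∘ pos) τ - ∑ T ∈ S.mesh.elems,
      (volume.real (hull T ∩ hull τ.verts) / area τ.verts) • S.stressH y T) (microGrad w τ) ≤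
      S.modelling y * gradNorm w := by
  refine (le_abs_self _).trans ((sum_frob_le _ _ (fun τ _ => area_nonneg _) _ _).trans ?_)
  refine mul_le_mul ?_ (sqrt_sum_le_gradNorm hw Q) (Real.sqrt_nonneg _) (Real.sqrt_nonneg _)
  apply Real.sqrt_le_sqrt
  refine (le_of_eq ?_).trans (Summable.sum_le_tsum Q (fun τ _ => ?_) ?_)
  · exact Finset.sum_congr rfl fun τ hτ => (if_pos (hQ τ hτ)).symm
  · by_cases h : hull τ.verts ⊆ S.domain
    · rw [if_pos h]
      exact mul_nonneg (area_nonneg _) (frobSq_nonneg _)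
    · rw [if_neg h]
  · refine summable_of_hasFiniteSupport ((finite_micro_of_bounded
      (Triangulation.isCompact_domain (M := S.mesh)).isBounded).subset fun τ hτ => ?_)
    by_contra h
    exact hτ (if_neg h)

lemma sum_average_stressH (w : Site → Plane) (Q : Finset Micro) :
    ∑ τ ∈ Q, area τ.verts * frob (∑ T ∈ S.mesh.elems,
      (volume.real (hull T ∩ hull τ.verts) / area τ.verts) • S.stressH y T) (microGrad w τ) =
      ∑ T ∈ S.mesh.elems, frob (S.stressH y T) (gradOver Q w T) := by
  simp only [gradOver, frob_sum_right, frob_sum_left, frob_smul_left, frob_smul_right,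
    Finset.mul_sum]
  rw [Finset.sum_comm]
  refine Finset.sum_congr rfl fun T _ => Finset.sum_congr rfl fun τ _ => ?_
  have : area τ.verts ≠ 0 := by
    rw [Micro.area_verts]; have := sqrt_three_pos; positivity
  field_simp

/-- The residual on functions supported in the computational domain. -/
lemma variation_le_of_eq_zero (hy : S.IsSolution B y) {κ : ℝ} (hM : S.mesh.ShapeRegular κ)
    (w : energySpace) (hw : ∀ ℓ, S.R - 1 ≤ ‖pos ℓ‖ → (w : Site → Plane) ℓ = 0) :
    X.variation (y ∘ pos) B S.nearMicro w ≤
      (S.modelling y + coarseConst κ * S.coarsening y) * gradNorm w := by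
  have hc := compactGrad_of_eq_zero hw
  set Q := hc.toFinset with hQdef
  have hQ : ∀ τ ∉ Q, microGrad w τ = 0 := fun τ hτ => by
    by_contra h
    exact hτ (hc.mem_toFinset.2 h)
  have hQsub : ∀ τ ∈ Q, hull τ.verts ⊆ S.mesh.domain := by
    intro τ hτ x hx
    refine S.ball_subset (mem_closedBall_zero_iff.2 ?_)
    by_contra! h
    exact (hc.mem_toFinset.1 hτ) (microGrad_eq_zero_of_le_norm hw hx h.le)
  have e1 : X.variation (y ∘ pos) B S.nearMicro w =
      ∑ τ ∈ Q, area τ.verts * frob (X.stressA (y ∘ pos) τ) (microGrad w τ) := by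
    have h1 : HasSum (fun τ : Micro => area τ.verts *
        frob (X.stressA (y ∘ pos) τ - X.stressCB B) (microGrad w τ))
        (X.variation (y ∘ pos) B S.nearMicro w) :=
      hasSum_sum_of_ne_finset_zero fun τ hτ => by
        rw [S.stressA_eq_of_notMem_nearMicro hy.1 hτ]; simp
    have h2 : HasSum (fun τ : Micro => area τ.verts *
        frob (X.stressA (y ∘ pos) τ) (microGrad w τ)) (∑ τ ∈ Q, area τ.verts *
        frob (X.stressA (y ∘ pos) τ) (microGrad w τ)) :=
      hasSum_sum_of_ne_finset_zero fun τ hτ => by rw [hQ τ hτ]; simp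
    have h3 := h1.add (X.hasSum_stressCB B hc)
    rw [add_zero] at h3
    refine h3.unique ?_
    convert h2 using 2 with τ
    rw [frob_sub_left]
    ring
  have e2 : ∑ τ ∈ Q, area τ.verts * frob (X.stressA (y ∘ pos) τ) (microGrad w τ) =
      ∑ τ ∈ Q, area τ.verts * frob (X.stressA (y ∘ pos) τ - ∑ T ∈ S.mesh.elems,
        (volume.real (hull T ∩ hull τ.verts) / area τ.verts) • S.stressH y T) (microGrad w τ) +
      ∑ T ∈ S.mesh.elems, frob (S.stressH y T) (gradOver Q w T) := by
    rw [← S.sum_average_stressH, ← Finset.sum_add_distrib]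
    refine Finset.sum_congr rfl fun τ _ => ?_
    rw [frob_sub_left]
    ring
  set F := (finite_norm_pos_le S.R).toFinset with hFdef
  have hF : ∀ ℓ ∉ F, (w : Site → Plane) ℓ = 0 := fun ℓ hℓ => by
    have : S.R < ‖pos ℓ‖ := by simpa [hFdef] using hℓ
    exact hw ℓ (by linarith)
  have h3 := S.sum_stressH_gradOver_le hy (S.shapeRegular_nonneg hM) hM hF hQ fun x hx i =>
    interp_eq_zero_of_le_norm hF hw (S.le_norm_of_notMem_interior hx) i
  rw [e1, e2, add_mul]
  refine add_le_add (S.sum_modelling_le w.2 hQsub) (h3.trans ?_)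
  exact mul_le_mul_of_nonneg_left (sqrt_sum_le_gradNorm w.2 Q)
    (mul_nonneg (Real.sqrt_nonneg _) (Real.sqrt_nonneg _))

lemma variation_le (hy : S.IsSolution B y) {κ : ℝ} (hM : S.mesh.ShapeRegular κ)
    (v : energySpace) :
    X.variation (y ∘ pos) B S.nearMicro v ≤
      (401 * S.truncation B y + 401 * S.modelling y +
        Real.sqrt 3 * 401 * (coarseConst κ + 1) * S.coarsening y) * gradNorm v := by
  obtain ⟨w, h0, h1, h2⟩ := exists_truncation S.R_gt v.2
  set w' : energySpace := ⟨w, (compactGrad_of_eq_zero h0).mem_energySpace⟩ with hw'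
  have hT0 : 0 ≤ S.truncation B y := Real.sqrt_nonneg _
  have hM0 : 0 ≤ S.modelling y := Real.sqrt_nonneg _
  have hC0 : 0 ≤ S.coarsening y := Real.sqrt_nonneg _
  have hK0 : 0 ≤ coarseConst κ := Real.sqrt_nonneg _
  have hG0 : 0 ≤ gradNorm v := Real.sqrt_nonneg _
  have a1 := S.sum_truncation_le hy.1 (v - w') fun τ hτ => by
    rw [Submodule.coe_sub, microGrad_sub, hw', h1 τ hτ, sub_self]
  have a2 := S.variation_le_of_eq_zero hy hM w' h0
  have n1 : gradNorm ((v - w' : energySpace) : Site → Plane) ≤ 401 * gradNorm v := by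
    have : gradNorm (w' : Site → Plane) ≤ 400 * gradNorm v := h2
    linarith [gradNorm_sub_le v w']
  have n2 : gradNorm (w' : Site → Plane) ≤ 401 * gradNorm v := h2.trans (by linarith)
  have h3 : 1 ≤ Real.sqrt 3 := Real.one_le_sqrt.2 (by norm_num)
  have hk : coarseConst κ ≤ Real.sqrt 3 * (coarseConst κ + 1) := by nlinarith
  calc X.variation (y ∘ pos) B S.nearMicro v
      = X.variation (y ∘ pos) B S.nearMicro (v - w') +
          X.variation (y ∘ pos) B S.nearMicro w' := by rw [← map_add, sub_add_cancel]
    _ ≤ S.truncation B y * (401 * gradNorm v) +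
          (S.modelling y + Real.sqrt 3 * (coarseConst κ + 1) * S.coarsening y) *
            (401 * gradNorm v) := by
        refine add_le_add (a1.trans (mul_le_mul_of_nonneg_left n1 hT0))
          (a2.trans (mul_le_mul ?_ n2 (Real.sqrt_nonneg _) (by positivity)))
        exact add_le_add le_rfl (mul_le_mul_of_nonneg_right hk hC0)
    _ = _ := by ring

lemma isFirstVariation_variation (hy : S.Admissible B y) :
    X.IsFirstVariation (y ∘ pos) (X.variation (y ∘ pos) B S.nearMicro) :=
  X.isFirstVariation_variation fun _ hτ => S.stressA_eq_of_notMem_nearMicro hy hτ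

end Coupling

end GRAC

end

theorem theorem3p1 :
    ∃ CTr : ℝ, 0 < CTr ∧ ∀ κ : ℝ, ∃ Ccl : ℝ, 0 < Ccl ∧
      ∀ (X : GRAC.Crystal) (S : GRAC.Coupling X) (B : GRAC.Plane →L[ℝ] GRAC.Plane)
        (y : GRAC.Plane → GRAC.Plane),
        S.mesh.ShapeRegular κ → S.IsSolution B y →
        (∃! L : GRAC.energySpace →ₗ[ℝ] ℝ, X.IsFirstVariation (y ∘ GRAC.pos) L) ∧
        ∀ L : GRAC.energySpace →ₗ[ℝ] ℝ, X.IsFirstVariation (y ∘ GRAC.pos) L →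
          ∀ v : GRAC.energySpace,
            L v ≤ (CTr * S.truncation B y + CTr * S.modelling y +
                Real.sqrt 3 * CTr * Ccl * S.coarsening y) *
              GRAC.gradNorm v := by
  refine ⟨401, by norm_num, fun κ => ⟨GRAC.Coupling.coarseConst κ + 1, ?_, ?_⟩⟩
  · have : 0 ≤ GRAC.Coupling.coarseConst κ := Real.sqrt_nonneg _
    linarith
  · intro X S B y hM hy
    have hL := S.isFirstVariation_variation hy.1
    refine ⟨⟨_, hL, fun L' hL' => hL'.unique hL⟩, fun L hL' v => ?_⟩
    rw [hL'.unique hL]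
    exact S.variation_le hy hM v
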